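/- Let $n\ge 2$, let $M$ be a smooth (Hausdorff) manifold of dimension $1+n$ with a smooth Lorentzian metric $g$ of signature $(-,+,\dots,+)$, let $\ell>0$, and let $\gamma_0:[0,\ell]\to M$ be a lightlike geodesic segment. Parametrize the lightlike geodesics near $\gamma_0$ as follows. Let $(t,z)\in(-T,T)\times Z$, with $Z\subset\mathbf R^n$ open and $0\in Z$, be smooth coordinates on an open subset of $M$ in which $g=-dt^2+g'(t,z)$, $g'(t,\cdot)$ Riemannian, and in which $\gamma_0(0)=(0,0)$ and $\dot\gamma_0(0)=(1,\theta_0)$; put $h=g'(0,\cdot)$. Let $A\subset\mathbf R^{n-1}$ be open with $0\in A$, and let $(z,a)\mapsto(z,\theta(z,a))$, $(z,a)\in Z\times A$, be local coordinates on the unit sphere bundle of $(Z,h)$ with $\theta(0,0)=\theta_0$. Let $\gamma_{z,a}$ be the geodesic with $\gamma_{z,a}(0)=(0,z)$ and $\dot\gamma_{z,a}(0)=(1,\theta(z,a))$, so that $\gamma_{0,0}=\gamma_0$; assume that, for some $\varepsilon>0$, it is defined on $(-\varepsilon,\ell+\varepsilon)$ for all $(z,a)\in Z\times A$. Let $\Omega\subset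 M$ be open and relatively compact with $\gamma_0(0),\gamma_0(\ell)\notin\overline\Omega$. For an open set $\mathcal M\subset Z\times A$ containing $(0,0)$, let $C\subset T^*\mathcal M\times T^*\Omega$ be the set of all pairs $\big((z,a,\zeta,\alpha),(x,\xi)\big)$ for which there is $s\in(0,\ell)$ with $$(z,a)\in\mathcal M,\quad x=\gamma_{z,a}(s)\in\Omega,\quad \xi\in T^*_xM\setminus 0,\quad \langle\xi,\dot\gamma_{z,a}(s)\rangle=0,\quad \zeta_j=\langle\xi,\partial_{z^j}\gamma_{z,a}(s)\rangle,\quad \alpha_k=\langle\xi,\partial_{a^k}\gamma_{z,a}(s)\rangle,$$ $j=1,\dots,n$, $k=1,\dots,n-1$. Regard $C$ as a multivalued map from $T^*M$ to $T^*\mathcal M$: $C(x,\xi)$ is the set of all $(z,a,\zeta,\alpha)$ with $\big((z,a,\zeta,\alpha),(x,\xi)\big)\in C$, and $C^{-1}$ is the inverse relation. Let $\Sigma_s\subset T^*M$ be the set of spacelike covectors, $g^{-1}(\xi,\xi)>0$, and let $N^*\gamma_0=\{(\gamma_0(s),\xi) : s\in[0,\ell],\ \langle\xi,\dot\gamma_0(s)\rangle=0\}$.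 Suppose that there are no conjugate points on $\gamma_0$, i.e. that for no $s_1\neq s_2$ in $[0,\ell]$ there is a nonzero Jacobi field along $\gamma_0$ vanishing at $s_1$ and at $s_2$. Then for every sufficiently small open neighborhood $\mathcal M$ of $(0,0)$, that is, for every open $\mathcal M\ni(0,0)$ contained in a certain neighborhood of $(0,0)$ in $Z\times A$, there is a neighborhood $U$ of $\Sigma_s\cap N^*\gamma_0\cap T^*\Omega$ in $\Sigma_s$ such that $$(C^{-1}\circ C)(x,\xi)=\{(x,\xi)\}\qquad\text{for all }(x,\xi)\in U.$$ -/

import Mathlib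

open Set Bundle
open scoped Manifold ContDiff Topology

noncomputable section

namespace LightRay

-- The manifold structure of a vector space is found as `chartedSpaceSelf`, not in this form.
attribute [-instance] TopCat.of.chartedSpace

/-- Coordinate space `ℝᵏ`. -/
abbrev Euc (k : ℕ) : Type := EuclideanSpace ℝ (Fin k)

/-- A smooth Lorentzian metric of signature `(-,+,…,+)` on a manifold `M` of dimension `1 + n`:
a smooth symmetric `2`-tensor such that each tangent space contains a timelike vector whose
orthogonal complement is positive definite. -/
structure LorentzMetric (n : ℕ) (M : Type*) [TopologicalSpace M] [ChartedSpace (Euc (n + 1)) M]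
    [IsManifold (𝓡 (n + 1)) ∞ M] where
  val (x : M) : TangentSpace (𝓡 (n + 1)) x →L[ℝ] TangentSpace (𝓡 (n + 1)) x →L[ℝ] ℝ
  symm (x : M) (v w : TangentSpace (𝓡 (n + 1)) x) : val x v w = val x w v
  contMDiff : ContMDiff (𝓡 (n + 1))
    ((𝓡 (n + 1)).prod 𝓘(ℝ, Euc (n + 1) →L[ℝ] Euc (n + 1) →L[ℝ] ℝ)) ∞
    (fun x ↦ TotalSpace.mk' (Euc (n + 1) →L[ℝ] Euc (n + 1) →L[ℝ] ℝ) x (val x))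
  signature (x : M) : ∃ v : TangentSpace (𝓡 (n + 1)) x, val x v v < 0 ∧
    ∀ w : TangentSpace (𝓡 (n + 1)) x, val x v w = 0 → w ≠ 0 → 0 < val x w w

variable {n : ℕ} {M : Type*} [TopologicalSpace M] [ChartedSpace (Euc (n + 1)) M]

/-- The cotangent space `T*ₓM`. -/
abbrev CotangentSpace (n : ℕ) {M : Type*} [TopologicalSpace M] [ChartedSpace (Euc (n + 1)) M]
    (x : M) : Type :=
  TangentSpace (𝓡 (n + 1)) x →L[ℝ] Bundle.Trivial M ℝ x

variable [IsManifold (𝓡 (n + 1)) ∞ M]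

/-- The cotangent bundle `T*M`, with its vector bundle topology. Its elements are pairs
`⟨x, ξ⟩` with `ξ ∈ T*ₓM`. -/
abbrev CotangentBundle (n : ℕ) (M : Type*) [TopologicalSpace M] [ChartedSpace (Euc (n + 1)) M]
    [IsManifold (𝓡 (n + 1)) ∞ M] : Type _ :=
  TotalSpace (Euc (n + 1) →L[ℝ] ℝ) (fun x : M ↦ CotangentSpace n x)

namespace LorentzMetric

variable (g : LorentzMetric n M)

/-- The vector `ξ_*` obtained from the covector `ξ` by raising the index:
`g (ξ_*, ·) = ξ`. -/
def sharp (x : M) (ξ : TangentSpace (𝓡 (n + 1)) x →L[ℝ] ℝ) : TangentSpace (𝓡 (n + 1)) x :=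
  (g.val x).inverse ξ

/-- The spacelike cone `Σ_s ⊂ T*M`: the covectors `ξ` with `g⁻¹(ξ, ξ) > 0`. -/
def spacelikeCone : Set (CotangentBundle n M) :=
  {p | 0 < g.val p.1 (g.sharp p.1 p.2) (g.sharp p.1 p.2)}

/-! ### Levi-Civita connection and curvature in local coordinates

Everything is written in the chart `extChartAt (𝓡 (n + 1)) x₀`, as functions of a point `y` of
coordinate space (a point of the target of the chart), and all vectors are coordinate vectors. -/

/-- The metric in the chart at `x₀`: the matrix `g_{ij}(y)`, as a bilinear form. -/
def coordMetric (x₀ : M) (y : Euc (n + 1)) : Euc (n + 1) →L[ℝ] Euc (n + 1) →L[ℝ] ℝ :=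
  ContinuousLinearMap.bilinearComp (E := Euc (n + 1)) (F := Euc (n + 1)) (G := ℝ)
    (g.val ((extChartAt (𝓡 (n + 1)) x₀).symm y))
    (mfderiv 𝓘(ℝ, Euc (n + 1)) (𝓡 (n + 1)) (extChartAt (𝓡 (n + 1)) x₀).symm y)
    (mfderiv 𝓘(ℝ, Euc (n + 1)) (𝓡 (n + 1)) (extChartAt (𝓡 (n + 1)) x₀).symm y)

/-- The Christoffel symbols in the chart at `x₀`: `Γ(u, v)^k = Γ^k_{ij} u^i v^j` is the vector with
`g(Γ(u, v), w) = ½ (∂_u g(v, w) + ∂_v g(u, w) - ∂_w g(u, v))` for all `w`. -/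
def christoffel (x₀ : M) (y u v : Euc (n + 1)) : Euc (n + 1) :=
  (g.coordMetric x₀ y).inverse
    ((1 / 2 : ℝ) • (fderiv ℝ (g.coordMetric x₀) y u v + fderiv ℝ (g.coordMetric x₀) y v u
      - ((fderiv ℝ (g.coordMetric x₀) y).flip u).flip v))

/-- The Riemann curvature `R(u, v) w = ∇_u ∇_v w - ∇_v ∇_u w - ∇_{[u, v]} w` in the chart
at `x₀`. -/
def curvature (x₀ : M) (y u v w : Euc (n + 1)) : Euc (n + 1) :=
  fderiv ℝ (fun y' ↦ g.christoffel x₀ y' v w) y u - fderiv ℝ (fun y' ↦ g.christoffel x₀ y' u w) y v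
    + g.christoffel x₀ y u (g.christoffel x₀ y v w)
    - g.christoffel x₀ y v (g.christoffel x₀ y u w)

/-- The covariant derivative `D_s v = v' + Γ(c)(c', v)` along the coordinate curve `c` of the
coordinate vector field `v`, in the chart at `x₀`. -/
def covDerivAlong (x₀ : M) (c v : ℝ → Euc (n + 1)) (s : ℝ) : Euc (n + 1) :=
  deriv v s + g.christoffel x₀ (c s) (deriv c s) (v s)

end LorentzMetric

/-- The representation of the curve `γ` in the chart at `x₀`. -/
def coordCurve (n : ℕ) {M : Type*} [TopologicalSpace M] [ChartedSpace (Euc (n + 1)) M]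
    (x₀ : M) (γ : ℝ → M) (s : ℝ) : Euc (n + 1) :=
  extChartAt (𝓡 (n + 1)) x₀ (γ s)

/-- The representation in the chart at `x₀` of the vector field `J` along the curve `γ`. -/
def coordField (x₀ : M) (γ : ℝ → M) (J : ∀ s : ℝ, TangentSpace (𝓡 (n + 1)) (γ s)) (s : ℝ) :
    Euc (n + 1) :=
  mfderiv (𝓡 (n + 1)) 𝓘(ℝ, Euc (n + 1)) (extChartAt (𝓡 (n + 1)) x₀) (γ s) (J s)

/-- The velocity `γ'(s) ∈ T_{γ(s)}M`. -/
def velocity (n : ℕ) {M : Type*} [TopologicalSpace M] [ChartedSpace (Euc (n + 1)) M]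
    (γ : ℝ → M) (s : ℝ) : TangentSpace (𝓡 (n + 1)) (γ s) :=
  mfderiv 𝓘(ℝ, ℝ) (𝓡 (n + 1)) γ s (1 : ℝ)

/-- `γ` is a geodesic of `g` on the open interval `I`: it is smooth there and satisfies
`D_s γ' = 0` in all charts. -/
def IsGeodesicOn (g : LorentzMetric n M) (γ : ℝ → M) (I : Set ℝ) : Prop :=
  ContMDiffOn 𝓘(ℝ, ℝ) (𝓡 (n + 1)) ∞ γ I ∧
  ∀ x₀ : M, ∀ s ∈ I, γ s ∈ (chartAt (Euc (n + 1)) x₀).source →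
    g.covDerivAlong x₀ (coordCurve n x₀ γ) (deriv (coordCurve n x₀ γ)) s = 0

/-- `J` is a Jacobi field along the geodesic `γ` on the open interval `I`: a smooth vector field
along `γ` which satisfies `D_s D_s J + R(J, γ') γ' = 0` in all charts. -/
def IsJacobiFieldOn (g : LorentzMetric n M) (γ : ℝ → M)
    (J : ∀ s : ℝ, TangentSpace (𝓡 (n + 1)) (γ s)) (I : Set ℝ) : Prop :=
  ContMDiffOn 𝓘(ℝ, ℝ) (𝓡 (n + 1)).tangent ∞
    (fun s ↦ (⟨γ s, J s⟩ : TangentBundle (𝓡 (n + 1)) M)) I ∧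
  ∀ x₀ : M, ∀ s ∈ I, γ s ∈ (chartAt (Euc (n + 1)) x₀).source →
    g.covDerivAlong x₀ (coordCurve n x₀ γ)
        (g.covDerivAlong x₀ (coordCurve n x₀ γ) (coordField x₀ γ J)) s
      + g.curvature x₀ (coordCurve n x₀ γ s) (coordField x₀ γ J s)
          (deriv (coordCurve n x₀ γ) s) (deriv (coordCurve n x₀ γ) s) = 0

/-- The points `γ(s₁)` and `γ(s₂)` are conjugate along the geodesic `γ` (defined on the open
interval `I`): `s₁ ≠ s₂`, and some Jacobi field which does not vanish identically vanishes at
`s₁` and at `s₂`. -/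
def AreConjugateAlong (g : LorentzMetric n M) (γ : ℝ → M) (I : Set ℝ) (s₁ s₂ : ℝ) : Prop :=
  s₁ ≠ s₂ ∧ ∃ J : ∀ s : ℝ, TangentSpace (𝓡 (n + 1)) (γ s),
    IsJacobiFieldOn g γ J I ∧ J s₁ = 0 ∧ J s₂ = 0 ∧ ∃ s ∈ I, J s ≠ 0

/-! ### Light rays near a given light ray -/

/-- A lightlike geodesic segment `γ₀ = γ_{0,0} : [0, ℓ] → M` together with a parametrization
`γ_{z,a}`, `(z, a) ∈ 𝓜 = Z × A`, of the lightlike geodesics near it, by means of semigeodesic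
coordinates `(t, z) ∈ (-T, T) × Z` of the spacelike hypersurface `H = {t = 0}` and of coordinates
`(z, a) ↦ (z, θ(z, a))` on its unit sphere bundle.
The segments are restrictions to `[0, ℓ]` of geodesics on the open interval `(-ε, ℓ + ε)`. -/
structure LightRayFamily (g : LorentzMetric n M) where
  /-- The length of the parameter interval. -/
  ℓ : ℝ
  ℓ_pos : 0 < ℓ
  ε : ℝ
  ε_pos : 0 < ε
  T : ℝ
  T_pos : 0 < T
  Z : Set (Euc n)
  isOpen_Z : IsOpen Z
  zero_mem_Z : 0 ∈ Z
  A : Set (Euc (n - 1))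
  isOpen_A : IsOpen A
  zero_mem_A : 0 ∈ A
  /-- The point with coordinates `(t, z)`. -/
  Ψ : OpenPartialHomeomorph (ℝ × Euc n) M
  source_Ψ : Ψ.source = Ioo (-T) T ×ˢ Z
  contMDiffOn_Ψ : ContMDiffOn 𝓘(ℝ, ℝ × Euc n) (𝓡 (n + 1)) ∞ Ψ Ψ.source
  contMDiffOn_Ψ_symm : ContMDiffOn (𝓡 (n + 1)) 𝓘(ℝ, ℝ × Euc n) ∞ Ψ.symm Ψ.target
  /-- In the coordinates `(t, z)` the metric is `-dt² + g'(t, z)`, where `g'(t, z)` is a positive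
  definite quadratic form in `dz`. -/
  metric_Ψ : ∀ p ∈ Ψ.source, ∀ (τ τ' : ℝ) (u u' : Euc n),
    g.val (Ψ p) (mfderiv 𝓘(ℝ, ℝ × Euc n) (𝓡 (n + 1)) Ψ p (τ, u))
        (mfderiv 𝓘(ℝ, ℝ × Euc n) (𝓡 (n + 1)) Ψ p (τ', u')) =
      -(τ * τ') + g.val (Ψ p) (mfderiv 𝓘(ℝ, ℝ × Euc n) (𝓡 (n + 1)) Ψ p ((0 : ℝ), u))
        (mfderiv 𝓘(ℝ, ℝ × Euc n) (𝓡 (n + 1)) Ψ p ((0 : ℝ), u'))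
  metric_Ψ_pos : ∀ p ∈ Ψ.source, ∀ u : Euc n, u ≠ 0 →
    0 < g.val (Ψ p) (mfderiv 𝓘(ℝ, ℝ × Euc n) (𝓡 (n + 1)) Ψ p ((0 : ℝ), u))
        (mfderiv 𝓘(ℝ, ℝ × Euc n) (𝓡 (n + 1)) Ψ p ((0 : ℝ), u))
  /-- The direction `θ(z, a) ∈ S_z Z`. -/
  θ : Euc n → Euc (n - 1) → Euc n
  contDiffOn_θ : ContDiffOn ℝ ∞ (fun p : Euc n × Euc (n - 1) ↦ θ p.1 p.2) (Z ×ˢ A)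
  /-- `θ(z, a)` has length `1` in the metric `h = g'(0, ·)`. -/
  unit_θ : ∀ z ∈ Z, ∀ a ∈ A,
    g.val (Ψ ((0 : ℝ), z)) (mfderiv 𝓘(ℝ, ℝ × Euc n) (𝓡 (n + 1)) Ψ ((0 : ℝ), z) ((0 : ℝ), θ z a))
      (mfderiv 𝓘(ℝ, ℝ × Euc n) (𝓡 (n + 1)) Ψ ((0 : ℝ), z) ((0 : ℝ), θ z a)) = 1
  /-- Each `a ↦ θ(z, a)` is a local parametrization of the unit sphere at `z`: an injective
  immersion, the dimensions being equal. -/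
  injOn_θ : ∀ z ∈ Z, InjOn (θ z) A
  immersion_θ : ∀ z ∈ Z, ∀ a ∈ A, Function.Injective (fderiv ℝ (θ z) a)
  /-- The geodesic `γ_{z,a}`, with `γ_{z,a}(0) = (0, z)` and `γ_{z,a}'(0) = (1, θ(z, a))` in the
  coordinates `(t, z)`. -/
  γ : Euc n → Euc (n - 1) → ℝ → M
  isGeodesicOn_γ : ∀ z ∈ Z, ∀ a ∈ A, IsGeodesicOn g (γ z a) (Ioo (-ε) (ℓ + ε))
  γ_zero : ∀ z ∈ Z, ∀ a ∈ A, γ z a 0 = Ψ ((0 : ℝ), z)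
  velocity_γ_zero : ∀ z ∈ Z, ∀ a ∈ A,
    HasMFDerivAt 𝓘(ℝ, ℝ) (𝓡 (n + 1)) (γ z a) 0
      (ContinuousLinearMap.toSpanSingleton ℝ
        (mfderiv 𝓘(ℝ, ℝ × Euc n) (𝓡 (n + 1)) Ψ ((0 : ℝ), z) ((1 : ℝ), θ z a)))

namespace LightRayFamily

variable {g : LorentzMetric n M} (S : LightRayFamily g)

/-- The central light ray `γ₀`. -/
def γ₀ : ℝ → M := S.γ 0 0

/-- The parameter space `𝓜 = Z × A`. -/
def params : Set (Euc n × Euc (n - 1)) := S.Z ×ˢ S.A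

/-- There are no conjugate points on the segment `γ₀ : [0, ℓ] → M`. -/
def NoConjugatePoints : Prop :=
  ∀ s₁ ∈ Icc 0 S.ℓ, ∀ s₂ ∈ Icc 0 S.ℓ,
    ¬ AreConjugateAlong g S.γ₀ (Ioo (-S.ε) (S.ℓ + S.ε)) s₁ s₂

/-- The conormal bundle `N*γ₀` of the segment `γ₀`. -/
def conormal : Set (CotangentBundle n M) :=
  {p | ∃ s ∈ Icc 0 S.ℓ, ∃ ξ : CotangentSpace n (S.γ₀ s),
    p = ⟨S.γ₀ s, ξ⟩ ∧ ξ (velocity n S.γ₀ s) = 0}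

/-- The Jacobi field `M_j = ∂γ_{z,a}/∂z^j`. -/
def fieldM (z : Euc n) (a : Euc (n - 1)) (s : ℝ) (j : Fin n) :
    TangentSpace (𝓡 (n + 1)) (S.γ z a s) :=
  mfderiv 𝓘(ℝ, Euc n) (𝓡 (n + 1)) (fun z' ↦ S.γ z' a s) z (EuclideanSpace.single j (1 : ℝ))

/-- The Jacobi field `J_k = ∂γ_{z,a}/∂a^k`. -/
def fieldJ (z : Euc n) (a : Euc (n - 1)) (s : ℝ) (k : Fin (n - 1)) :
    TangentSpace (𝓡 (n + 1)) (S.γ z a s) :=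
  mfderiv 𝓘(ℝ, Euc (n - 1)) (𝓡 (n + 1)) (fun a' ↦ S.γ z a' s) a
    (EuclideanSpace.single k (1 : ℝ))

/-- `T*(ℝⁿ × ℝⁿ⁻¹)`, which contains `T*𝓜`; its elements are `((z, a), (ζ, α))`, the numbers
`ζ_j` and `α_k` being the components of the covector. -/
abbrev ParamCotangent (n : ℕ) : Type :=
  (Euc n × Euc (n - 1)) × ((Fin n → ℝ) × (Fin (n - 1) → ℝ))

/-- The canonical relation `C` of the light ray transform over `Ω`, for the light rays `γ_{z,a}`
with `(z, a) ∈ V`: the twisted conormal bundle of the point-geodesic relation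
`{(z, a, x) | (z, a) ∈ V, x ∈ Ω, x = γ_{z,a}(s) for some s ∈ (0, ℓ)}`. It consists of the pairs
`((z, a, ζ, α), (x, ξ))` with `x = γ_{z,a}(s) ∈ Ω` for some `s ∈ (0, ℓ)`, `ξ ≠ 0`,
`⟨ξ, γ_{z,a}'(s)⟩ = 0`, `ζ_j = ⟨ξ, M_j(s)⟩` and `α_k = ⟨ξ, J_k(s)⟩`. -/
def canonicalRelation (Ω : Set M) (V : Set (Euc n × Euc (n - 1))) :
    SetRel (ParamCotangent n) (CotangentBundle n M) :=
  {r | ∃ z a, (z, a) ∈ V ∧ ∃ s ∈ Ioo 0 S.ℓ, S.γ z a s ∈ Ω ∧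
    ∃ ξ : CotangentSpace n (S.γ z a s), ξ ≠ 0 ∧ ξ (velocity n (S.γ z a) s) = 0 ∧
      r = (((z, a), (fun j ↦ ξ (S.fieldM z a s j), fun k ↦ ξ (S.fieldJ z a s k))),
        ⟨S.γ z a s, ξ⟩)}

/-- `C` as a multivalued map from `T*M` to `T*𝓜`, that is `C = π_𝓜 ∘ π_M⁻¹`, where `π_𝓜` and
`π_M` are the projections of the canonical relation. -/
def C (Ω : Set M) (V : Set (Euc n × Euc (n - 1))) :
    SetRel (CotangentBundle n M) (ParamCotangent n) :=
  (S.canonicalRelation Ω V).inv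

/-- The multivalued map `C⁻¹ ∘ C` from `T*M` to itself (`SetRel.comp` takes the map that is
applied first as its first argument). -/
def CinvC (Ω : Set M) (V : Set (Euc n × Euc (n - 1))) :
    SetRel (CotangentBundle n M) (CotangentBundle n M) :=
  (S.C Ω V).comp (S.C Ω V).inv

end LightRayFamily

end LightRay

end

/-! Along a ray `γ = γ_{z,a}` consider the variation fields `J = dγ(δp) + (σ + τ s) γ'`, where `δp`
is a variation of the `2n - 1` parameters and the second term comes from affine reparametrization.
They form a space of dimension `2n + 1`. A variation through null geodesics stays in the null cone
bundle, whose tangent spaces also have dimension `2n + 1`. At time `0` the semigeodesic coordinates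
and the immersion `θ(z, ·)` show that `J` is determined by `(z, a)`-data without redundancy, and the
linearized geodesic equation carries this to all times (`isLightFamily`). Hence the pairs `(J, J')`
fill the tangent space of the null cone bundle (`exists_varPhase_eq`), and the values `J(s)` fill
`T_{γ(s)}M`. Since the energy vanishes on the family, `g(J, γ')` is constant in time (`pairing_eq`).
If `s ≠ s'` are not conjugate, the `n`-dimensional space of fields vanishing at `s'` is mapped
injectively by evaluation at `s` into `γ'(s)^⊥`, which has dimension `n`, so the map is onto
(`exists_varField_eq`). Suppose now that `ξ` at `γ(s)` and `η` at `γ(s')` have the same image in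
`T*𝓜`. They agree on all variation fields, because both annihilate `γ'`. Taking `J` with `J(s') = 0`
and `J(s) = ξ^♯` gives `g⁻¹(ξ, ξ) = ⟨ξ, J(s)⟩ = ⟨η, J(s')⟩ = 0`, which contradicts `ξ` being
spacelike (`time_eq`). So `s = s'`, and then `ξ = η` since the `J(s)` span the tangent space. Two
further facts are needed. Non-conjugacy on the compact segment persists for nearby rays: away from
the diagonal this is continuity and compactness, and near it one uses that nontrivial fields have
simple zeros (`eventually_forall_eq_zero`). Moreover `C(x, ξ)` must be nonempty on a full
neighborhood: covectors near a spacelike conormal are conormal to nearby rays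
(`eventually_exists_conormal`), by local surjectivity of a map with surjective derivative. All of
this requires `γ_{z,a}(s)` to be smooth in `(z, a, s)`. Only smoothness in `s` is assumed, so the
rest is derived from smooth dependence of solutions of differential equations on their initial
values. -/

noncomputable section

namespace LightRay

attribute [-instance] TopCat.of.chartedSpace
set_option maxSynthPendingDepth 3

/-! ### Smooth dependence of solutions of differential equations on initial data -/

section LocalFlow

open Filter Metric

universe u

/-- A two-sided Grönwall estimate around the time `0`. -/
theorem norm_le_gronwallBound_abs {E : Type*} [NormedAddCommGroup E] [NormedSpace ℝ E]
    {f f' : ℝ → E} {K ε δ : ℝ} (hf : ∀ t ∈ Ioo (-δ) δ, HasDerivAt f (f' t) t) (h0 : f 0 = 0)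
    (hb : ∀ t ∈ Ioo (-δ) δ, ‖f' t‖ ≤ K * ‖f t‖ + ε) {t : ℝ} (ht : t ∈ Ioo (-δ) δ) :
    ‖f t‖ ≤ gronwallBound 0 K ε |t| := by
  have key : ∀ (f f' : ℝ → E), (∀ t ∈ Ioo (-δ) δ, HasDerivAt f (f' t) t) → f 0 = 0 →
      (∀ t ∈ Ioo (-δ) δ, ‖f' t‖ ≤ K * ‖f t‖ + ε) → ∀ t ∈ Ico 0 δ,
      ‖f t‖ ≤ gronwallBound 0 K ε t := by
    intro f f' hf h0 hb t ht
    have hsub : Icc 0 t ⊆ Ioo (-δ) δ := fun x hx ↦ ⟨by linarith [hx.1, ht.1, ht.2], by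
      linarith [hx.2, ht.2]⟩
    have := norm_le_gronwallBound_of_norm_deriv_right_le (f := f) (f' := f') (δ := 0) (K := K)
      (ε := ε) (a := 0) (b := t) (fun x hx ↦ (hf x (hsub hx)).continuousAt.continuousWithinAt)
      (fun x hx ↦ (hf x (hsub (Ico_subset_Icc_self hx))).hasDerivWithinAt) (by simp [h0])
      (fun x hx ↦ hb x (hsub (Ico_subset_Icc_self hx))) t ⟨ht.1, le_rfl⟩
    simpa using this
  rcases le_total 0 t with h | h
  · rw [abs_of_nonneg h]
    exact key f f' hf h0 hb t ⟨h, ht.2⟩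
  · rw [abs_of_nonpos h]
    have hneg : ∀ s ∈ Ioo (-δ) δ, -s ∈ Ioo (-δ) δ := fun s hs ↦
      ⟨by linarith [hs.2], by linarith [hs.1]⟩
    have := key (fun s ↦ f (-s)) (fun s ↦ -f' (-s)) (fun s hs ↦ by
      simpa using! (hf (-s) (hneg s hs)).scomp s (hasDerivAt_neg s)) (by simp [h0])
      (fun s hs ↦ by simpa using hb (-s) (hneg s hs)) (-t) ⟨by linarith, by linarith [ht.1]⟩
    simpa using this

/-- `Φ` is a local flow of the vector field `F` near `y₀`, for small times. -/
structure IsLocalFlow {E : Type*} [NormedAddCommGroup E] [NormedSpace ℝ E] (F : E → E) (y₀ : E)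
    (Φ : E × ℝ → E) : Prop where
  zero : ∀ᶠ y in 𝓝 y₀, Φ (y, 0) = y
  deriv : ∀ᶠ q in 𝓝 (y₀, (0 : ℝ)), HasDerivAt (fun s ↦ Φ (q.1, s)) (F (Φ q)) q.2
  lip : ∃ L : ℝ, ∀ᶠ q in 𝓝 ((y₀, y₀), (0 : ℝ)),
    ‖Φ (q.1.1, q.2) - Φ (q.1.2, q.2)‖ ≤ L * ‖q.1.1 - q.1.2‖

/-- Picard–Lindelöf on a closed ball; continuity in time together with a uniform Lipschitz bound in
the initial value yields joint continuity. -/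
theorem exists_isLocalFlow {E : Type*} [NormedAddCommGroup E] [NormedSpace ℝ E] [CompleteSpace E]
    {F : E → E} {y₀ : E} (hF : ContDiffAt ℝ 1 F y₀) :
    ∃ Φ : E × ℝ → E, IsLocalFlow F y₀ Φ ∧ ContDiffAt ℝ 0 Φ (y₀, 0) := by
  obtain ⟨ε, hε, a, r, L, K, hr, h⟩ := IsPicardLindelof.of_contDiffAt_one hF
  obtain ⟨α, hα, L', hL'⟩ :=
    (h 0).exists_forall_mem_closedBall_eq_hasDerivWithinAt_lipschitzOnWith
  have hball : closedBall y₀ (r : ℝ) ∈ 𝓝 y₀ := closedBall_mem_nhds _ (by exact_mod_cast hr)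
  have hI : Icc (0 - ε) (0 + ε) ∈ 𝓝 (0 : ℝ) := Icc_mem_nhds (by linarith) (by linarith)
  have hI' : Ioo (0 - ε) (0 + ε) ∈ 𝓝 (0 : ℝ) := Ioo_mem_nhds (by linarith) (by linarith)
  refine ⟨Function.uncurry α, ⟨?_, ?_, L', ?_⟩, ?_⟩
  · filter_upwards [hball] with y hy using (hα y hy).1
  · filter_upwards [prod_mem_nhds hball hI'] with q hq
    exact ((hα q.1 hq.1).2 q.2 (Ioo_subset_Icc_self hq.2)).hasDerivAt
      (Icc_mem_nhds hq.2.1 hq.2.2)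
  · filter_upwards [prod_mem_nhds (prod_mem_nhds hball hball) hI] with q hq
    exact (hL' q.2 hq.2).norm_sub_le hq.1.1 hq.1.2
  · rw [contDiffAt_zero]
    refine ⟨_, prod_mem_nhds hball hI, ?_⟩
    exact continuousOn_prod_of_continuousOn_lipschitzOnWith _ L'
      (fun x hx ↦ HasDerivWithinAt.continuousOn (hα x hx).2) hL'

variable {E : Type u} [NormedAddCommGroup E] [NormedSpace ℝ E]

/-- The vector field on `E × (E →L[ℝ] E)` whose flow is the flow of `F` together with its
derivative with respect to the initial value. -/
def variationField (F : E → E) (q : E × (E →L[ℝ] E)) : E × (E →L[ℝ] E) :=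
  (F q.1, (fderiv ℝ F q.1).comp q.2)

theorem contDiffAt_variationField {F : E → E} {y₀ : E} (hF : ContDiffAt ℝ ∞ F y₀)
    (W : E →L[ℝ] E) : ContDiffAt ℝ ∞ (variationField F) (y₀, W) := by
  have hF' : ContDiffAt ℝ ∞ F (y₀, W).1 := hF
  refine (hF'.comp _ contDiffAt_fst).prodMk ?_
  have h : ContDiffAt ℝ ∞ (fderiv ℝ F) (y₀, W).1 := hF'.fderiv_right (m := ∞) (by simp)
  exact (h.comp _ contDiffAt_fst).clm_comp contDiffAt_snd

/-- If the derivative of `F` is `L`-Lipschitz on a convex set then the first order Taylor remainder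
is quadratic. -/
theorem norm_sub_sub_fderiv_le {F : E → E} {s : Set E} (hs : Convex ℝ s) {L : NNReal}
    (hd : ∀ x ∈ s, DifferentiableAt ℝ F x) (hL : LipschitzOnWith L (fderiv ℝ F) s) {a b : E}
    (ha : a ∈ s) (hb : b ∈ s) :
    ‖F b - F a - fderiv ℝ F a (b - a)‖ ≤ L * ‖b - a‖ ^ 2 := by
  have hseg : segment ℝ a b ⊆ s := hs.segment_subset ha hb
  have := Convex.norm_image_sub_le_of_norm_fderiv_le' (𝕜 := ℝ) (f := F) (φ := fderiv ℝ F a)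
    (C := L * ‖b - a‖) (s := segment ℝ a b) (x := a) (y := b) (fun x hx ↦ hd x (hseg hx))
    (fun x hx ↦ ?_) (convex_segment _ _) (left_mem_segment ..) (right_mem_segment ..)
  · rw [pow_two, ← mul_assoc]; exact this
  · refine (hL.norm_sub_le (hseg hx) ha).trans ?_
    gcongr
    obtain ⟨t, ht, rfl⟩ := (segment_eq_image' ℝ a b) ▸ hx
    simp only [add_sub_cancel_left, norm_smul, Real.norm_eq_abs, abs_of_nonneg ht.1]
    exact mul_le_of_le_one_left (norm_nonneg _) ht.2

/-- The first component of a local flow of the variational field is differentiable in the initial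
value, with derivative the second component. -/
theorem IsLocalFlow.hasFDerivAt_of_variationField {F : E → E} {y₀ : E} (hF : ContDiffAt ℝ ∞ F y₀)
    {α : (E × (E →L[ℝ] E)) × ℝ → E × (E →L[ℝ] E)}
    (hα : IsLocalFlow (variationField F) (y₀, ContinuousLinearMap.id ℝ E) α)
    (hc : ContDiffAt ℝ 0 α ((y₀, ContinuousLinearMap.id ℝ E), 0)) :
    ∀ᶠ q : E × ℝ in 𝓝 (y₀, 0), HasFDerivAt
      (fun y ↦ (α ((y, ContinuousLinearMap.id ℝ E), q.2)).1)
      (α ((q.1, ContinuousLinearMap.id ℝ E), q.2)).2 q.1 := by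
  set i := ContinuousLinearMap.id ℝ E
  -- a ball on which the vector field is controlled
  obtain ⟨L₁, s₁, hs₁, hL₁⟩ := (hF.fderiv_right (m := 1) (by norm_cast)).exists_lipschitzOnWith
  obtain ⟨L₂, s₂, hs₂, hL₂⟩ := (hF.of_le (m := 1) (by simp)).exists_lipschitzOnWith
  have hd : ∀ᶠ y in 𝓝 y₀, DifferentiableAt ℝ F y :=
    ((hF.of_le (m := 1) (by simp)).eventually (by simp)).mono
      fun y hy ↦ hy.differentiableAt (by simp)
  obtain ⟨ρ, hρ, hρs⟩ := Metric.mem_nhds_iff.1 (inter_mem (inter_mem hs₁ hs₂) hd)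
  have hbound : ∀ y ∈ ball y₀ ρ, ‖fderiv ℝ F y‖ ≤ L₂ := fun y hy ↦
    norm_fderiv_le_of_lipschitzOn ℝ (mem_of_superset (isOpen_ball.mem_nhds hy)
      fun z hz ↦ (hρs hz).1.2) hL₂
  have hj : Continuous (fun q : E × ℝ ↦ ((q.1, i), q.2)) := by fun_prop
  obtain ⟨L₃, hL₃⟩ := hα.lip
  have hj' : Continuous (fun q : (E × E) × ℝ ↦ (((q.1.1, i), (q.1.2, i)), q.2)) := by fun_prop
  have hcont : ContinuousAt α ((y₀, i), 0) := hc.continuousAt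
  have hα0 : (α ((y₀, i), 0)).1 = y₀ := by rw [hα.zero.self_of_nhds]
  have hmem : ∀ᶠ q : E × ℝ in 𝓝 (y₀, 0), (α ((q.1, i), q.2)).1 ∈ ball y₀ ρ := by
    have h1 : ContinuousAt (fun q : E × ℝ ↦ (α ((q.1, i), q.2)).1) (y₀, 0) :=
      continuousAt_fst.comp (hcont.comp (f := fun q : E × ℝ ↦ ((q.1, i), q.2)) hj.continuousAt)
    exact h1 (by simpa only [hα0] using ball_mem_nhds y₀ hρ)
  have hder : ∀ᶠ q : E × ℝ in 𝓝 (y₀, 0), HasDerivAt (fun s ↦ α ((q.1, i), s))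
      (variationField F (α ((q.1, i), q.2))) q.2 := (hj.tendsto (y₀, 0)).eventually hα.deriv
  have hzero : ∀ᶠ q : E × ℝ in 𝓝 (y₀, 0), α ((q.1, i), 0) = (q.1, i) := by
    have : Continuous (fun q : E × ℝ ↦ (q.1, i)) := by fun_prop
    exact (this.tendsto (y₀, 0)).eventually hα.zero
  have hlip : ∀ᶠ q : (E × E) × ℝ in 𝓝 ((y₀, y₀), 0),
      ‖α ((q.1.1, i), q.2) - α ((q.1.2, i), q.2)‖ ≤ L₃ * ‖q.1.1 - q.1.2‖ := by
    refine ((hj'.tendsto ((y₀, y₀), 0)).eventually hL₃).mono fun q hq ↦ hq.trans_eq ?_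
    simp
  obtain ⟨r, hr, hall⟩ := Metric.mem_nhds_iff.1 ((hmem.and hder).and hzero)
  obtain ⟨r', hr', hall'⟩ := Metric.mem_nhds_iff.1 hlip
  set δ := min r r'
  have hδ : 0 < δ := lt_min hr hr'
  filter_upwards [prod_mem_nhds (ball_mem_nhds y₀ hδ) (Ioo_mem_nhds (neg_lt_zero.2 hδ) hδ)]
    with q hq
  obtain ⟨y, t⟩ := q
  simp only [mem_prod] at hq
  obtain ⟨hy, ht⟩ := hq
  have hin : ∀ y ∈ ball y₀ δ, ∀ s ∈ Ioo (-δ) δ, (y, s) ∈ ball (y₀, (0 : ℝ)) r := by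
    intro y hy s hs
    rw [← ball_prod_same]
    refine ⟨ball_subset_ball (min_le_left _ _) hy, ?_⟩
    rw [Real.ball_eq_Ioo]
    exact ⟨by linarith [hs.1, min_le_left r r'], by linarith [hs.2, min_le_left r r']⟩
  have hin' : ∀ y ∈ ball y₀ δ, ∀ y' ∈ ball y₀ δ, ∀ s ∈ Ioo (-δ) δ,
      ((y, y'), s) ∈ ball ((y₀, y₀), (0 : ℝ)) r' := by
    intro y hy y' hy' s hs
    rw [← ball_prod_same, ← ball_prod_same]
    refine ⟨⟨ball_subset_ball (min_le_right _ _) hy, ball_subset_ball (min_le_right _ _) hy'⟩, ?_⟩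
    rw [Real.ball_eq_Ioo]
    exact ⟨by linarith [hs.1, min_le_right r r'], by linarith [hs.2, min_le_right r r']⟩
  set C := gronwallBound 0 L₂ 1 δ
  -- The remainder solves the variational equation along `y` up to a forcing term of size `L₁ (L₃
  -- ‖y' - y‖)²`, the Taylor remainder of `F`; Grönwall then bounds it quadratically.
  have hquad : ∀ y' ∈ ball y₀ δ, ‖(α ((y', i), t)).1 - (α ((y, i), t)).1
      - (α ((y, i), t)).2 (y' - y)‖ ≤ (L₁ * L₃ ^ 2 * C) * ‖y' - y‖ ^ 2 := by
    intro y' hy'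
    set η := L₁ * (L₃ * ‖y' - y‖) ^ 2
    have hη : 0 ≤ η := by positivity
    have hb := norm_le_gronwallBound_abs (δ := δ) (K := L₂) (ε := η) (t := t)
      (f := fun s ↦ (α ((y', i), s)).1 - (α ((y, i), s)).1 - (α ((y, i), s)).2 (y' - y))
      (f' := fun s ↦ F (α ((y', i), s)).1 - F (α ((y, i), s)).1
        - (fderiv ℝ F (α ((y, i), s)).1) ((α ((y, i), s)).2 (y' - y))) ?_ ?_ ?_ ht
    · refine hb.trans ?_
      have h1 : gronwallBound 0 L₂ η |t| ≤ gronwallBound 0 L₂ η δ :=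
        gronwallBound_mono le_rfl hη L₂.2 (abs_le.2 ⟨ht.1.le, ht.2.le⟩)
      refine h1.trans_eq ?_
      -- With zero initial value the Grönwall bound is linear in the forcing, so `η` factors out.
      simp only [C, gronwallBound, η]
      split_ifs <;> ring
    · intro s hs
      have h1 := (hall (hin y' hy' s hs)).1.2
      have h2 := (hall (hin y hy s hs)).1.2
      have h1' : HasDerivAt (fun s ↦ (α ((y', i), s)).1) (F (α ((y', i), s)).1) s := h1.fst
      have h2' : HasDerivAt (fun s ↦ (α ((y, i), s)).1) (F (α ((y, i), s)).1) s := h2.fst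
      have h2'' := HasDerivAt.clm_apply (h2.snd : HasDerivAt (fun s ↦ (α ((y, i), s)).2) _ s)
        (hasDerivAt_const s (y' - y))
      simp only [map_zero, add_zero] at h2''
      exact (h1'.sub h2').sub h2''
    · have h1 := (hall (hin y' hy' 0 ⟨by linarith, hδ⟩)).2
      have h2 := (hall (hin y hy 0 ⟨by linarith, hδ⟩)).2
      simp only at h1 h2
      simp [h1, h2, i]
    · intro s hs
      have h1 := (hall (hin y' hy' s hs)).1.1
      have h2 := (hall (hin y hy s hs)).1.1
      have h3 := hall' (hin' y' hy' y hy s hs)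
      simp only [mem_ofPred_eq] at h1 h2 h3
      set a := α ((y, i), s)
      set b := α ((y', i), s)
      have h4 : ‖b.1 - a.1‖ ≤ L₃ * ‖y' - y‖ := (norm_fst_le (b - a)).trans h3
      have h5 := norm_sub_sub_fderiv_le (convex_ball y₀ ρ) (fun x hx ↦ (hρs hx).2)
        (hL₁.mono fun x hx ↦ (hρs hx).1.1) h2 h1
      have e : F b.1 - F a.1 - (fderiv ℝ F a.1) (a.2 (y' - y))
          = (fderiv ℝ F a.1) (b.1 - a.1 - a.2 (y' - y))
            + (F b.1 - F a.1 - fderiv ℝ F a.1 (b.1 - a.1)) := by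
        simp only [map_sub]; abel
      rw [e]
      refine (norm_add_le _ _).trans (add_le_add ?_ (h5.trans ?_))
      · exact ((fderiv ℝ F a.1).le_opNorm _).trans (by gcongr; exact hbound _ h2)
      · change _ ≤ L₁ * (L₃ * ‖y' - y‖) ^ 2
        gcongr
  refine HasFDerivAt.of_isLittleO ?_
  have hO : (fun y' ↦ (α ((y', i), t)).1 - (α ((y, i), t)).1 - (α ((y, i), t)).2 (y' - y))
      =O[𝓝 y] fun y' ↦ ‖y' - y‖ ^ 2 :=
    Asymptotics.IsBigO.of_bound _ (by
      filter_upwards [isOpen_ball.mem_nhds hy] with y' hy'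
      simpa using hquad y' hy')
  refine hO.trans_isLittleO ?_
  have := (Asymptotics.isLittleO_norm_pow_id (E' := E) one_lt_two).comp_tendsto
    (k := fun y' ↦ y' - y) (l' := 𝓝 y) (by
      have : Continuous fun y' : E ↦ y' - y := by fun_prop
      simpa using this.tendsto y)
  exact this

/-- Induction on `k`, over all spaces at once because the space changes. The `C^k` flow of
`variationField F`, started at `(y, id)`, consists of the flow of `F` and its derivative in `y`. The
time derivative is `F` of the flow, again `C^k`, so both partial derivatives are `C^k` and the flow
is `C^{k+1}`. -/
theorem exists_isLocalFlow_contDiffAt (k : ℕ) : ∀ {E : Type u} [NormedAddCommGroup E]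
    [NormedSpace ℝ E] [CompleteSpace E] {F : E → E} {y₀ : E}, ContDiffAt ℝ ∞ F y₀ →
    ∃ Φ : E × ℝ → E, IsLocalFlow F y₀ Φ ∧ ContDiffAt ℝ k Φ (y₀, 0) := by
  induction k with
  | zero =>
    intro E _ _ _ F y₀ hF
    exact exists_isLocalFlow (hF.of_le (by simp))
  | succ k ih =>
    intro E _ _ _ F y₀ hF
    set i := ContinuousLinearMap.id ℝ E
    obtain ⟨α, hα, hk⟩ := ih (contDiffAt_variationField hF i)
    have hj : ContDiff ℝ k (fun q : E × ℝ ↦ ((q.1, i), q.2)) := by fun_prop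
    have hderiv : ∀ᶠ q : E × ℝ in 𝓝 (y₀, 0), HasDerivAt (fun s ↦ (α ((q.1, i), s)).1)
        (F (α ((q.1, i), q.2)).1) q.2 :=
      ((hj.continuous.tendsto (y₀, 0)).eventually hα.deriv).mono fun q hq ↦ hq.fst
    refine ⟨fun q ↦ (α ((q.1, i), q.2)).1, ⟨?_, hderiv, ?_⟩, ?_⟩
    · have : Continuous (fun y : E ↦ (y, i)) := by fun_prop
      filter_upwards [(this.tendsto y₀).eventually hα.zero] with y hy
      rw [hy]
    · obtain ⟨L, hL⟩ := hα.lip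
      have hj' : Continuous (fun q : (E × E) × ℝ ↦ (((q.1.1, i), (q.1.2, i)), q.2)) := by fun_prop
      refine ⟨L, ((hj'.tendsto ((y₀, y₀), 0)).eventually hL).mono fun q hq ↦ ?_⟩
      refine (norm_fst_le (α ((q.1.1, i), q.2) - α ((q.1.2, i), q.2))).trans (hq.trans_eq ?_)
      simp
    · have hα' : ContDiffAt ℝ k (fun q : E × ℝ ↦ α ((q.1, i), q.2)) (y₀, 0) :=
        ContDiffAt.comp (y₀, (0 : ℝ)) (f := fun q : E × ℝ ↦ ((q.1, i), q.2)) hk hj.contDiffAt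
      have hfd := hα.hasFDerivAt_of_variationField hF (hk.of_le (by simp))
      have hα0 : (α ((y₀, i), 0)).1 = y₀ := by rw [hα.zero.self_of_nhds]
      have hF' : ContDiffAt ℝ k F (α ((y₀, i), 0)).1 := by
        rw [hα0]; exact hF.of_le (by exact_mod_cast le_top)
      have hFc : ContDiffAt ℝ k (fun q : E × ℝ ↦ F (α ((q.1, i), q.2)).1) (y₀, 0) :=
        ContDiffAt.comp (y₀, (0 : ℝ)) (f := fun q : E × ℝ ↦ (α ((q.1, i), q.2)).1) hF' hα'.fst
      -- The candidate for the full derivative, assembled from the two partial derivatives; their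
      -- continuity near the point makes it the actual derivative.
      set D : E × ℝ → (E × ℝ →L[ℝ] E) := fun q ↦ (α ((q.1, i), q.2)).2.coprod
        (ContinuousLinearMap.toSpanSingleton ℝ (F (α ((q.1, i), q.2)).1)) with hD
      have hDk : ContDiffAt ℝ k D (y₀, 0) := by
        have e : D = fun q ↦ (α ((q.1, i), q.2)).2.comp (ContinuousLinearMap.fst ℝ E ℝ)
            + (ContinuousLinearMap.toSpanSingletonCLE (𝕜 := ℝ) (E := E)
              (F (α ((q.1, i), q.2)).1)).comp (ContinuousLinearMap.snd ℝ E ℝ) := by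
          ext q <;> simp [D]
        rw [e]
        refine ContDiffAt.add (hα'.snd.clm_comp contDiffAt_const) ?_
        refine ContDiffAt.clm_comp ?_ contDiffAt_const
        exact (ContinuousLinearEquiv.contDiff _).contDiffAt.comp _ hFc
      have hc1 : ∀ᶠ q : E × ℝ in 𝓝 (y₀, 0), ContinuousAt (fun q : E × ℝ ↦ α ((q.1, i), q.2)) q :=
        ((hα'.of_le (m := 0) (by simp)).eventually (by simp)).mono fun q hq ↦ hq.continuousAt
      have hc2 : ∀ᶠ q : E × ℝ in 𝓝 (y₀, 0),
          ContinuousAt (fun q : E × ℝ ↦ F (α ((q.1, i), q.2)).1) q :=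
        ((hFc.of_le (m := 0) (by simp)).eventually (by simp)).mono fun q hq ↦ hq.continuousAt
      rw [show ((k + 1 : ℕ) : WithTop ℕ∞) = (k : WithTop ℕ∞) + 1 by push_cast; rfl,
        contDiffAt_succ_iff_hasFDerivAt]
      refine ⟨D, ?_, hDk⟩
      have hev := (hfd.and hderiv).eventually_nhds.and (hc1.and hc2)
      refine ⟨_, hev, fun q hq ↦ ?_⟩
      refine (hasStrictFDerivAt_uncurry_coprod (u := q)
        (f := fun y s ↦ (α ((y, i), s)).1) (f₁ := fun y s ↦ (α ((y, i), s)).2)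
        (f₂ := fun y s ↦ ContinuousLinearMap.toSpanSingleton ℝ (F (α ((y, i), s)).1))
        (hq.1.mono fun v hv ↦ hv.1) (hq.1.mono fun v hv ↦ hv.2.hasFDerivAt)
        (continuousAt_snd.comp hq.2.1) ?_).hasFDerivAt
      exact (ContinuousLinearMap.toSpanSingletonCLE (𝕜 := ℝ) (E := E)).continuous.continuousAt.comp
        hq.2.2

end LocalFlow

/-! ### Metrics in coordinates -/

/-- The value at `y` of the metric coefficients `G` is nondegenerate and symmetric, and `G` is
smooth at `y`. -/
structure IsCoordMetricAt {E : Type*} [NormedAddCommGroup E] [NormedSpace ℝ E]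
    (G : E → E →L[ℝ] E →L[ℝ] ℝ) (y : E) : Prop where
  smooth : ContDiffAt ℝ ∞ G y
  symm : ∀ y u v, G y u v = G y v u
  inv : (G y).IsInvertible

section CoordMetric

variable {E : Type*} [NormedAddCommGroup E] [NormedSpace ℝ E] (G : E → E →L[ℝ] E →L[ℝ] ℝ)

/-- The Christoffel symbols of the metric coefficients `G`, as a continuous bilinear map. -/
def christoffelCLM (y : E) : E →L[ℝ] E →L[ℝ] E :=
  (ContinuousLinearMap.compL ℝ E (E →L[ℝ] ℝ) E (G y).inverse).comp
    ((1 / 2 : ℝ) • (fderiv ℝ G y + (fderiv ℝ G y).flip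
      - ((ContinuousLinearMap.flipₗᵢ ℝ E E ℝ).toContinuousLinearEquiv :
        (E →L[ℝ] E →L[ℝ] ℝ) →L[ℝ] (E →L[ℝ] E →L[ℝ] ℝ)).comp (fderiv ℝ G y).flip))

/-- The geodesic equation in coordinates, as a first order equation on phase space. -/
def geodesicField (q : E × E) : E × E := (q.2, -christoffelCLM G q.1 q.2 q.2)

/-- The energy `g(v, v)` on phase space in coordinates. -/
def coordEnergy (q : E × E) : ℝ := G q.1 q.2 q.2

namespace IsCoordMetricAt

variable {G} {y : E} {q : E × E}

theorem contDiffAt_christoffelCLM [CompleteSpace E] (h : IsCoordMetricAt G y) :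
    ContDiffAt ℝ ∞ (christoffelCLM G) y := by
  have hD : ContDiffAt ℝ ∞ (fderiv ℝ G) y := h.smooth.fderiv_right (by simp)
  have hflip : ContDiffAt ℝ ∞ (fun y ↦ (fderiv ℝ G y).flip) y :=
    (ContinuousLinearMap.flipₗᵢ ℝ E E (E →L[ℝ] ℝ)).contDiff.contDiffAt.comp y hD
  refine ContDiffAt.clm_comp ?_ (ContDiffAt.const_smul _ ((hD.add hflip).sub
    (contDiffAt_const.clm_comp hflip)))
  refine (ContinuousLinearMap.contDiff _).contDiffAt.comp y ?_
  exact h.inv.contDiffAt_map_inverse.comp y h.smooth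

theorem fderiv_symm (h : IsCoordMetricAt G y) (w u v : E) :
    fderiv ℝ G y w u v = fderiv ℝ G y w v u := by
  have hd : HasFDerivAt G _ y := (h.smooth.differentiableAt (by simp)).hasFDerivAt
  have h1 := (hd.clm_apply (hasFDerivAt_const u y)).clm_apply (hasFDerivAt_const v y)
  have h2 := (hd.clm_apply (hasFDerivAt_const v y)).clm_apply (hasFDerivAt_const u y)
  have h3 : (fun y ↦ G y u v) = fun y ↦ G y v u := funext fun y ↦ h.symm y u v
  rw [h3] at h1
  simpa using DFunLike.congr_fun (h1.unique h2) w

/-- The Koszul formula. It determines the symbols because `G y` is invertible, and it is the only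
form in which they enter the energy identities. -/
theorem apply_christoffelCLM (h : IsCoordMetricAt G y) (u v w : E) :
    G y (christoffelCLM G y u v) w
      = 1 / 2 * (fderiv ℝ G y u v w + fderiv ℝ G y v u w - fderiv ℝ G y w u v) := by
  simp only [christoffelCLM, ContinuousLinearMap.comp_apply, ContinuousLinearMap.compL_apply]
  rw [h.inv.self_apply_inverse]
  simp

theorem christoffelCLM_symm (h : IsCoordMetricAt G y) (u v : E) :
    christoffelCLM G y u v = christoffelCLM G y v u := by
  simp only [christoffelCLM, ContinuousLinearMap.comp_apply, ContinuousLinearMap.compL_apply]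
  congr 1
  ext w
  simp [h.fderiv_symm w u v, add_comm]

theorem contDiffAt_geodesicField [CompleteSpace E] (h : IsCoordMetricAt G q.1) :
    ContDiffAt ℝ ∞ (geodesicField G) q := by
  refine contDiffAt_snd.prodMk (ContDiffAt.neg ?_)
  exact ((h.contDiffAt_christoffelCLM.comp q contDiffAt_fst).clm_apply
    contDiffAt_snd).clm_apply contDiffAt_snd

theorem fderiv_geodesicField [CompleteSpace E] (h : IsCoordMetricAt G q.1) (X : E × E) :
    fderiv ℝ (geodesicField G) q X = (X.2, -(fderiv ℝ (christoffelCLM G) q.1 X.1 q.2 q.2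
      + (2 : ℝ) • christoffelCLM G q.1 q.2 X.2)) := by
  have h1 : HasFDerivAt (fun q : E × E ↦ christoffelCLM G q.1) _ q :=
    (h.contDiffAt_christoffelCLM.differentiableAt (by simp)).hasFDerivAt.comp q hasFDerivAt_fst
  have h2 := (hasFDerivAt_snd (𝕜 := ℝ) (p := q)).prodMk
    ((h1.clm_apply hasFDerivAt_snd).clm_apply hasFDerivAt_snd).neg
  have h3 : HasFDerivAt (geodesicField G) _ q := h2
  rw [h3.fderiv]
  ext1
  · simp
  · simp [h.christoffelCLM_symm X.2 q.2, two_smul]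
    abel

theorem hasFDerivAt_coordEnergy (h : IsCoordMetricAt G q.1) :
    DifferentiableAt ℝ (coordEnergy G) q ∧ ∀ X, fderiv ℝ (coordEnergy G) q X
      = fderiv ℝ G q.1 X.1 q.2 q.2 + 2 * G q.1 q.2 X.2 := by
  have h1 : HasFDerivAt (fun q : E × E ↦ G q.1) _ q :=
    (h.smooth.differentiableAt (by simp)).hasFDerivAt.comp q hasFDerivAt_fst
  have h2 := (h1.clm_apply (hasFDerivAt_snd (𝕜 := ℝ))).clm_apply (hasFDerivAt_snd (𝕜 := ℝ))
  have h3 : HasFDerivAt (coordEnergy G) _ q := h2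
  refine ⟨h3.differentiableAt, fun X ↦ ?_⟩
  rw [h3.fderiv]
  simp [h.symm q.1 X.2 q.2]
  ring

theorem fderiv_coordEnergy (h : IsCoordMetricAt G q.1) (X : E × E) :
    fderiv ℝ (coordEnergy G) q X = fderiv ℝ G q.1 X.1 q.2 q.2 + 2 * G q.1 q.2 X.2 :=
  h.hasFDerivAt_coordEnergy.2 X

/-- Infinitesimal conservation of energy: by the Koszul formula `2 g(Γ(v, v), v)` is exactly the
derivative of the metric coefficients along `v`. -/
theorem fderiv_coordEnergy_geodesicField (h : IsCoordMetricAt G q.1) :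
    fderiv ℝ (coordEnergy G) q (geodesicField G q) = 0 := by
  rw [h.fderiv_coordEnergy, geodesicField]
  simp only [map_neg]
  rw [h.symm, h.apply_christoffelCLM]
  ring

/-- The derivative of `g(j, c')` along a geodesic `c`. -/
theorem fderiv_pairing (h : IsCoordMetricAt G q.1) (X : E × E) :
    fderiv ℝ G q.1 q.2 X.1 q.2 + G q.1 X.2 q.2 + G q.1 X.1 (geodesicField G q).2
      = 1 / 2 * fderiv ℝ (coordEnergy G) q X := by
  rw [h.fderiv_coordEnergy, geodesicField]
  simp only [map_neg]
  rw [h.symm q.1 X.1, h.apply_christoffelCLM, h.symm q.1 X.2, h.fderiv_symm q.2 X.1]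
  ring

end IsCoordMetricAt

end CoordMetric

/-! ### Charts -/

section Charts

variable {n : ℕ} {M : Type*} [TopologicalSpace M] [ChartedSpace (Euc (n + 1)) M]

/-- The derivative at `x` of the chart at `x₀`. -/
def dchart (x₀ x : M) : TangentSpace (𝓡 (n + 1)) x →L[ℝ] Euc (n + 1) :=
  mfderiv (𝓡 (n + 1)) 𝓘(ℝ, Euc (n + 1)) (extChartAt (𝓡 (n + 1)) x₀) x

/-- The derivative at `y` of the inverse of the chart at `x₀`. -/
def dchartSymm (x₀ : M) (y : Euc (n + 1)) :
    Euc (n + 1) →L[ℝ] TangentSpace (𝓡 (n + 1)) ((extChartAt (𝓡 (n + 1)) x₀).symm y) :=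
  mfderiv 𝓘(ℝ, Euc (n + 1)) (𝓡 (n + 1)) (extChartAt (𝓡 (n + 1)) x₀).symm y

variable [IsManifold (𝓡 (n + 1)) ∞ M]

omit [IsManifold (𝓡 (n + 1)) ∞ M] in
theorem mem_source_iff {x₀ x : M} : x ∈ (extChartAt (𝓡 (n + 1)) x₀).source ↔
    x ∈ (chartAt (Euc (n + 1)) x₀).source := by rw [extChartAt_source]

theorem dchart_dchartSymm {x₀ : M} {y : Euc (n + 1)} (hy : y ∈ (extChartAt (𝓡 (n + 1)) x₀).target)
    (u : Euc (n + 1)) :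
    dchart x₀ ((extChartAt (𝓡 (n + 1)) x₀).symm y) (dchartSymm x₀ y u) = u := by
  have := mfderiv_extChartAt_comp_mfderivWithin_extChartAt_symm (I := 𝓡 (n + 1)) hy
  rw [modelWithCornersSelf_coe, range_id, mfderivWithin_univ] at this
  exact DFunLike.congr_fun this u

theorem dchartSymm_dchart {x₀ : M} {y : Euc (n + 1)} (hy : y ∈ (extChartAt (𝓡 (n + 1)) x₀).target)
    (w : TangentSpace (𝓡 (n + 1)) ((extChartAt (𝓡 (n + 1)) x₀).symm y)) :
    dchartSymm x₀ y (dchart x₀ ((extChartAt (𝓡 (n + 1)) x₀).symm y) w) = w := by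
  have := mfderivWithin_extChartAt_symm_comp_mfderiv_extChartAt (I := 𝓡 (n + 1)) hy
  rw [modelWithCornersSelf_coe, range_id, mfderivWithin_univ] at this
  exact DFunLike.congr_fun this w

theorem dchart_injective {x₀ x : M} (hx : x ∈ (extChartAt (𝓡 (n + 1)) x₀).source) :
    Function.Injective (dchart (n := n) x₀ x) := by
  obtain ⟨e, he⟩ := isInvertible_mfderiv_extChartAt (I := 𝓡 (n + 1)) hx
  intro v w h
  exact e.injective ((DFunLike.congr_fun he v).trans (h.trans (DFunLike.congr_fun he w).symm))

theorem dchart_surjective {x₀ x : M} (hx : x ∈ (extChartAt (𝓡 (n + 1)) x₀).source) :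
    Function.Surjective (dchart (n := n) x₀ x) := by
  obtain ⟨e, he⟩ := isInvertible_mfderiv_extChartAt (I := 𝓡 (n + 1)) hx
  intro v
  obtain ⟨w, hw⟩ := e.surjective v
  exact ⟨w, (DFunLike.congr_fun he w).symm.trans hw⟩

/-- In the trivialization at `x₀` this vector field is the constant `u`. Such fields are used to
read off the smoothness of the metric coefficients. -/
theorem contMDiffAt_dchartSymm {x₀ : M} {y : Euc (n + 1)}
    (hy : y ∈ (extChartAt (𝓡 (n + 1)) x₀).target) (u : Euc (n + 1)) :
    ContMDiffAt 𝓘(ℝ, Euc (n + 1)) (𝓡 (n + 1)).tangent ∞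
      (fun y ↦ (⟨(extChartAt (𝓡 (n + 1)) x₀).symm y, dchartSymm x₀ y u⟩ :
        TangentBundle (𝓡 (n + 1)) M)) y := by
  have hs := (contMDiffOn_extChartAt_symm (I := 𝓡 (n + 1)) (n := ∞) x₀).contMDiffAt
    ((isOpen_extChartAt_target x₀).mem_nhds hy)
  have hx : (extChartAt (𝓡 (n + 1)) x₀).symm y ∈ (chartAt (Euc (n + 1)) x₀).source :=
    mem_source_iff.1 ((extChartAt (𝓡 (n + 1)) x₀).map_target hy)
  refine (Trivialization.contMDiffAt_iff (e := trivializationAt (Euc (n + 1))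
    (TangentSpace (𝓡 (n + 1)) (M := M)) x₀) (IB := 𝓡 (n + 1)) (IM := 𝓘(ℝ, Euc (n + 1))) ?_).2
    ⟨hs, ?_⟩
  · simpa [TangentBundle.trivializationAt_source] using hx
  · refine (contMDiffAt_const (c := u)).congr_of_eventuallyEq ?_
    filter_upwards [(isOpen_extChartAt_target x₀).mem_nhds hy] with z hz
    have hz' : (extChartAt (𝓡 (n + 1)) x₀).symm z ∈ (chartAt (Euc (n + 1)) x₀).source :=
      mem_source_iff.1 ((extChartAt (𝓡 (n + 1)) x₀).map_target hz)
    have h1 := TangentBundle.continuousLinearMapAt_trivializationAt (I := 𝓡 (n + 1)) hz'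
    have h2 := DFunLike.congr_fun h1 (dchartSymm x₀ z u)
    refine Eq.trans ?_ (h2.trans (dchart_dchartSymm hz u))
    rw [Trivialization.continuousLinearMapAt_apply, Trivialization.linearMapAt_apply,
      if_pos (by simpa using hz')]

end Charts

theorem contDiffAt_clm_of_apply {D E F : Type*} [NormedAddCommGroup D] [NormedSpace ℝ D]
    [NormedAddCommGroup E] [NormedSpace ℝ E] [NormedAddCommGroup F] [NormedSpace ℝ F]
    [FiniteDimensional ℝ E] {f : D → E →L[ℝ] F} {x : D} {m : WithTop ℕ∞}
    (h : ∀ y, ContDiffAt ℝ m (fun x ↦ f x y) x) : ContDiffAt ℝ m f x := by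
  let d := Module.finrank ℝ E
  have hd : d = Module.finrank ℝ (Fin d → ℝ) := (Module.finrank_fin_fun ℝ).symm
  let e₁ := ContinuousLinearEquiv.ofFinrankEq hd
  let e₂ := (e₁.arrowCongr (1 : F ≃L[ℝ] F)).trans (ContinuousLinearEquiv.piRing (Fin d))
  rw [← Function.id_comp f, ← e₂.symm_comp_self]
  exact e₂.symm.contDiff.contDiffAt.comp x (contDiffAt_pi.mpr fun i ↦ h _)

/-! ### The Lorentz metric in a chart -/

namespace LorentzMetric

variable {n : ℕ} {M : Type*} [TopologicalSpace M] [ChartedSpace (Euc (n + 1)) M]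
  [IsManifold (𝓡 (n + 1)) ∞ M] (g : LorentzMetric n M)

/-- A vector orthogonal to everything is orthogonal to the timelike vector, on whose complement the
metric is positive definite. -/
theorem nondegenerate {x : M} {v : TangentSpace (𝓡 (n + 1)) x} (h : ∀ w, g.val x v w = 0) :
    v = 0 := by
  obtain ⟨t, ht, hpos⟩ := g.signature x
  by_contra hv
  have := hpos v (by rw [g.symm]; exact h t) hv
  rw [h v] at this
  exact lt_irrefl _ this

theorem isInvertible_of_nondegenerate {E : Type*} [NormedAddCommGroup E] [NormedSpace ℝ E]
    [FiniteDimensional ℝ E] {B : E →L[ℝ] E →L[ℝ] ℝ} (h : ∀ v, (∀ w, B v w = 0) → v = 0) :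
    B.IsInvertible := by
  have hinj : Function.Injective (B : E →ₗ[ℝ] E →L[ℝ] ℝ) := by
    rw [← LinearMap.ker_eq_bot, LinearMap.ker_eq_bot']
    intro v hv
    refine h v fun w ↦ ?_
    have : B v = 0 := hv
    simp [this]
  have hdim : Module.finrank ℝ E = Module.finrank ℝ (E →L[ℝ] ℝ) := by
    rw [← (LinearMap.toContinuousLinearMap (𝕜 := ℝ) (E := E) (F' := ℝ)).finrank_eq]
    exact (Subspace.dual_finrank_eq (K := ℝ) (V := E)).symm
  refine ⟨(LinearEquiv.ofInjectiveOfFinrankEq (B : E →ₗ[ℝ] E →L[ℝ] ℝ) hinj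
    hdim).toContinuousLinearEquiv, ?_⟩
  ext v w
  rfl

/-- `sharp` is built on the total function `ContinuousLinearMap.inverse`, which has the junk value
`0` on noninvertible maps; nondegeneracy makes it the true inverse. -/
theorem val_sharp (x : M) (ξ : TangentSpace (𝓡 (n + 1)) x →L[ℝ] ℝ) :
    g.val x (g.sharp x ξ) = ξ :=
  (isInvertible_of_nondegenerate (E := Euc (n + 1)) (B := g.val x)
    fun _ h ↦ g.nondegenerate h).self_apply_inverse ξ

theorem coordMetric_apply (x₀ : M) (y u v : Euc (n + 1)) :
    g.coordMetric x₀ y u v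
      = g.val ((extChartAt (𝓡 (n + 1)) x₀).symm y) (dchartSymm x₀ y u) (dchartSymm x₀ y v) := rfl

theorem coordMetric_symm (x₀ : M) (y u v : Euc (n + 1)) :
    g.coordMetric x₀ y u v = g.coordMetric x₀ y v u := by
  rw [coordMetric_apply, coordMetric_apply, g.symm]

theorem coordMetric_dchart {x₀ x : M} (hx : x ∈ (extChartAt (𝓡 (n + 1)) x₀).source)
    (v w : TangentSpace (𝓡 (n + 1)) x) :
    g.coordMetric x₀ (extChartAt (𝓡 (n + 1)) x₀ x) (dchart x₀ x v) (dchart x₀ x w)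
      = g.val x v w := by
  -- With `x` as a variable equal to the image of `y`, substitution avoids transporting tangent
  -- vectors between equal base points.
  have key : ∀ y ∈ (extChartAt (𝓡 (n + 1)) x₀).target, ∀ x, (extChartAt (𝓡 (n + 1)) x₀).symm y = x →
      ∀ (v w : TangentSpace (𝓡 (n + 1)) x),
      g.coordMetric x₀ y (dchart x₀ x v) (dchart x₀ x w) = g.val x v w := by
    rintro y hy x rfl v w
    rw [coordMetric_apply, dchartSymm_dchart hy, dchartSymm_dchart hy]
  exact key _ ((extChartAt (𝓡 (n + 1)) x₀).map_source hx) x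
    ((extChartAt (𝓡 (n + 1)) x₀).left_inv hx) v w

theorem isInvertible_coordMetric {x₀ : M} {y : Euc (n + 1)}
    (hy : y ∈ (extChartAt (𝓡 (n + 1)) x₀).target) : (g.coordMetric x₀ y).IsInvertible := by
  refine isInvertible_of_nondegenerate fun v h ↦ ?_
  have : dchartSymm x₀ y v = 0 := by
    refine g.nondegenerate fun w ↦ ?_
    have := h (dchart x₀ _ w)
    rwa [coordMetric_apply, dchartSymm_dchart hy] at this
  rw [← dchart_dchartSymm hy v, this, map_zero]

theorem contDiffAt_coordMetric {x₀ : M} {y : Euc (n + 1)}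
    (hy : y ∈ (extChartAt (𝓡 (n + 1)) x₀).target) : ContDiffAt ℝ ∞ (g.coordMetric x₀) y := by
  refine contDiffAt_clm_of_apply fun u ↦ contDiffAt_clm_of_apply fun v ↦ ?_
  have hs := (contMDiffOn_extChartAt_symm (I := 𝓡 (n + 1)) (n := ∞) x₀).contMDiffAt
    ((isOpen_extChartAt_target x₀).mem_nhds hy)
  have : ContMDiffAt 𝓘(ℝ, Euc (n + 1)) ((𝓡 (n + 1)).prod 𝓘(ℝ)) ∞
      (fun y ↦ TotalSpace.mk' ℝ (E := Bundle.Trivial M ℝ) ((extChartAt (𝓡 (n + 1)) x₀).symm y)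
        (g.val ((extChartAt (𝓡 (n + 1)) x₀).symm y) (dchartSymm x₀ y u) (dchartSymm x₀ y v))) y := by
    apply ContMDiffAt.clm_bundle_apply₂ (F₁ := Euc (n + 1)) (F₂ := Euc (n + 1))
    · exact (g.contMDiff _).comp y hs
    · exact contMDiffAt_dchartSymm hy u
    · exact contMDiffAt_dchartSymm hy v
  simp only [contMDiffAt_totalSpace] at this
  exact this.2.contDiffAt

theorem isCoordMetricAt {x₀ : M} {y : Euc (n + 1)}
    (hy : y ∈ (extChartAt (𝓡 (n + 1)) x₀).target) : IsCoordMetricAt (g.coordMetric x₀) y :=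
  ⟨g.contDiffAt_coordMetric hy, g.coordMetric_symm x₀, g.isInvertible_coordMetric hy⟩

theorem christoffel_eq (x₀ : M) (y u v : Euc (n + 1)) :
    g.christoffel x₀ y u v = christoffelCLM (g.coordMetric x₀) y u v := rfl

end LorentzMetric

/-! ### Smoothness of families of geodesics -/

section Geodesics

open Filter

variable {n : ℕ} {M : Type*} [TopologicalSpace M] [ChartedSpace (Euc (n + 1)) M]

/-- Position and velocity of the curve `γ` at the time `s`, in the chart at `x₀`. -/
def phase (n : ℕ) {M : Type*} [TopologicalSpace M] [ChartedSpace (Euc (n + 1)) M]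
    (x₀ : M) (γ : ℝ → M) (s : ℝ) : Euc (n + 1) × Euc (n + 1) :=
  (coordCurve n x₀ γ s, deriv (coordCurve n x₀ γ) s)

/-- The change of coordinates from the chart at `x₀` to the chart at `x₁`. -/
def transition (n : ℕ) {M : Type*} [TopologicalSpace M] [ChartedSpace (Euc (n + 1)) M]
    (x₀ x₁ : M) (y : Euc (n + 1)) : Euc (n + 1) :=
  extChartAt (𝓡 (n + 1)) x₁ ((extChartAt (𝓡 (n + 1)) x₀).symm y)

variable [IsManifold (𝓡 (n + 1)) ∞ M]

theorem contDiffAt_transition {x₀ x₁ x : M} (h₀ : x ∈ (extChartAt (𝓡 (n + 1)) x₀).source)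
    (h₁ : x ∈ (extChartAt (𝓡 (n + 1)) x₁).source) :
    ContDiffAt ℝ ∞ (transition n x₀ x₁) (extChartAt (𝓡 (n + 1)) x₀ x) := by
  rw [← contMDiffAt_iff_contDiffAt]
  have hs := (contMDiffOn_extChartAt_symm (I := 𝓡 (n + 1)) (n := ∞) x₀).contMDiffAt
    ((isOpen_extChartAt_target x₀).mem_nhds ((extChartAt (𝓡 (n + 1)) x₀).map_source h₀))
  have h₁' : (extChartAt (𝓡 (n + 1)) x₀).symm (extChartAt (𝓡 (n + 1)) x₀ x)
      ∈ (chartAt (Euc (n + 1)) x₁).source := by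
    rwa [(extChartAt (𝓡 (n + 1)) x₀).left_inv h₀, ← mem_source_iff]
  exact (contMDiffAt_extChartAt' (I := 𝓡 (n + 1)) (n := ∞) h₁').comp _ hs

omit [IsManifold (𝓡 (n + 1)) ∞ M] in
theorem eventually_mem_source {x₀ : M} {X : Type*} [TopologicalSpace X] {f : X → M} {s : X}
    (hf : ContinuousAt f s) (hx : f s ∈ (extChartAt (𝓡 (n + 1)) x₀).source) :
    ∀ᶠ t in 𝓝 s, f t ∈ (extChartAt (𝓡 (n + 1)) x₀).source :=
  hf ((isOpen_extChartAt_source (I := 𝓡 (n + 1)) x₀).mem_nhds hx)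

section SmoothCurve

variable {γ : ℝ → M} {s : ℝ} {x₀ : M}

theorem contDiffAt_coordCurve (hγ : ContMDiffAt 𝓘(ℝ, ℝ) (𝓡 (n + 1)) ∞ γ s)
    (hx : γ s ∈ (extChartAt (𝓡 (n + 1)) x₀).source) :
    ContDiffAt ℝ ∞ (coordCurve n x₀ γ) s := by
  rw [← contMDiffAt_iff_contDiffAt]
  exact (contMDiffAt_extChartAt' (I := 𝓡 (n + 1)) (n := ∞) (mem_source_iff.1 hx)).comp s hγ

theorem deriv_coordCurve (hγ : ContMDiffAt 𝓘(ℝ, ℝ) (𝓡 (n + 1)) ∞ γ s)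
    (hx : γ s ∈ (extChartAt (𝓡 (n + 1)) x₀).source) :
    deriv (coordCurve n x₀ γ) s = dchart x₀ (γ s) (velocity n γ s) := by
  have h := mfderiv_comp s (mdifferentiableAt_extChartAt (I := 𝓡 (n + 1)) (mem_source_iff.1 hx))
    (hγ.mdifferentiableAt (by simp))
  have h2 : mfderiv 𝓘(ℝ, ℝ) 𝓘(ℝ, Euc (n + 1)) (extChartAt (𝓡 (n + 1)) x₀ ∘ γ) s (1 : ℝ)
      = dchart x₀ (γ s) (velocity n γ s) := by rw [h]; rfl
  rw [mfderiv_eq_fderiv] at h2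
  rw [← h2, ← fderiv_apply_one_eq_deriv]
  rfl

theorem phase_transition {x₁ : M} (hγ : ContMDiffAt 𝓘(ℝ, ℝ) (𝓡 (n + 1)) ∞ γ s)
    (h₀ : γ s ∈ (extChartAt (𝓡 (n + 1)) x₀).source)
    (h₁ : γ s ∈ (extChartAt (𝓡 (n + 1)) x₁).source) :
    phase n x₁ γ s = (transition n x₀ x₁ (phase n x₀ γ s).1,
      fderiv ℝ (transition n x₀ x₁) (phase n x₀ γ s).1 (phase n x₀ γ s).2) := by
  have hev : coordCurve n x₁ γ =ᶠ[𝓝 s] transition n x₀ x₁ ∘ coordCurve n x₀ γ := by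
    filter_upwards [eventually_mem_source hγ.continuousAt h₀] with t ht
    simp only [coordCurve, transition, Function.comp_apply]
    rw [(extChartAt (𝓡 (n + 1)) x₀).left_inv ht]
  have hc := (contDiffAt_coordCurve hγ h₀).differentiableAt (by simp)
  have ht : DifferentiableAt ℝ (transition n x₀ x₁) (coordCurve n x₀ γ s) :=
    (contDiffAt_transition h₀ h₁).differentiableAt (by simp)
  refine Prod.ext hev.self_of_nhds ?_
  simp only [phase]
  rw [hev.deriv_eq]
  exact (ht.hasFDerivAt.comp_hasDerivAt s hc.hasDerivAt).deriv

end SmoothCurve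

variable {g : LorentzMetric n M} {γ : ℝ → M} {a b s : ℝ} {x₀ : M}

theorem IsGeodesicOn.contMDiffAt (hγ : IsGeodesicOn g γ (Ioo a b)) (hs : s ∈ Ioo a b) :
    ContMDiffAt 𝓘(ℝ, ℝ) (𝓡 (n + 1)) ∞ γ s :=
  hγ.1.contMDiffAt (isOpen_Ioo.mem_nhds hs)

theorem IsGeodesicOn.hasDerivAt_phase (hγ : IsGeodesicOn g γ (Ioo a b)) (hs : s ∈ Ioo a b)
    (hx : γ s ∈ (extChartAt (𝓡 (n + 1)) x₀).source) :
    HasDerivAt (phase n x₀ γ) (geodesicField (g.coordMetric x₀) (phase n x₀ γ s)) s := by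
  have hc := contDiffAt_coordCurve (hγ.contMDiffAt hs) hx
  have hc' : ContDiffAt ℝ 1 (deriv (coordCurve n x₀ γ)) s :=
    (hc.fderiv_right (m := 1) (by norm_cast)).clm_apply contDiffAt_const
  have h1 := (hc.differentiableAt (by simp)).hasDerivAt
  have h2 := (hc'.differentiableAt (by simp)).hasDerivAt
  have h3 := hγ.2 x₀ s hs (mem_source_iff.1 hx)
  rw [LorentzMetric.covDerivAlong, LorentzMetric.christoffel_eq, add_eq_zero_iff_eq_neg] at h3
  rw [h3] at h2
  exact h1.prodMk h2

/-- A geodesic coincides with a solution of the geodesic equation in a chart with the same initial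
values, as long as the latter exists. -/
theorem IsGeodesicOn.eq_of_phase_eq [T2Space M] (hγ : IsGeodesicOn g γ (Ioo a b)) {c d : ℝ}
    (hcd : Ioo c d ⊆ Ioo a b) {η : ℝ → Euc (n + 1) × Euc (n + 1)}
    (hη : ∀ t ∈ Ioo c d, HasDerivAt η (geodesicField (g.coordMetric x₀) (η t)) t)
    (hηt : ∀ t ∈ Ioo c d, (η t).1 ∈ (extChartAt (𝓡 (n + 1)) x₀).target)
    (hs : s ∈ Ioo c d) (hx : γ s ∈ (extChartAt (𝓡 (n + 1)) x₀).source)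
    (heq : phase n x₀ γ s = η s) :
    ∀ t ∈ Ioo c d, γ t ∈ (extChartAt (𝓡 (n + 1)) x₀).source ∧ phase n x₀ γ t = η t := by
  set u := {t | t ∈ Ioo c d ∧ γ t ∈ (extChartAt (𝓡 (n + 1)) x₀).source ∧ phase n x₀ γ t = η t}
  suffices h : Ioo c d ⊆ u from fun t ht ↦ (h ht).2
  -- The times of agreement form an open set, by uniqueness for the differential equation, that is
  -- also relatively closed in the interval.
  refine isPreconnected_Ioo.subset_of_closure_inter_subset ?_ ⟨s, hs, hs, hx, heq⟩ ?_
  · rw [isOpen_iff_mem_nhds]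
    rintro t ⟨ht, htx, hte⟩
    obtain ⟨K, N, hN, hK⟩ := ((g.isCoordMetricAt (hηt t ht)).contDiffAt_geodesicField.of_le
      (m := 1) (by simp)).exists_lipschitzOnWith
    have hsrc : ∀ᶠ r in 𝓝 t, γ r ∈ (extChartAt (𝓡 (n + 1)) x₀).source :=
      eventually_mem_source (hγ.contMDiffAt (hcd ht)).continuousAt htx
    have hI : ∀ᶠ r in 𝓝 t, r ∈ Ioo c d := isOpen_Ioo.mem_nhds ht
    have hpc : ContinuousAt (phase n x₀ γ) t := (hγ.hasDerivAt_phase (hcd ht) htx).continuousAt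
    have := ODE_solution_unique_of_eventually (t₀ := t) (K := K) (s := fun _ ↦ N)
      (v := fun _ ↦ geodesicField (g.coordMetric x₀)) (f := phase n x₀ γ) (g := η)
      (Eventually.of_forall fun _ ↦ hK) ?_ ?_ hte
    · filter_upwards [this, hsrc, hI] with r h1 h2 h3 using ⟨h3, h2, h1⟩
    · filter_upwards [hsrc, hI, hpc (hte ▸ hN)] with r h1 h2 h3
      exact ⟨hγ.hasDerivAt_phase (hcd h2) h1, h3⟩
    · filter_upwards [hI, (hη t ht).continuousAt hN] with r h1 h2 using ⟨hη r h1, h2⟩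
  · rintro t ⟨htu, ht⟩
    have : (𝓝[u] t).NeBot := mem_closure_iff_nhdsWithin_neBot.1 htu
    have hηc : ContinuousAt η t := (hη t ht).continuousAt
    have hγc : ContinuousAt γ t := (hγ.contMDiffAt (hcd ht)).continuousAt
    have h1 : ContinuousAt (fun r ↦ (extChartAt (𝓡 (n + 1)) x₀).symm (η r).1) t :=
      ContinuousAt.comp (g := (extChartAt (𝓡 (n + 1)) x₀).symm) (f := fun r ↦ (η r).1)
        (continuousAt_extChartAt_symm'' (hηt t ht)) hηc.fst
    -- Hausdorffness enters here: the limit of `γ` is the point with coordinates `(η t).1`, which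
    -- lies in the chart, so `γ` cannot leave the chart at time `t`.
    have h2 : γ t = (extChartAt (𝓡 (n + 1)) x₀).symm (η t).1 := by
      refine tendsto_nhds_unique (hγc.continuousWithinAt (s := u))
        (Tendsto.congr' ?_ (h1.continuousWithinAt (s := u)))
      filter_upwards [self_mem_nhdsWithin] with r hr
      rw [← hr.2.2]
      exact (extChartAt (𝓡 (n + 1)) x₀).left_inv hr.2.1
    have h3 : γ t ∈ (extChartAt (𝓡 (n + 1)) x₀).source := by
      rw [h2]; exact (extChartAt (𝓡 (n + 1)) x₀).map_target (hηt t ht)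
    refine ⟨ht, h3, ?_⟩
    refine tendsto_nhds_unique
      ((hγ.hasDerivAt_phase (hcd ht) h3).continuousAt.continuousWithinAt (s := u))
      (Tendsto.congr' ?_ (hηc.continuousWithinAt (s := u)))
    filter_upwards [self_mem_nhdsWithin] with r hr using hr.2.2.symm

section Family

variable {P : Type*} [NormedAddCommGroup P] [NormedSpace ℝ P] {Γ : P → ℝ → M} {p₀ : P} {k : ℕ}

/-- At the fixed time `s`, the family `Γ` of curves and its velocities are `C^k` in the
parameter, at `p₀`. -/
structure RegularAt (n k : ℕ) {M : Type*} [TopologicalSpace M]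
    [ChartedSpace (Euc (n + 1)) M] (Γ : P → ℝ → M) (p₀ : P) (x₀ : M) (s : ℝ) : Prop where
  source : ∀ᶠ p in 𝓝 p₀, Γ p s ∈ (extChartAt (𝓡 (n + 1)) x₀).source
  smooth : ContDiffAt ℝ k (fun p ↦ phase n x₀ (Γ p) s) p₀

/-- The family `Γ` of curves and its velocities are jointly `C^k` in the parameter and in time,
at `(p₀, s)`. -/
structure JointRegularAt (n k : ℕ) {M : Type*} [TopologicalSpace M]
    [ChartedSpace (Euc (n + 1)) M] (Γ : P → ℝ → M) (p₀ : P) (x₀ : M) (s : ℝ) : Prop where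
  source : ∀ᶠ q in 𝓝 (p₀, s), Γ q.1 q.2 ∈ (extChartAt (𝓡 (n + 1)) x₀).source
  smooth : ContDiffAt ℝ k (fun q : P × ℝ ↦ phase n x₀ (Γ q.1) q.2) (p₀, s)

omit [IsManifold (𝓡 (n + 1)) ∞ M] in
theorem JointRegularAt.regularAt (h : JointRegularAt n k Γ p₀ x₀ s) : RegularAt n k Γ p₀ x₀ s := by
  have hc : ContDiff ℝ k (fun p : P ↦ (p, s)) := by fun_prop
  exact ⟨(hc.continuous.tendsto p₀).eventually h.source,
    ContDiffAt.comp p₀ (f := fun p : P ↦ (p, s)) h.smooth hc.contDiffAt⟩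

/-- The phase in the new chart is the transition map and its derivative applied to the old phase;
smoothness of the transition map transfers the regularity. -/
theorem RegularAt.change_chart {x₁ : M} (h : RegularAt n k Γ p₀ x₀ s)
    (hΓ : ∀ᶠ p in 𝓝 p₀, IsGeodesicOn g (Γ p) (Ioo a b)) (hs : s ∈ Ioo a b)
    (hx : Γ p₀ s ∈ (extChartAt (𝓡 (n + 1)) x₁).source) : RegularAt n k Γ p₀ x₁ s := by
  have h₀ := h.source.self_of_nhds
  have hcont : ContinuousAt (fun p ↦ Γ p s) p₀ := by
    have h1 : ContinuousAt (fun p ↦ (extChartAt (𝓡 (n + 1)) x₀).symm (phase n x₀ (Γ p) s).1) p₀ :=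
      ContinuousAt.comp (g := (extChartAt (𝓡 (n + 1)) x₀).symm)
        (f := fun p ↦ (phase n x₀ (Γ p) s).1)
        (continuousAt_extChartAt_symm'' ((extChartAt (𝓡 (n + 1)) x₀).map_source h₀))
        h.smooth.continuousAt.fst
    refine h1.congr ?_
    filter_upwards [h.source] with p hp
    exact (extChartAt (𝓡 (n + 1)) x₀).left_inv hp
  have hsrc := eventually_mem_source hcont hx
  refine ⟨hsrc, ?_⟩
  have hev : (fun p ↦ phase n x₁ (Γ p) s) =ᶠ[𝓝 p₀] fun p ↦
      (transition n x₀ x₁ (phase n x₀ (Γ p) s).1,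
        fderiv ℝ (transition n x₀ x₁) (phase n x₀ (Γ p) s).1 (phase n x₀ (Γ p) s).2) := by
    filter_upwards [hsrc, h.source, hΓ] with p h1 h2 h3
    exact phase_transition (h3.contMDiffAt hs) h2 h1
  refine ContDiffAt.congr_of_eventuallyEq ?_ hev
  have ht : ContDiffAt ℝ ∞ (transition n x₀ x₁) (phase n x₀ (Γ p₀) s).1 :=
    contDiffAt_transition h₀ hx
  have hk : ((k : ℕ) : WithTop ℕ∞) ≤ ∞ := by exact_mod_cast le_top
  refine ContDiffAt.prodMk (ContDiffAt.comp p₀ (f := fun p ↦ (phase n x₀ (Γ p) s).1)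
    (ht.of_le hk) h.smooth.fst) ?_
  refine ContDiffAt.clm_apply ?_ h.smooth.snd
  have ht' : ContDiffAt ℝ k (fderiv ℝ (transition n x₀ x₁)) (phase n x₀ (Γ p₀) s).1 :=
    (ht.fderiv_right (m := ∞) (by simp)).of_le hk
  exact ht'.comp p₀ h.smooth.fst

/-- Near `s` every curve of the family is the coordinate flow applied to its phase at any chosen
time `t₁`. The length `δ` does not depend on `t₁`; this uniformity makes the set of regular times
relatively closed as well as open. -/
theorem exists_forall_jointRegularAt [T2Space M] (k : ℕ)
    (hΓ : ∀ᶠ p in 𝓝 p₀, IsGeodesicOn g (Γ p) (Ioo a b)) (hs : s ∈ Ioo a b)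
    (hx : Γ p₀ s ∈ (extChartAt (𝓡 (n + 1)) x₀).source) :
    ∃ δ > 0, Ioo (s - δ) (s + δ) ⊆ Ioo a b ∧
      (∀ t ∈ Ioo (s - δ) (s + δ), Γ p₀ t ∈ (extChartAt (𝓡 (n + 1)) x₀).source) ∧
      ∀ r ∈ Ioo (s - δ) (s + δ), RegularAt n k Γ p₀ x₀ r →
        ∀ t ∈ Ioo (s - δ) (s + δ), JointRegularAt n k Γ p₀ x₀ t := by
  set F := geodesicField (g.coordMetric x₀)
  set y₀ := phase n x₀ (Γ p₀) s
  have hγ := hΓ.self_of_nhds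
  have hy₀ : y₀.1 ∈ (extChartAt (𝓡 (n + 1)) x₀).target :=
    (extChartAt (𝓡 (n + 1)) x₀).map_source hx
  obtain ⟨Φ, hΦ, hΦk⟩ := exists_isLocalFlow_contDiffAt k
    (g.isCoordMetricAt hy₀).contDiffAt_geodesicField
  have hΦ0 : Φ (y₀, 0) = y₀ := hΦ.zero.self_of_nhds
  have htarget : ∀ᶠ q in 𝓝 (y₀, (0 : ℝ)), (Φ q).1 ∈ (extChartAt (𝓡 (n + 1)) x₀).target :=
    hΦk.continuousAt.fst ((isOpen_extChartAt_target x₀).mem_nhds (by simpa only [hΦ0]))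
  have hzero : ∀ᶠ q in 𝓝 (y₀, (0 : ℝ)), Φ (q.1, 0) = q.1 :=
    (continuous_fst.tendsto (y₀, (0 : ℝ))).eventually hΦ.zero
  obtain ⟨r, hr, hball⟩ := Metric.eventually_nhds_iff_ball.1
    (((hΦ.deriv.and htarget).and hzero).and (hΦk.eventually (by simp)))
  have hp : ContinuousAt (phase n x₀ (Γ p₀)) s := (hγ.hasDerivAt_phase hs hx).continuousAt
  obtain ⟨δ₀, hδ₀, hδ⟩ := Metric.eventually_nhds_iff_ball.1
    (((eventually_mem_source (hγ.contMDiffAt hs).continuousAt hx).and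
      (hp (Metric.ball_mem_nhds y₀ hr))).and (isOpen_Ioo.mem_nhds hs))
  simp only [Real.ball_eq_Ioo] at hδ
  -- Two times in the interval differ by less than `2δ ≤ r`, so `t - t₁` stays in the domain of the
  -- flow.
  set δ := min δ₀ (r / 2)
  have hδpos : 0 < δ := lt_min hδ₀ (by linarith)
  have hsub : Ioo (s - δ) (s + δ) ⊆ Ioo (s - δ₀) (s + δ₀) :=
    Ioo_subset_Ioo (by linarith [min_le_left δ₀ (r / 2)]) (by linarith [min_le_left δ₀ (r / 2)])
  refine ⟨δ, hδpos, fun t ht ↦ (hδ t (hsub ht)).2, fun t ht ↦ (hδ t (hsub ht)).1.1,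
    fun t₁ ht₁ hreg t ht ↦ ?_⟩
  have hmem : ∀ y ∈ Metric.ball y₀ r, ∀ t ∈ Ioo (s - δ) (s + δ),
      (y, t - t₁) ∈ Metric.ball (y₀, (0 : ℝ)) r := by
    intro y hy t ht
    rw [← ball_prod_same]
    refine ⟨hy, ?_⟩
    rw [Real.ball_eq_Ioo]
    have := min_le_right δ₀ (r / 2)
    exact ⟨by linarith [ht.1, ht₁.2], by linarith [ht.2, ht₁.1]⟩
  have hy₁ : phase n x₀ (Γ p₀) t₁ ∈ Metric.ball y₀ r := (hδ t₁ (hsub ht₁)).1.2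
  have hev : ∀ᶠ p in 𝓝 p₀, ∀ t ∈ Ioo (s - δ) (s + δ),
      Γ p t ∈ (extChartAt (𝓡 (n + 1)) x₀).source ∧
        phase n x₀ (Γ p) t = Φ (phase n x₀ (Γ p) t₁, t - t₁) := by
    filter_upwards [hΓ, hreg.source,
      hreg.smooth.continuousAt (Metric.isOpen_ball.mem_nhds hy₁)] with p h1 h2 h3
    refine h1.eq_of_phase_eq (η := fun t ↦ Φ (phase n x₀ (Γ p) t₁, t - t₁))
      (fun t ht ↦ (hδ t (hsub ht)).2) (fun t ht ↦ ?_) (fun t ht ↦ ?_) ht₁ h2 ?_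
    · exact HasDerivAt.comp_sub_const (f := fun τ ↦ Φ (phase n x₀ (Γ p) t₁, τ)) t t₁
        (hball _ (hmem _ h3 t ht)).1.1.1
    · exact (hball _ (hmem _ h3 t ht)).1.1.2
    · rw [sub_self]
      exact ((hball _ (hmem _ h3 t ht)).1.2).symm
  have hev' : ∀ᶠ q in 𝓝 (p₀, t), Γ q.1 q.2 ∈ (extChartAt (𝓡 (n + 1)) x₀).source ∧
        phase n x₀ (Γ q.1) q.2 = Φ (phase n x₀ (Γ q.1) t₁, q.2 - t₁) := by
    rw [nhds_prod_eq]
    filter_upwards [prod_mem_prod hev (isOpen_Ioo.mem_nhds ht)] with q hq using hq.1 _ hq.2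
  refine ⟨hev'.mono fun q hq ↦ hq.1, ?_⟩
  refine ContDiffAt.congr_of_eventuallyEq ?_ (hev'.mono fun q hq ↦ hq.2)
  have hΦk' : ContDiffAt ℝ k Φ (phase n x₀ (Γ p₀) t₁, t - t₁) := (hball _ (hmem _ hy₁ t ht)).2
  have h1 : ContDiffAt ℝ k (fun q : P × ℝ ↦ phase n x₀ (Γ q.1) t₁) (p₀, t) :=
    ContDiffAt.comp (p₀, t) (g := fun p ↦ phase n x₀ (Γ p) t₁) (f := Prod.fst) hreg.smooth
      contDiffAt_fst
  exact ContDiffAt.comp (p₀, t) (f := fun q : P × ℝ ↦ (phase n x₀ (Γ q.1) t₁, q.2 - t₁)) hΦk'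
    (h1.prodMk (contDiffAt_snd.sub contDiffAt_const))

/-- A family of geodesics whose initial values are `C^k` in the parameter is `C^k`. -/
theorem jointRegularAt_of_regularAt [T2Space M]
    (hΓ : ∀ᶠ p in 𝓝 p₀, IsGeodesicOn g (Γ p) (Ioo a b)) {s₀ : ℝ} (hs₀ : s₀ ∈ Ioo a b)
    (h : RegularAt n k Γ p₀ x₀ s₀) (hs : s ∈ Ioo a b) {x₁ : M}
    (hx : Γ p₀ s ∈ (extChartAt (𝓡 (n + 1)) x₁).source) : JointRegularAt n k Γ p₀ x₁ s := by
  set u := {t | t ∈ Ioo a b ∧ ∃ x, RegularAt n k Γ p₀ x t}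
  have hmem : ∀ t ∈ Ioo a b, ∃ δ > 0, Ioo (t - δ) (t + δ) ⊆ Ioo a b ∧
      ((Ioo (t - δ) (t + δ) ∩ u).Nonempty → Ioo (t - δ) (t + δ) ⊆ u) := by
    intro t ht
    obtain ⟨δ, hδ, hsub, hsrc, hδ'⟩ := exists_forall_jointRegularAt k hΓ ht
      (mem_extChartAt_source (I := 𝓡 (n + 1)) (Γ p₀ t))
    refine ⟨δ, hδ, hsub, ?_⟩
    rintro ⟨r, hr, hru, x, hx⟩ r' hr'
    exact ⟨hsub hr', _, (hδ' r hr (hx.change_chart hΓ hru (hsrc r hr)) r' hr').regularAt⟩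
  have hself : ∀ t δ : ℝ, 0 < δ → t ∈ Ioo (t - δ) (t + δ) := fun t δ hδ ↦
    ⟨by linarith, by linarith⟩
  have hu : Ioo a b ⊆ u := by
    refine isPreconnected_Ioo.subset_of_closure_inter_subset ?_ ⟨s₀, hs₀, hs₀, x₀, h⟩ ?_
    · rw [isOpen_iff_mem_nhds]
      intro t ht
      obtain ⟨δ, hδ, hsub, h⟩ := hmem t ht.1
      exact mem_of_superset (isOpen_Ioo.mem_nhds (hself t δ hδ)) (h ⟨t, hself t δ hδ, ht⟩)
    · rintro t ⟨htu, ht⟩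
      obtain ⟨δ, hδ, hsub, h⟩ := hmem t ht
      refine h ?_ (hself t δ hδ)
      exact mem_closure_iff_nhds.1 htu _ (isOpen_Ioo.mem_nhds (hself t δ hδ))
  obtain ⟨-, x, hx'⟩ := hu hs
  obtain ⟨δ, hδ, hsub, hsrc, hδ'⟩ := exists_forall_jointRegularAt k hΓ hs hx
  exact hδ' s (hself s δ hδ) (hx'.change_chart hΓ hs hx) s (hself s δ hδ)

end Family

end Geodesics

/-! ### Variations through geodesics -/

section Variations

open Filter

variable {n : ℕ} {M : Type*} [TopologicalSpace M] [ChartedSpace (Euc (n + 1)) M]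
  {P : Type*} [NormedAddCommGroup P] [NormedSpace ℝ P]

/-- Position and velocity, in the chart at `x₀`, of the curves of the family `Γ`, as a function of
parameter and time. -/
def famPhase (n : ℕ) {M : Type*} [TopologicalSpace M] [ChartedSpace (Euc (n + 1)) M]
    {P : Type*} (x₀ : M) (Γ : P → ℝ → M) (q : P × ℝ) : Euc (n + 1) × Euc (n + 1) :=
  phase n x₀ (Γ q.1) q.2

/-- The variation field `dΓ(δp) + (σ + τ s) γ'` along `γ = Γ p`, for `u = (δp, σ, τ)`. -/
def varField (n : ℕ) {M : Type*} [TopologicalSpace M] [ChartedSpace (Euc (n + 1)) M]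
    {P : Type*} [NormedAddCommGroup P] [NormedSpace ℝ P] (Γ : P → ℝ → M) (p : P) (s : ℝ)
    (u : P × ℝ × ℝ) : TangentSpace (𝓡 (n + 1)) (Γ p s) :=
  mfderiv 𝓘(ℝ, P) (𝓡 (n + 1)) (fun p' ↦ Γ p' s) p u.1
    + (u.2.1 + u.2.2 * s) • velocity n (Γ p) s

/-- The variation field `varField` and its derivative with respect to time, in the chart at
`x₀`. -/
def varPhase (n : ℕ) {M : Type*} [TopologicalSpace M] [ChartedSpace (Euc (n + 1)) M]
    {P : Type*} [NormedAddCommGroup P] [NormedSpace ℝ P] (x₀ : M) (Γ : P → ℝ → M) (q : P × ℝ)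
    (u : P × ℝ × ℝ) : Euc (n + 1) × Euc (n + 1) :=
  fderiv ℝ (famPhase n x₀ Γ) q (u.1, u.2.1 + u.2.2 * q.2) + u.2.2 • (0, (famPhase n x₀ Γ q).2)

/-- A smooth family of geodesics. -/
structure IsGeodesicFamily [IsManifold (𝓡 (n + 1)) ∞ M] (g : LorentzMetric n M) (Γ : P → ℝ → M)
    (U : Set P) (a b : ℝ) : Prop where
  isOpen : IsOpen U
  geodesic : ∀ p ∈ U, IsGeodesicOn g (Γ p) (Ioo a b)
  regular : ∀ k, ∀ p ∈ U, ∀ s ∈ Ioo a b, ∀ x₀,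
    Γ p s ∈ (extChartAt (𝓡 (n + 1)) x₀).source → JointRegularAt n k Γ p x₀ s

variable [IsManifold (𝓡 (n + 1)) ∞ M] {g : LorentzMetric n M} {Γ : P → ℝ → M} {U : Set P}
  {a b s : ℝ} {p : P} {x₀ : M} {u : P × ℝ × ℝ}

namespace IsGeodesicFamily

theorem eventually (h : IsGeodesicFamily g Γ U a b) (hp : p ∈ U) (hs : s ∈ Ioo a b)
    (hx : Γ p s ∈ (extChartAt (𝓡 (n + 1)) x₀).source) : ∀ᶠ q in 𝓝 (p, s),
      (q.1 ∈ U ∧ q.2 ∈ Ioo a b) ∧ Γ q.1 q.2 ∈ (extChartAt (𝓡 (n + 1)) x₀).source :=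
  Filter.Eventually.and
    ((h.isOpen.prod isOpen_Ioo).mem_nhds (show (p, s) ∈ U ×ˢ Ioo a b from ⟨hp, hs⟩))
    (h.regular 0 p hp s hs x₀ hx).source

theorem eventually_time (h : IsGeodesicFamily g Γ U a b) (hp : p ∈ U) (hs : s ∈ Ioo a b)
    (hx : Γ p s ∈ (extChartAt (𝓡 (n + 1)) x₀).source) : ∀ᶠ t in 𝓝 s,
      t ∈ Ioo a b ∧ Γ p t ∈ (extChartAt (𝓡 (n + 1)) x₀).source := by
  have hc : Continuous fun t : ℝ ↦ (p, t) := by fun_prop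
  exact ((hc.tendsto s).eventually (h.eventually hp hs hx)).mono fun t ht ↦ ⟨ht.1.2, ht.2⟩

theorem contDiffAt_famPhase (h : IsGeodesicFamily g Γ U a b) (hp : p ∈ U) (hs : s ∈ Ioo a b)
    (hx : Γ p s ∈ (extChartAt (𝓡 (n + 1)) x₀).source) :
    ContDiffAt ℝ ∞ (famPhase n x₀ Γ) (p, s) :=
  contDiffAt_infty.2 fun k ↦ (h.regular k p hp s hs x₀ hx).smooth

theorem hasFDerivAt_famPhase (h : IsGeodesicFamily g Γ U a b) (hp : p ∈ U) (hs : s ∈ Ioo a b)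
    (hx : Γ p s ∈ (extChartAt (𝓡 (n + 1)) x₀).source) :
    HasFDerivAt (famPhase n x₀ Γ) (fderiv ℝ (famPhase n x₀ Γ) (p, s)) (p, s) :=
  ((h.contDiffAt_famPhase hp hs hx).differentiableAt (by simp)).hasFDerivAt

omit [NormedAddCommGroup P] [NormedSpace ℝ P] in
theorem isCoordMetricAt (hx : Γ p s ∈ (extChartAt (𝓡 (n + 1)) x₀).source) :
    IsCoordMetricAt (g.coordMetric x₀) (famPhase n x₀ Γ (p, s)).1 :=
  g.isCoordMetricAt ((extChartAt (𝓡 (n + 1)) x₀).map_source hx)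

theorem fderiv_famPhase_time (h : IsGeodesicFamily g Γ U a b) (hp : p ∈ U) (hs : s ∈ Ioo a b)
    (hx : Γ p s ∈ (extChartAt (𝓡 (n + 1)) x₀).source) (c : ℝ) :
    fderiv ℝ (famPhase n x₀ Γ) (p, s) (0, c)
      = c • geodesicField (g.coordMetric x₀) (famPhase n x₀ Γ (p, s)) := by
  have h1 := (h.hasFDerivAt_famPhase hp hs hx).comp_hasDerivAt s
    ((hasDerivAt_const s p).prodMk (hasDerivAt_id s))
  have h2 := (h.geodesic p hp).hasDerivAt_phase hs hx
  have h3 : fderiv ℝ (famPhase n x₀ Γ) (p, s) (0, 1)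
      = geodesicField (g.coordMetric x₀) (famPhase n x₀ Γ (p, s)) := h1.unique h2
  rw [← h3, ← map_smul]
  simp

/-- The linearized geodesic equation. -/
theorem hasDerivAt_varPhase (h : IsGeodesicFamily g Γ U a b) (hp : p ∈ U) (hs : s ∈ Ioo a b)
    (hx : Γ p s ∈ (extChartAt (𝓡 (n + 1)) x₀).source) (u : P × ℝ × ℝ) :
    HasDerivAt (fun t ↦ varPhase n x₀ Γ (p, t) u)
      (fderiv ℝ (geodesicField (g.coordMetric x₀)) (famPhase n x₀ Γ (p, s))
        (varPhase n x₀ Γ (p, s) u)) s := by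
  set Y := famPhase n x₀ Γ
  set F := geodesicField (g.coordMetric x₀)
  have hG := isCoordMetricAt (g := g) hx
  have hY := h.contDiffAt_famPhase hp hs hx
  have hDY : HasFDerivAt (fderiv ℝ Y) (fderiv ℝ (fderiv ℝ Y) (p, s)) (p, s) :=
    ((hY.fderiv_right (m := 1) (by norm_cast)).differentiableAt (by simp)).hasFDerivAt
  have hsymm := hY.isSymmSndFDerivAt (by
    rw [minSmoothness_of_isRCLikeNormedField, ← one_add_one_eq_two]; norm_cast)
  have hF : HasFDerivAt F (fderiv ℝ F (Y (p, s))) (Y (p, s)) :=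
    (hG.contDiffAt_geodesicField.differentiableAt (by simp)).hasFDerivAt
  have hline : HasDerivAt (fun t : ℝ ↦ (p, t)) (0, 1) s :=
    (hasDerivAt_const s p).prodMk (hasDerivAt_id s)
  -- Differentiate `∂_s Y = F(Y)` in the direction `v` and exchange the two derivatives.
  have hFY : ∀ v : P × ℝ, fderiv ℝ (fderiv ℝ Y) (p, s) (0, 1) v
      = fderiv ℝ F (Y (p, s)) (fderiv ℝ Y (p, s) v) := by
    intro v
    rw [hsymm.eq]
    have h1 : HasFDerivAt (fun q ↦ fderiv ℝ Y q (0, 1)) _ (p, s) :=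
      hDY.clm_apply (hasFDerivAt_const ((0 : P), (1 : ℝ)) (p, s))
    have h2 : HasFDerivAt (fun q ↦ F (Y q)) _ (p, s) :=
      hF.comp (p, s) (h.hasFDerivAt_famPhase hp hs hx)
    have hev : (fun q ↦ fderiv ℝ Y q (0, 1)) =ᶠ[𝓝 (p, s)] fun q ↦ F (Y q) := by
      filter_upwards [h.eventually hp hs hx] with q hq
      have := h.fderiv_famPhase_time hq.1.1 hq.1.2 hq.2 1
      rwa [one_smul] at this
    have := DFunLike.congr_fun (h1.unique (h2.congr_of_eventuallyEq hev)) v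
    simpa using this
  have hτ : HasDerivAt (fun t : ℝ ↦ (u.1, u.2.1 + u.2.2 * t)) ((0 : P), u.2.2) s := by
    refine (hasDerivAt_const s u.1).prodMk ?_
    simpa using ((hasDerivAt_id s).const_mul u.2.2).const_add u.2.1
  have h1 := (hDY.comp_hasDerivAt s hline).clm_apply hτ
  have hYt : HasDerivAt (fun t ↦ Y (p, t)) (F (Y (p, s))) s :=
    (h.geodesic p hp).hasDerivAt_phase hs hx
  have h2 : HasDerivAt (fun t ↦ u.2.2 • ((0 : Euc (n + 1)), (Y (p, t)).2))
      (u.2.2 • ((0 : Euc (n + 1)), (F (Y (p, s))).2)) s :=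
    ((hasDerivAt_const s (0 : Euc (n + 1))).prodMk hYt.snd).const_smul u.2.2
  refine (h1.add h2).congr_deriv ?_
  simp only [varPhase, map_add, map_smul, Function.comp_apply]
  rw [hFY, h.fderiv_famPhase_time hp hs hx, add_assoc, ← smul_add]
  congr 2
  -- The field `s γ'` satisfies the linearized equation because the geodesic equation is quadratic
  -- in the velocity: the derivative of `F` on `(0, c')` is `(c', 2 c'')`.
  rw [hG.fderiv_geodesicField]
  refine Prod.ext ?_ ?_
  · simp [geodesicField, Y]
  · simp only [F, Y, geodesicField, Prod.snd_add, map_zero, zero_apply, two_smul]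
    abel

theorem contMDiffAt_param (h : IsGeodesicFamily g Γ U a b) (hp : p ∈ U) (hs : s ∈ Ioo a b) :
    ContMDiffAt 𝓘(ℝ, P × ℝ) (𝓡 (n + 1)) ∞ (fun q : P × ℝ ↦ Γ q.1 q.2) (p, s) := by
  have hx := mem_extChartAt_source (I := 𝓡 (n + 1)) (Γ p s)
  have h1 : ContMDiffAt 𝓘(ℝ, P × ℝ) 𝓘(ℝ, Euc (n + 1)) ∞
      (fun q ↦ (famPhase n (Γ p s) Γ q).1) (p, s) :=
    (h.contDiffAt_famPhase hp hs hx).fst.contMDiffAt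
  have h2 := (contMDiffOn_extChartAt_symm (I := 𝓡 (n + 1)) (n := ∞) (Γ p s)).contMDiffAt
    ((isOpen_extChartAt_target (Γ p s)).mem_nhds ((extChartAt (𝓡 (n + 1)) (Γ p s)).map_source hx))
  refine (ContMDiffAt.comp (p, s) (f := fun q ↦ (famPhase n (Γ p s) Γ q).1) h2
    h1).congr_of_eventuallyEq ?_
  filter_upwards [h.eventually hp hs hx] with q hq
  exact ((extChartAt (𝓡 (n + 1)) (Γ p s)).left_inv hq.2).symm

theorem mdifferentiableAt_param (h : IsGeodesicFamily g Γ U a b) (hp : p ∈ U)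
    (hs : s ∈ Ioo a b) : MDifferentiableAt 𝓘(ℝ, P) (𝓡 (n + 1)) (fun p' ↦ Γ p' s) p := by
  have hc : ContMDiffAt 𝓘(ℝ, P) 𝓘(ℝ, P × ℝ) ∞ (fun p' : P ↦ (p', s)) p :=
    ContDiffAt.contMDiffAt (contDiffAt_id.prodMk contDiffAt_const)
  exact (ContMDiffAt.comp p (f := fun p' : P ↦ (p', s)) (h.contMDiffAt_param hp hs)
    hc).mdifferentiableAt (by simp)

theorem dchart_mfderiv_param (h : IsGeodesicFamily g Γ U a b) (hp : p ∈ U) (hs : s ∈ Ioo a b)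
    (hx : Γ p s ∈ (extChartAt (𝓡 (n + 1)) x₀).source) (v : P) :
    dchart x₀ (Γ p s) (mfderiv 𝓘(ℝ, P) (𝓡 (n + 1)) (fun p' ↦ Γ p' s) p v)
      = (fderiv ℝ (famPhase n x₀ Γ) (p, s) (v, 0)).1 := by
  have h1 := mfderiv_comp p (mdifferentiableAt_extChartAt (I := 𝓡 (n + 1)) (mem_source_iff.1 hx))
    (h.mdifferentiableAt_param hp hs)
  have h2 : mfderiv 𝓘(ℝ, P) 𝓘(ℝ, Euc (n + 1)) (extChartAt (𝓡 (n + 1)) x₀ ∘ fun p' ↦ Γ p' s) p v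
      = dchart x₀ (Γ p s) (mfderiv 𝓘(ℝ, P) (𝓡 (n + 1)) (fun p' ↦ Γ p' s) p v) := by
    rw [h1]; rfl
  rw [mfderiv_eq_fderiv] at h2
  have h3 : HasFDerivAt (fun p' ↦ famPhase n x₀ Γ (p', s))
      ((fderiv ℝ (famPhase n x₀ Γ) (p, s)).comp
        ((ContinuousLinearMap.id ℝ P).prod (0 : P →L[ℝ] ℝ))) p :=
    HasFDerivAt.comp p (f := fun p' ↦ (p', s)) (h.hasFDerivAt_famPhase hp hs hx)
      ((hasFDerivAt_id p).prodMk (hasFDerivAt_const s p))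
  have h4 : HasFDerivAt (extChartAt (𝓡 (n + 1)) x₀ ∘ fun p' ↦ Γ p' s)
      ((ContinuousLinearMap.fst ℝ _ _).comp _) p := h3.fst
  rw [← h2, h4.fderiv]
  rfl

theorem dchart_velocity (h : IsGeodesicFamily g Γ U a b) (hp : p ∈ U) (hs : s ∈ Ioo a b)
    (hx : Γ p s ∈ (extChartAt (𝓡 (n + 1)) x₀).source) :
    dchart x₀ (Γ p s) (velocity n (Γ p) s) = (famPhase n x₀ Γ (p, s)).2 :=
  (deriv_coordCurve ((h.geodesic p hp).contMDiffAt hs) hx).symm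

theorem dchart_varField (h : IsGeodesicFamily g Γ U a b) (hp : p ∈ U) (hs : s ∈ Ioo a b)
    (hx : Γ p s ∈ (extChartAt (𝓡 (n + 1)) x₀).source) (u : P × ℝ × ℝ) :
    dchart x₀ (Γ p s) (varField n Γ p s u) = (varPhase n x₀ Γ (p, s) u).1 := by
  have e : (u.1, u.2.1 + u.2.2 * s) = (u.1, (0 : ℝ)) + ((0 : P), u.2.1 + u.2.2 * s) := by simp
  rw [varField, varPhase, map_add, map_smul, h.dchart_mfderiv_param hp hs hx,
    h.dchart_velocity hp hs hx, e, map_add, h.fderiv_famPhase_time hp hs hx]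
  simp [geodesicField]

/-- The right-hand side does not mention a chart, so vanishing of the phase can be passed from one
chart to another. One direction is uniqueness for the linearized equation, the other is
differentiation of the field. -/
theorem varPhase_eq_zero_iff (h : IsGeodesicFamily g Γ U a b) (hp : p ∈ U) (hs : s ∈ Ioo a b)
    (hx : Γ p s ∈ (extChartAt (𝓡 (n + 1)) x₀).source) (u : P × ℝ × ℝ) :
    varPhase n x₀ Γ (p, s) u = 0 ↔ ∀ᶠ t in 𝓝 s, varField n Γ p t u = 0 := by
  have hev := h.eventually_time hp hs hx
  constructor
  · intro h0
    set A : ℝ → (Euc (n + 1) × Euc (n + 1) →L[ℝ] Euc (n + 1) × Euc (n + 1)) := fun t ↦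
      fderiv ℝ (geodesicField (g.coordMetric x₀)) (famPhase n x₀ Γ (p, t))
    have hA : ContinuousAt A s := by
      have h1 : ContinuousAt (fderiv ℝ (geodesicField (g.coordMetric x₀)))
          (famPhase n x₀ Γ (p, s)) :=
        ((isCoordMetricAt (g := g) hx).contDiffAt_geodesicField.fderiv_right (m := 0)
          (by simp)).continuousAt
      have h2 : ContinuousAt (fun t ↦ famPhase n x₀ Γ (p, t)) s :=
        ((h.geodesic p hp).hasDerivAt_phase hs hx).continuousAt
      exact ContinuousAt.comp (f := fun t ↦ famPhase n x₀ Γ (p, t)) h1 h2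
    have hbd : ∀ᶠ t in 𝓝 s, ‖A t‖ < ‖A s‖ + 1 := hA.norm.eventually_lt_const (by simp)
    have huniq := ODE_solution_unique_of_eventually (t₀ := s) (K := ⟨‖A s‖ + 1, by positivity⟩)
      (s := fun _ ↦ univ) (v := fun t x ↦ A t x) (f := fun t ↦ varPhase n x₀ Γ (p, t) u)
      (g := fun _ ↦ 0) ?_ ?_ ?_ h0
    · filter_upwards [huniq, hev] with t ht hts
      have := h.dchart_varField hp hts.1 hts.2 u
      rw [ht, Prod.fst_zero, ← map_zero (dchart (n := n) x₀ (Γ p t))] at this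
      exact dchart_injective hts.2 this
    · filter_upwards [hbd] with t ht
      exact ((A t).lipschitz.weaken ht.le).lipschitzOnWith
    · filter_upwards [hev] with t ht
      exact ⟨h.hasDerivAt_varPhase hp ht.1 ht.2 u, mem_univ _⟩
    · exact Eventually.of_forall fun t ↦ ⟨by simpa using hasDerivAt_const t (0 : _ × _),
        mem_univ _⟩
  · intro h0
    have h1 : ∀ᶠ t in 𝓝 s, (varPhase n x₀ Γ (p, t) u).1 = 0 := by
      filter_upwards [h0, hev] with t ht hts
      rw [← h.dchart_varField hp hts.1 hts.2 u, ht, map_zero]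
    have h2 : HasDerivAt (fun t ↦ (varPhase n x₀ Γ (p, t) u).1)
        (fderiv ℝ (geodesicField (g.coordMetric x₀)) (famPhase n x₀ Γ (p, s))
          (varPhase n x₀ Γ (p, s) u)).1 s := (h.hasDerivAt_varPhase hp hs hx u).fst
    have h3 : HasDerivAt (fun t ↦ (varPhase n x₀ Γ (p, t) u).1) 0 s :=
      (hasDerivAt_const s (0 : Euc (n + 1))).congr_of_eventuallyEq h1
    have h4 := h2.unique h3
    rw [(isCoordMetricAt (g := g) hx).fderiv_geodesicField] at h4
    exact Prod.ext h1.self_of_nhds h4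

/-- A variation field that vanishes to second order at one time vanishes to second order at all
times. -/
theorem varPhase_eq_zero (h : IsGeodesicFamily g Γ U a b) (hp : p ∈ U) {s₀ : ℝ}
    (hs₀ : s₀ ∈ Ioo a b) {x₀ : M} (hx₀ : Γ p s₀ ∈ (extChartAt (𝓡 (n + 1)) x₀).source)
    (h0 : varPhase n x₀ Γ (p, s₀) u = 0) (hs : s ∈ Ioo a b) {x₁ : M}
    (hx : Γ p s ∈ (extChartAt (𝓡 (n + 1)) x₁).source) : varPhase n x₁ Γ (p, s) u = 0 := by
  set w := {t | ∀ᶠ r in 𝓝 t, varField n Γ p r u = 0}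
  have hw : Ioo a b ⊆ w := by
    refine isPreconnected_Ioo.subset_of_closure_inter_subset ?_
      ⟨s₀, hs₀, (h.varPhase_eq_zero_iff hp hs₀ hx₀ u).1 h0⟩ ?_
    · exact isOpen_iff_mem_nhds.2 fun t ht ↦ ht.eventually_nhds
    · rintro t ⟨htw, ht⟩
      have : (𝓝[w] t).NeBot := mem_closure_iff_nhdsWithin_neBot.1 htw
      have hx' := mem_extChartAt_source (I := 𝓡 (n + 1)) (Γ p t)
      refine (h.varPhase_eq_zero_iff hp ht hx' u).1 ?_
      refine tendsto_nhds_unique ((h.hasDerivAt_varPhase hp ht hx'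
        u).continuousAt.continuousWithinAt (s := w)) (Tendsto.congr' ?_ tendsto_const_nhds)
      filter_upwards [self_mem_nhdsWithin,
        nhdsWithin_le_nhds (h.eventually_time hp ht hx')] with r hr hr'
      exact ((h.varPhase_eq_zero_iff hp hr'.1 hr'.2 u).2 hr).symm
  exact (h.varPhase_eq_zero_iff hp hs hx u).2 (hw hs)

end IsGeodesicFamily

end Variations

/-! ### Families of light rays -/

section LightFamilies

open Filter

theorem IsCoordMetricAt.exists_eq_one {E : Type*} [NormedAddCommGroup E] [NormedSpace ℝ E]
    {G : E → E →L[ℝ] E →L[ℝ] ℝ} {y v : E} (h : IsCoordMetricAt G y) (hv : v ≠ 0) :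
    ∃ w, G y v w = 1 := by
  have h1 : ∃ w, G y v w ≠ 0 := by
    by_contra! h0
    obtain ⟨e, he⟩ := h.inv
    refine hv (e.injective ?_)
    ext w
    have := h0 w
    rw [← he] at this
    simpa using this
  obtain ⟨w, hw⟩ := h1
  exact ⟨(G y v w)⁻¹ • w, by simp [hw]⟩

theorem finrank_ker_add_one {E : Type*} [AddCommGroup E] [Module ℝ E] [FiniteDimensional ℝ E]
    {f : E →ₗ[ℝ] ℝ} {w : E} (hw : f w ≠ 0) :
    Module.finrank ℝ (LinearMap.ker f) + 1 = Module.finrank ℝ E := by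
  have h1 : LinearMap.range f = ⊤ :=
    LinearMap.range_eq_top.2 (LinearMap.surjective (fun h ↦ hw (by simp [h])))
  have h2 := f.finrank_range_add_finrank_ker
  rw [h1, finrank_top, Module.finrank_self] at h2
  omega

variable {n : ℕ} {M : Type*} [TopologicalSpace M] [ChartedSpace (Euc (n + 1)) M]
  [IsManifold (𝓡 (n + 1)) ∞ M] {g : LorentzMetric n M}

/-- Energy conservation in the chart centred at each point gives a vanishing derivative throughout
the interval. -/
theorem IsGeodesicOn.energy_eq {γ : ℝ → M} {a b s t : ℝ} (hγ : IsGeodesicOn g γ (Ioo a b))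
    (hs : s ∈ Ioo a b) (ht : t ∈ Ioo a b) :
    g.val (γ s) (velocity n γ s) (velocity n γ s)
      = g.val (γ t) (velocity n γ t) (velocity n γ t) := by
  have key : ∀ r ∈ Ioo a b,
      HasDerivAt (fun r ↦ g.val (γ r) (velocity n γ r) (velocity n γ r)) 0 r := by
    intro r hr
    have hx := mem_extChartAt_source (I := 𝓡 (n + 1)) (γ r)
    have hG := g.isCoordMetricAt (mem_extChartAt_target (I := 𝓡 (n + 1)) (γ r))
    have h1 : HasDerivAt (coordEnergy (g.coordMetric (γ r)) ∘ phase n (γ r) γ) _ r :=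
      (IsCoordMetricAt.hasFDerivAt_coordEnergy (q := phase n (γ r) γ r)
        hG).1.hasFDerivAt.comp_hasDerivAt r (hγ.hasDerivAt_phase hr hx)
    rw [IsCoordMetricAt.fderiv_coordEnergy_geodesicField (q := phase n (γ r) γ r) hG] at h1
    refine h1.congr_of_eventuallyEq ?_
    filter_upwards [eventually_mem_source (hγ.contMDiffAt hr).continuousAt hx,
      isOpen_Ioo.mem_nhds hr] with t ht ht'
    simp only [Function.comp_apply, coordEnergy, phase]
    rw [deriv_coordCurve (hγ.contMDiffAt ht') ht]
    exact (g.coordMetric_dchart ht _ _).symm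
  exact isOpen_Ioo.is_const_of_deriv_eq_zero isPreconnected_Ioo
    (fun r hr ↦ (key r hr).differentiableAt.differentiableWithinAt)
    (fun r hr ↦ (key r hr).deriv) hs ht

variable {P : Type*} [NormedAddCommGroup P] [NormedSpace ℝ P]

/-- The variation field as a linear map. -/
def varFieldₗ (n : ℕ) {M : Type*} [TopologicalSpace M] [ChartedSpace (Euc (n + 1)) M]
    {P : Type*} [NormedAddCommGroup P] [NormedSpace ℝ P] (Γ : P → ℝ → M) (p : P) (s : ℝ) :
    (P × ℝ × ℝ) →ₗ[ℝ] TangentSpace (𝓡 (n + 1)) (Γ p s) where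
  toFun := varField n Γ p s
  map_add' u v := by
    let D : P →L[ℝ] TangentSpace (𝓡 (n + 1)) (Γ p s) :=
      mfderiv 𝓘(ℝ, P) (𝓡 (n + 1)) (fun p' ↦ Γ p' s) p
    change D (u.1 + v.1) + ((u.2.1 + v.2.1) + (u.2.2 + v.2.2) * s) • velocity n (Γ p) s
      = (D u.1 + (u.2.1 + u.2.2 * s) • velocity n (Γ p) s)
        + (D v.1 + (v.2.1 + v.2.2 * s) • velocity n (Γ p) s)
    rw [map_add]
    module
  map_smul' c u := by
    let D : P →L[ℝ] TangentSpace (𝓡 (n + 1)) (Γ p s) :=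
      mfderiv 𝓘(ℝ, P) (𝓡 (n + 1)) (fun p' ↦ Γ p' s) p
    change D (c • u.1) + (c * u.2.1 + c * u.2.2 * s) • velocity n (Γ p) s
      = c • (D u.1 + (u.2.1 + u.2.2 * s) • velocity n (Γ p) s)
    rw [map_smul]
    module

/-- `varPhase` as a linear map. -/
def varPhaseₗ (n : ℕ) {M : Type*} [TopologicalSpace M] [ChartedSpace (Euc (n + 1)) M]
    {P : Type*} [NormedAddCommGroup P] [NormedSpace ℝ P] (x₀ : M) (Γ : P → ℝ → M) (q : P × ℝ) :
    (P × ℝ × ℝ) →ₗ[ℝ] Euc (n + 1) × Euc (n + 1) where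
  toFun := varPhase n x₀ Γ q
  map_add' u v := by
    have e : ((u + v).1, (u + v).2.1 + (u + v).2.2 * q.2)
        = (u.1, u.2.1 + u.2.2 * q.2) + (v.1, v.2.1 + v.2.2 * q.2) :=
      Prod.ext rfl (by simp; ring)
    simp only [varPhase]
    rw [e, map_add, Prod.snd_add, Prod.snd_add]
    module
  map_smul' c u := by
    have e : ((c • u).1, (c • u).2.1 + (c • u).2.2 * q.2) = c • (u.1, u.2.1 + u.2.2 * q.2) :=
      Prod.ext rfl (by simp; ring)
    simp only [varPhase]
    rw [e, map_smul, Prod.smul_snd, Prod.smul_snd, RingHom.id_apply, smul_eq_mul]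
    module

/-- A smooth family of light rays whose phases, with the reparametrizations of the light rays,
locally exhaust the null vectors. -/
structure IsLightFamily (g : LorentzMetric n M) (Γ : P → ℝ → M) (U : Set P) (a b : ℝ) : Prop
    extends IsGeodesicFamily g Γ U a b where
  null : ∀ p ∈ U, ∀ s ∈ Ioo a b,
    g.val (Γ p s) (velocity n (Γ p) s) (velocity n (Γ p) s) = 0
  injective : ∀ p ∈ U, ∀ s ∈ Ioo a b, ∀ x₀, Γ p s ∈ (extChartAt (𝓡 (n + 1)) x₀).source →
    ∀ u, varPhase n x₀ Γ (p, s) u = 0 → u = 0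
  finrank : Module.finrank ℝ P + 1 = 2 * n

namespace IsLightFamily

variable {Γ : P → ℝ → M} {U : Set P} {a b s s' : ℝ} {p : P} {x₀ : M}

theorem famPhase_snd_ne_zero (h : IsLightFamily g Γ U a b) (hp : p ∈ U) (hs : s ∈ Ioo a b)
    (hx : Γ p s ∈ (extChartAt (𝓡 (n + 1)) x₀).source) : (famPhase n x₀ Γ (p, s)).2 ≠ 0 := by
  intro h0
  -- The reparametrization `t - s` vanishes at `t = s`, so the phase of this variation is `(0,
  -- γ'(s))`.
  have := h.injective p hp s hs x₀ hx (0, -s, 1) (by simp [varPhase, h0, ← Prod.zero_eq_mk])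
  simp at this

theorem velocity_ne_zero (h : IsLightFamily g Γ U a b) (hp : p ∈ U) (hs : s ∈ Ioo a b) :
    velocity n (Γ p) s ≠ 0 := by
  intro h0
  have hx := mem_extChartAt_source (I := 𝓡 (n + 1)) (Γ p s)
  refine h.famPhase_snd_ne_zero hp hs hx ?_
  rw [← h.dchart_velocity hp hs hx, h0, map_zero]

theorem coordEnergy_famPhase (h : IsLightFamily g Γ U a b) (hp : p ∈ U) (hs : s ∈ Ioo a b)
    (hx : Γ p s ∈ (extChartAt (𝓡 (n + 1)) x₀).source) :
    coordEnergy (g.coordMetric x₀) (famPhase n x₀ Γ (p, s)) = 0 := by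
  rw [coordEnergy, ← h.dchart_velocity hp hs hx]
  exact (g.coordMetric_dchart hx _ _).trans (h.null p hp s hs)

/-- The energy is identically zero on the family, so its derivative vanishes on all parameter and
time directions. The extra term `τ (0, γ')` contributes `2 τ g(γ', γ') = 0`. -/
theorem fderiv_coordEnergy_varPhase (h : IsLightFamily g Γ U a b) (hp : p ∈ U)
    (hs : s ∈ Ioo a b) (hx : Γ p s ∈ (extChartAt (𝓡 (n + 1)) x₀).source) (u : P × ℝ × ℝ) :
    fderiv ℝ (coordEnergy (g.coordMetric x₀)) (famPhase n x₀ Γ (p, s))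
      (varPhase n x₀ Γ (p, s) u) = 0 := by
  have hG := IsGeodesicFamily.isCoordMetricAt (g := g) hx
  have h1 := hG.hasFDerivAt_coordEnergy.1.hasFDerivAt.comp (p, s)
    (h.hasFDerivAt_famPhase hp hs hx)
  have h2 : HasFDerivAt (coordEnergy (g.coordMetric x₀) ∘ famPhase n x₀ Γ)
      (0 : P × ℝ →L[ℝ] ℝ) (p, s) := by
    refine (hasFDerivAt_const (0 : ℝ) (p, s)).congr_of_eventuallyEq ?_
    filter_upwards [h.eventually hp hs hx] with q hq
    exact h.coordEnergy_famPhase hq.1.1 hq.1.2 hq.2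
  have h3 : ∀ v, fderiv ℝ (coordEnergy (g.coordMetric x₀)) (famPhase n x₀ Γ (p, s))
      (fderiv ℝ (famPhase n x₀ Γ) (p, s) v) = 0 := fun v ↦ DFunLike.congr_fun (h1.unique h2) v
  have h4 : g.coordMetric x₀ (famPhase n x₀ Γ (p, s)).1 (famPhase n x₀ Γ (p, s)).2
    (famPhase n x₀ Γ (p, s)).2 = 0 := h.coordEnergy_famPhase hp hs hx
  rw [varPhase, map_add, h3, map_smul, hG.fderiv_coordEnergy, h4]
  simp

/-- The phases of the variation fields exhaust the tangent space of the null cone bundle. -/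
theorem exists_varPhase_eq [FiniteDimensional ℝ P] (h : IsLightFamily g Γ U a b) (hp : p ∈ U)
    (hs : s ∈ Ioo a b) (hx : Γ p s ∈ (extChartAt (𝓡 (n + 1)) x₀).source)
    {X : Euc (n + 1) × Euc (n + 1)}
    (hX : fderiv ℝ (coordEnergy (g.coordMetric x₀)) (famPhase n x₀ Γ (p, s)) X = 0) :
    ∃ u, varPhase n x₀ Γ (p, s) u = X := by
  have hG := IsGeodesicFamily.isCoordMetricAt (g := g) hx
  obtain ⟨w, hw⟩ := hG.exists_eq_one (h.famPhase_snd_ne_zero hp hs hx)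
  set f : Euc (n + 1) × Euc (n + 1) →ₗ[ℝ] ℝ :=
    (fderiv ℝ (coordEnergy (g.coordMetric x₀)) (famPhase n x₀ Γ (p, s))).toLinearMap
  have hf : f (0, w) ≠ 0 := by
    have : f (0, w) = _ := hG.fderiv_coordEnergy (0, w)
    rw [this]
    simp [hw]
  have h1 := finrank_ker_add_one hf
  have h2 : LinearMap.range (varPhaseₗ n x₀ Γ (p, s)) ≤ LinearMap.ker f := by
    rintro _ ⟨u, rfl⟩
    exact h.fderiv_coordEnergy_varPhase hp hs hx u
  have h3 := LinearMap.finrank_range_of_inj (f := varPhaseₗ n x₀ Γ (p, s))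
    ((injective_iff_map_eq_zero _).2 (h.injective p hp s hs x₀ hx))
  have h4 := h.finrank
  -- Equality by dimension: the kernel of the nonzero form has dimension `2(n + 1) - 1`, and the
  -- injective image has dimension `(2n - 1) + 2`.
  have h5 : LinearMap.range (varPhaseₗ n x₀ Γ (p, s)) = LinearMap.ker f := by
    refine Submodule.eq_of_le_of_finrank_eq h2 ?_
    rw [h3]
    simp only [Module.finrank_prod, Module.finrank_self, finrank_euclideanSpace_fin] at h1 ⊢
    omega
  have h6 : X ∈ LinearMap.ker f := hX
  rw [← h5] at h6
  exact h6

/-- Any position component `w` extends to a vector tangent to the null cone bundle: in the fibre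
direction the energy has derivative `2 g(γ', ·) ≠ 0`, so a multiple of a `w'` with `g(γ', w') = 1`
corrects the energy. -/
theorem varField_surjective [FiniteDimensional ℝ P] (h : IsLightFamily g Γ U a b) (hp : p ∈ U)
    (hs : s ∈ Ioo a b) : Function.Surjective (varField n Γ p s) := by
  intro w
  have hx := mem_extChartAt_source (I := 𝓡 (n + 1)) (Γ p s)
  have hG := IsGeodesicFamily.isCoordMetricAt (g := g) hx
  obtain ⟨w', hw'⟩ := hG.exists_eq_one (h.famPhase_snd_ne_zero hp hs hx)
  obtain ⟨u, hu⟩ := h.exists_varPhase_eq hp hs hx (X := (dchart _ _ w,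
    (-(fderiv ℝ (g.coordMetric (Γ p s)) (famPhase n (Γ p s) Γ (p, s)).1 (dchart _ _ w)
      (famPhase n (Γ p s) Γ (p, s)).2 (famPhase n (Γ p s) Γ (p, s)).2) / 2) • w')) (by
    rw [hG.fderiv_coordEnergy]
    simp only [map_smul, hw', smul_eq_mul]
    ring)
  refine ⟨u, dchart_injective hx ?_⟩
  rw [h.dchart_varField hp hs hx, hu]

/-- For a general Jacobi field `g(J, γ')` is affine in time. Its slope is half the variation of the
energy, which is zero for a variation through null geodesics. -/
theorem pairing_eq (h : IsLightFamily g Γ U a b) (hp : p ∈ U) (hs : s ∈ Ioo a b)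
    (hs' : s' ∈ Ioo a b) (u : P × ℝ × ℝ) :
    g.val (Γ p s) (varField n Γ p s u) (velocity n (Γ p) s)
      = g.val (Γ p s') (varField n Γ p s' u) (velocity n (Γ p) s') := by
  have key : ∀ r ∈ Ioo a b,
      HasDerivAt (fun r ↦ g.val (Γ p r) (varField n Γ p r u) (velocity n (Γ p) r)) 0 r := by
    intro r hr
    have hx := mem_extChartAt_source (I := 𝓡 (n + 1)) (Γ p r)
    have hG := IsGeodesicFamily.isCoordMetricAt (g := g) hx
    set x₀ := Γ p r
    set G := g.coordMetric x₀
    have hY : HasDerivAt (fun t ↦ famPhase n x₀ Γ (p, t)) _ r :=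
      (h.geodesic p hp).hasDerivAt_phase hr hx
    have hX := h.hasDerivAt_varPhase hp hr hx u
    have hY1 : HasDerivAt (fun t ↦ (famPhase n x₀ Γ (p, t)).1) (famPhase n x₀ Γ (p, r)).2 r :=
      hY.fst
    have hY2 : HasDerivAt (fun t ↦ (famPhase n x₀ Γ (p, t)).2)
      (geodesicField G (famPhase n x₀ Γ (p, r))).2 r := hY.snd
    have hX1 : HasDerivAt (fun t ↦ (varPhase n x₀ Γ (p, t) u).1) (varPhase n x₀ Γ (p, r) u).2 r := by
      rw [hG.fderiv_geodesicField] at hX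
      exact hX.fst
    have hGY := (hG.smooth.differentiableAt (by simp)).hasFDerivAt.comp_hasDerivAt r hY1
    have hd := (hGY.clm_apply hX1).clm_apply hY2
    refine (hd.congr_of_eventuallyEq ?_).congr_deriv ?_
    · filter_upwards [h.eventually_time hp hr hx] with t ht
      rw [← h.dchart_varField hp ht.1 ht.2, ← h.dchart_velocity hp ht.1 ht.2]
      exact (g.coordMetric_dchart ht.2 _ _).symm
    · have h1 := hG.fderiv_pairing (varPhase n x₀ Γ (p, r) u)
      rw [h.fderiv_coordEnergy_varPhase hp hr hx, mul_zero] at h1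
      simpa using h1
  exact isOpen_Ioo.is_const_of_deriv_eq_zero isPreconnected_Ioo
    (fun r hr ↦ (key r hr).differentiableAt.differentiableWithinAt)
    (fun r hr ↦ (key r hr).deriv) hs hs'

/-- A dimension count: the fields vanishing at `s'` inject into `γ'(s)^⊥`, the pairing with `γ'`
being constant and zero at `s'`, and both spaces have dimension `n`. -/
theorem exists_varField_eq [FiniteDimensional ℝ P] (h : IsLightFamily g Γ U a b) (hp : p ∈ U)
    (hs : s ∈ Ioo a b) (hs' : s' ∈ Ioo a b)
    (hinj : ∀ u, varField n Γ p s u = 0 → varField n Γ p s' u = 0 → u = 0)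
    {w : TangentSpace (𝓡 (n + 1)) (Γ p s)} (hw : g.val (Γ p s) w (velocity n (Γ p) s) = 0) :
    ∃ u, varField n Γ p s' u = 0 ∧ varField n Γ p s u = w := by
  have : FiniteDimensional ℝ (TangentSpace (𝓡 (n + 1)) (Γ p s)) :=
    inferInstanceAs (FiniteDimensional ℝ (Euc (n + 1)))
  have : FiniteDimensional ℝ (TangentSpace (𝓡 (n + 1)) (Γ p s')) :=
    inferInstanceAs (FiniteDimensional ℝ (Euc (n + 1)))
  have hd : ∀ t, Module.finrank ℝ (TangentSpace (𝓡 (n + 1)) (Γ p t)) = n + 1 := fun t ↦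
    finrank_euclideanSpace_fin
  set K := LinearMap.ker (varFieldₗ n Γ p s')
  set J : K →ₗ[ℝ] TangentSpace (𝓡 (n + 1)) (Γ p s) := (varFieldₗ n Γ p s).domRestrict K
  set f : TangentSpace (𝓡 (n + 1)) (Γ p s) →ₗ[ℝ] ℝ :=
    (g.val (Γ p s) (velocity n (Γ p) s)).toLinearMap
  have hf : ∃ w, f w ≠ 0 := by
    by_contra! h0
    exact h.velocity_ne_zero hp hs (g.nondegenerate h0)
  obtain ⟨w₁, hw₁⟩ := hf
  have h1 := finrank_ker_add_one hw₁
  -- Evaluation at `s'` is onto, so its kernel `K` has dimension `(2n + 1) - (n + 1) = n`.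
  have h2 := (varFieldₗ n Γ p s').finrank_range_add_finrank_ker
  rw [LinearMap.range_eq_top.2 (h.varField_surjective hp hs'), finrank_top, hd] at h2
  change _ + Module.finrank ℝ K = _ at h2
  have h3 : LinearMap.range J ≤ LinearMap.ker f := by
    rintro _ ⟨⟨u, hu⟩, rfl⟩
    have hu' : varField n Γ p s' u = 0 := hu
    have := h.pairing_eq hp hs hs' u
    rw [hu', map_zero, zero_apply, g.symm] at this
    exact this
  have h4 := LinearMap.finrank_range_of_inj (f := J) ((injective_iff_map_eq_zero _).2 (by
    rintro ⟨u, hu⟩ hu'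
    exact Subtype.ext (hinj u hu' hu)))
  have h5 := h.finrank
  have h6 : LinearMap.range J = LinearMap.ker f := by
    refine Submodule.eq_of_le_of_finrank_eq h3 ?_
    rw [h4]
    rw [hd] at h1
    simp only [Module.finrank_prod, Module.finrank_self] at h2
    omega
  have h7 : w ∈ LinearMap.ker f := by
    rw [LinearMap.mem_ker]
    exact (g.symm _ _ _).trans hw
  rw [← h6] at h7
  obtain ⟨⟨u, hu⟩, hu'⟩ := h7
  exact ⟨u, hu, hu'⟩

/-- A spacelike covector conormal to a light ray is determined, with its base point, by its
values on the variation fields, if the light ray has no conjugate points. -/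
theorem time_eq [FiniteDimensional ℝ P] (h : IsLightFamily g Γ U a b) (hp : p ∈ U)
    (hs : s ∈ Ioo a b) (hs' : s' ∈ Ioo a b)
    (hinj : s ≠ s' → ∀ u, varField n Γ p s u = 0 → varField n Γ p s' u = 0 → u = 0)
    {ξ : TangentSpace (𝓡 (n + 1)) (Γ p s) →L[ℝ] ℝ}
    {η : TangentSpace (𝓡 (n + 1)) (Γ p s') →L[ℝ] ℝ}
    (hξ : ξ (velocity n (Γ p) s) = 0)
    (hsp : 0 < g.val (Γ p s) (g.sharp (Γ p s) ξ) (g.sharp (Γ p s) ξ))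
    (heq : ∀ u, ξ (varField n Γ p s u) = η (varField n Γ p s' u)) : s = s' := by
  by_contra hne
  have h1 : g.val (Γ p s) (g.sharp (Γ p s) ξ) (velocity n (Γ p) s) = 0 := by
    rw [g.val_sharp, hξ]
  -- A field equal to `ξ^♯` at `s` and to zero at `s'`: the left side of `heq` is then `g⁻¹(ξ, ξ)`
  -- and the right side is zero.
  obtain ⟨u, hu, hu'⟩ := h.exists_varField_eq hp hs hs' (hinj hne) h1
  have h2 := heq u
  rw [hu, hu', map_zero] at h2
  rw [g.val_sharp, h2] at hsp
  exact lt_irrefl _ hsp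

end IsLightFamily

end LightFamilies

/-! ### The light rays near a given light ray -/

namespace LightRayFamily

open Filter

variable {n : ℕ} {M : Type*} [TopologicalSpace M] [ChartedSpace (Euc (n + 1)) M]
  [IsManifold (𝓡 (n + 1)) ∞ M] {g : LorentzMetric n M} (S : LightRayFamily g)

/-- The light ray with the parameters `p = (z, a)`. -/
def ray (p : Euc n × Euc (n - 1)) (s : ℝ) : M := S.γ p.1 p.2 s

/-- The coordinates `(t, z)` expressed in the chart at `x₀`. -/
def coordΨ (x₀ : M) (q : ℝ × Euc n) : Euc (n + 1) := extChartAt (𝓡 (n + 1)) x₀ (S.Ψ q)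

variable {S} {x₀ : M} {q : ℝ × Euc n} {p : Euc n × Euc (n - 1)}

theorem isOpen_params : IsOpen S.params := S.isOpen_Z.prod S.isOpen_A

theorem zero_mem_params : 0 ∈ S.params := ⟨S.zero_mem_Z, S.zero_mem_A⟩

theorem zero_mem_Ioo : (0 : ℝ) ∈ Ioo (-S.ε) (S.ℓ + S.ε) :=
  ⟨by linarith [S.ε_pos], by linarith [S.ε_pos, S.ℓ_pos]⟩

theorem Icc_subset : Icc 0 S.ℓ ⊆ Ioo (-S.ε) (S.ℓ + S.ε) :=
  Icc_subset_Ioo (by linarith [S.ε_pos]) (by linarith [S.ε_pos])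

theorem mem_source_Ψ {z : Euc n} (hz : z ∈ S.Z) : ((0 : ℝ), z) ∈ S.Ψ.source := by
  rw [S.source_Ψ]
  exact ⟨⟨by linarith [S.T_pos], S.T_pos⟩, hz⟩

theorem contMDiffAt_Ψ (hq : q ∈ S.Ψ.source) : ContMDiffAt 𝓘(ℝ, ℝ × Euc n) (𝓡 (n + 1)) ∞ S.Ψ q :=
  S.contMDiffOn_Ψ.contMDiffAt (S.Ψ.open_source.mem_nhds hq)

theorem contDiffAt_coordΨ (hq : q ∈ S.Ψ.source)
    (hx : S.Ψ q ∈ (extChartAt (𝓡 (n + 1)) x₀).source) : ContDiffAt ℝ ∞ (S.coordΨ x₀) q := by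
  rw [← contMDiffAt_iff_contDiffAt]
  exact (contMDiffAt_extChartAt' (I := 𝓡 (n + 1)) (n := ∞) (mem_source_iff.1 hx)).comp q
    (contMDiffAt_Ψ hq)

theorem fderiv_coordΨ (hq : q ∈ S.Ψ.source)
    (hx : S.Ψ q ∈ (extChartAt (𝓡 (n + 1)) x₀).source) (v : ℝ × Euc n) :
    fderiv ℝ (S.coordΨ x₀) q v
      = dchart x₀ (S.Ψ q) (mfderiv 𝓘(ℝ, ℝ × Euc n) (𝓡 (n + 1)) S.Ψ q v) := by
  have h := mfderiv_comp q (mdifferentiableAt_extChartAt (I := 𝓡 (n + 1)) (mem_source_iff.1 hx))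
    ((contMDiffAt_Ψ hq).mdifferentiableAt (by simp))
  have h2 : mfderiv 𝓘(ℝ, ℝ × Euc n) 𝓘(ℝ, Euc (n + 1)) (extChartAt (𝓡 (n + 1)) x₀ ∘ S.Ψ) q v
      = dchart x₀ (S.Ψ q) (mfderiv 𝓘(ℝ, ℝ × Euc n) (𝓡 (n + 1)) S.Ψ q v) := by rw [h]; rfl
  rw [mfderiv_eq_fderiv] at h2
  exact h2

/-- Pairing with the image of `(1, 0)` recovers `-τ`; the remaining spatial vector vanishes because
the metric is positive definite on such vectors. -/
theorem eq_zero_of_mfderiv_Ψ (hq : q ∈ S.Ψ.source) {v : ℝ × Euc n}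
    (hv : mfderiv 𝓘(ℝ, ℝ × Euc n) (𝓡 (n + 1)) S.Ψ q v = 0) : v = 0 := by
  obtain ⟨τ, u⟩ := v
  have hτ : τ = 0 := by
    have h1 := S.metric_Ψ q hq τ 1 u 0
    rw [hv, map_zero, zero_apply] at h1
    have h2 : mfderiv 𝓘(ℝ, ℝ × Euc n) (𝓡 (n + 1)) S.Ψ q ((0 : ℝ), (0 : Euc n)) = 0 :=
      map_zero (mfderiv 𝓘(ℝ, ℝ × Euc n) (𝓡 (n + 1)) S.Ψ q)
    rw [h2, map_zero] at h1
    linarith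
  subst hτ
  by_contra hne
  have h3 := S.metric_Ψ_pos q hq u (fun h ↦ hne (by rw [h]; rfl))
  rw [hv, map_zero] at h3
  exact lt_irrefl _ h3

theorem eq_zero_of_fderiv_coordΨ (hq : q ∈ S.Ψ.source)
    (hx : S.Ψ q ∈ (extChartAt (𝓡 (n + 1)) x₀).source) {v : ℝ × Euc n}
    (hv : fderiv ℝ (S.coordΨ x₀) q v = 0) : v = 0 := by
  rw [fderiv_coordΨ hq hx] at hv
  exact eq_zero_of_mfderiv_Ψ hq (dchart_injective hx (hv.trans (map_zero (dchart (n := n) _ _)).symm))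

theorem isGeodesicOn_ray (hp : p ∈ S.params) :
    IsGeodesicOn g (S.ray p) (Ioo (-S.ε) (S.ℓ + S.ε)) := S.isGeodesicOn_γ p.1 hp.1 p.2 hp.2

theorem ray_zero (hp : p ∈ S.params) : S.ray p 0 = S.Ψ (0, p.1) := S.γ_zero p.1 hp.1 p.2 hp.2

theorem phase_ray_zero (hp : p ∈ S.params)
    (hx : S.ray p 0 ∈ (extChartAt (𝓡 (n + 1)) x₀).source) :
    phase n x₀ (S.ray p) 0 = (S.coordΨ x₀ (0, p.1),
      fderiv ℝ (S.coordΨ x₀) (0, p.1) (1, S.θ p.1 p.2)) := by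
  have h0 := ray_zero hp
  refine Prod.ext (congrArg (extChartAt (𝓡 (n + 1)) x₀) h0) ?_
  have h1 : deriv (coordCurve n x₀ (S.ray p)) 0 = _ :=
    deriv_coordCurve ((isGeodesicOn_ray hp).contMDiffAt S.zero_mem_Ioo) hx
  have h2 : velocity n (S.ray p) 0 = mfderiv 𝓘(ℝ, ℝ × Euc n) (𝓡 (n + 1)) S.Ψ ((0 : ℝ), p.1)
      ((1 : ℝ), S.θ p.1 p.2) := by
    have := (S.velocity_γ_zero p.1 hp.1 p.2 hp.2).mfderiv
    rw [velocity]
    refine (DFunLike.congr_fun this (1 : ℝ)).trans ?_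
    exact one_smul ℝ _
  rw [h0] at hx
  refine h1.trans ?_
  rw [fderiv_coordΨ (mem_source_Ψ hp.1) hx, ← h2, h0]

/-- The initial velocity `(1, θ)` has square `-1 + 1`, as `θ` is a unit vector. -/
theorem null_ray_zero (hp : p ∈ S.params) :
    g.val (S.ray p 0) (velocity n (S.ray p) 0) (velocity n (S.ray p) 0) = 0 := by
  have hx := mem_extChartAt_source (I := 𝓡 (n + 1)) (S.ray p 0)
  have h1 := (isGeodesicOn_ray hp).contMDiffAt S.zero_mem_Ioo
  have h2 := phase_ray_zero hp hx
  have h3 : deriv (coordCurve n (S.ray p 0) (S.ray p)) 0 = _ := congrArg Prod.snd h2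
  have h4 := S.metric_Ψ _ (mem_source_Ψ hp.1) 1 1 (S.θ p.1 p.2) (S.θ p.1 p.2)
  rw [S.unit_θ _ hp.1 _ hp.2] at h4
  have h5 : S.Ψ ((0 : ℝ), p.1) ∈ (extChartAt (𝓡 (n + 1)) (S.ray p 0)).source := by
    rwa [← ray_zero hp]
  rw [← g.coordMetric_dchart hx, ← deriv_coordCurve h1 hx]
  rw [← g.coordMetric_dchart h5, ← fderiv_coordΨ (mem_source_Ψ hp.1) h5,
    ← ray_zero hp] at h4
  rw [h3]
  simpa using h4

theorem eventually_ray_zero (hp : p ∈ S.params)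
    (hx : S.ray p 0 ∈ (extChartAt (𝓡 (n + 1)) x₀).source) :
    ∀ᶠ p' in 𝓝 p, p' ∈ S.params ∧ S.ray p' 0 ∈ (extChartAt (𝓡 (n + 1)) x₀).source := by
  have h1 : ∀ᶠ p' in 𝓝 p, p' ∈ S.params := isOpen_params.mem_nhds hp
  have h2 : ContinuousAt (fun p' : Euc n × Euc (n - 1) ↦ S.Ψ (0, p'.1)) p :=
    ContinuousAt.comp (f := fun p' : Euc n × Euc (n - 1) ↦ ((0 : ℝ), p'.1))
      (contMDiffAt_Ψ (mem_source_Ψ hp.1)).continuousAt (by fun_prop)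
  rw [ray_zero hp] at hx
  filter_upwards [h1, eventually_mem_source h2 hx] with p' h3 h4
  exact ⟨h3, by rwa [ray_zero h3]⟩

/-- At time `0` position and velocity are explicit in terms of `Ψ` and `θ`. This is the initial
regularity that the flow carries to later times. -/
theorem regularAt_ray_zero (k : ℕ) (hp : p ∈ S.params) :
    RegularAt n k S.ray p (S.ray p 0) 0 := by
  have hx := mem_extChartAt_source (I := 𝓡 (n + 1)) (S.ray p 0)
  have hev := eventually_ray_zero hp hx
  have hq := mem_source_Ψ hp.1
  have hk : ((k : ℕ) : WithTop ℕ∞) ≤ ∞ := by exact_mod_cast le_top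
  refine ⟨hev.mono fun p' h ↦ h.2, ?_⟩
  have hΨ : ContDiffAt ℝ ∞ (S.coordΨ (S.ray p 0)) (0, p.1) :=
    contDiffAt_coordΨ hq (by rwa [← ray_zero hp])
  have hθ : ContDiffAt ℝ ∞ (fun p : Euc n × Euc (n - 1) ↦ S.θ p.1 p.2) p :=
    S.contDiffOn_θ.contDiffAt (isOpen_params.mem_nhds hp)
  have hl : ContDiffAt ℝ ∞ (fun p : Euc n × Euc (n - 1) ↦ ((0 : ℝ), p.1)) p := by fun_prop
  have h1 : ContDiffAt ℝ ∞ (fun p' : Euc n × Euc (n - 1) ↦ S.coordΨ (S.ray p 0) (0, p'.1)) p :=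
    ContDiffAt.comp p (f := fun p : Euc n × Euc (n - 1) ↦ ((0 : ℝ), p.1)) hΨ hl
  have h2 : ContDiffAt ℝ ∞ (fun p' : Euc n × Euc (n - 1) ↦
      fderiv ℝ (S.coordΨ (S.ray p 0)) (0, p'.1)) p :=
    ContDiffAt.comp p (f := fun p : Euc n × Euc (n - 1) ↦ ((0 : ℝ), p.1))
      (hΨ.fderiv_right (m := ∞) (by simp)) hl
  refine ((h1.prodMk (h2.clm_apply ((contDiffAt_const (c := (1 : ℝ))).prodMk hθ))).of_le
    hk).congr_of_eventuallyEq ?_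
  filter_upwards [hev] with p' h using phase_ray_zero h.1 h.2

theorem isGeodesicFamily [T2Space M] :
    IsGeodesicFamily g S.ray S.params (-S.ε) (S.ℓ + S.ε) where
  isOpen := isOpen_params
  geodesic _ hp := isGeodesicOn_ray hp
  regular k p hp s hs x₀ hx := by
    refine jointRegularAt_of_regularAt (g := g) ?_ S.zero_mem_Ioo (regularAt_ray_zero k hp) hs hx
    filter_upwards [isOpen_params.mem_nhds hp] with p hp using isGeodesicOn_ray hp

/-- The parametrization is nonredundant: `δz` and `σ` move the base point independently, while `δa`
turns the direction and `τ` rescales the velocity. -/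
theorem eq_zero_of_varPhase_zero [T2Space M] (hp : p ∈ S.params)
    (hx : S.ray p 0 ∈ (extChartAt (𝓡 (n + 1)) x₀).source)
    {u : (Euc n × Euc (n - 1)) × ℝ × ℝ} (hu : varPhase n x₀ S.ray (p, 0) u = 0) : u = 0 := by
  obtain ⟨⟨δz, δa⟩, σ, τ⟩ := u
  have hF := isGeodesicFamily (S := S)
  have hD := hF.hasFDerivAt_famPhase hp S.zero_mem_Ioo hx
  have hq := mem_source_Ψ hp.1
  have hx' : S.Ψ (0, p.1) ∈ (extChartAt (𝓡 (n + 1)) x₀).source := by rwa [← ray_zero hp]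
  have hev := eventually_ray_zero hp hx
  set L := fderiv ℝ (S.coordΨ x₀) (0, p.1)
  set Y := famPhase n x₀ S.ray
  have hΨ : HasFDerivAt (S.coordΨ x₀) L (0, p.1) :=
    ((contDiffAt_coordΨ hq hx').differentiableAt (by simp)).hasFDerivAt
  have hY0 : Y (p, 0) = (S.coordΨ x₀ (0, p.1), L (1, S.θ p.1 p.2)) := phase_ray_zero hp hx
  have hp1 : HasFDerivAt (fun p' ↦ Y (p', 0)) ((fderiv ℝ Y (p, 0)).comp
      ((ContinuousLinearMap.id ℝ _).prod (0 : Euc n × Euc (n - 1) →L[ℝ] ℝ))) p :=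
    HasFDerivAt.comp p (f := fun p' ↦ (p', (0 : ℝ))) hD
      ((hasFDerivAt_id p).prodMk (hasFDerivAt_const 0 p))
  have hz : ∀ v : Euc n × Euc (n - 1), (fderiv ℝ Y (p, 0) (v, 0)).1 = L (0, v.1) := by
    intro v
    have h1 : HasFDerivAt (fun p' ↦ (Y (p', 0)).1)
      ((ContinuousLinearMap.fst ℝ _ _).comp _) p := hp1.fst
    have h2 : HasFDerivAt (fun p' : Euc n × Euc (n - 1) ↦ S.coordΨ x₀ (0, p'.1))
        (L.comp ((0 : Euc n × Euc (n - 1) →L[ℝ] ℝ).prod (ContinuousLinearMap.fst ℝ _ _))) p :=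
      HasFDerivAt.comp p (f := fun p' : Euc n × Euc (n - 1) ↦ ((0 : ℝ), p'.1)) hΨ
        ((hasFDerivAt_const 0 p).prodMk hasFDerivAt_fst)
    have h3 := h1.unique (h2.congr_of_eventuallyEq (hev.mono fun p' h ↦
      congrArg Prod.fst (phase_ray_zero h.1 h.2)))
    exact DFunLike.congr_fun h3 v
  have ha : ∀ v : Euc (n - 1), (fderiv ℝ Y (p, 0) (((0 : Euc n), v), 0)).2
      = L (0, fderiv ℝ (S.θ p.1) p.2 v) := by
    intro v
    have hl : HasFDerivAt (fun a ↦ (p.1, a))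
        ((0 : Euc (n - 1) →L[ℝ] Euc n).prod (ContinuousLinearMap.id ℝ _)) p.2 :=
      (hasFDerivAt_const p.1 p.2).prodMk (hasFDerivAt_id p.2)
    have hp2 : HasFDerivAt (fun p' ↦ (Y (p', 0)).2)
      ((ContinuousLinearMap.snd ℝ _ _).comp _) p := hp1.snd
    have h1 := HasFDerivAt.comp p.2 (f := fun a ↦ (p.1, a)) (g := fun p' ↦ (Y (p', 0)).2) hp2 hl
    have hθ : HasFDerivAt (S.θ p.1) (fderiv ℝ (S.θ p.1) p.2) p.2 := by
      have := ContDiffAt.comp p.2 (f := fun a ↦ (p.1, a))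
        (g := fun p : Euc n × Euc (n - 1) ↦ S.θ p.1 p.2)
        (S.contDiffOn_θ.contDiffAt (isOpen_params.mem_nhds hp))
        (contDiffAt_const.prodMk contDiffAt_id)
      exact (this.differentiableAt (by simp)).hasFDerivAt
    have h2 : HasFDerivAt (fun a ↦ L (1, S.θ p.1 a))
        (L.comp ((0 : Euc (n - 1) →L[ℝ] ℝ).prod (fderiv ℝ (S.θ p.1) p.2))) p.2 :=
      L.hasFDerivAt.comp p.2 ((hasFDerivAt_const (1 : ℝ) p.2).prodMk hθ)
    have hc : ContinuousAt (fun a ↦ (p.1, a)) p.2 := hl.continuousAt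
    have h3 := h1.unique (h2.congr_of_eventuallyEq ((hc.eventually hev).mono fun a h ↦
      congrArg Prod.snd (phase_ray_zero h.1 h.2)))
    exact DFunLike.congr_fun h3 v
  have e : ∀ v : Euc n × Euc (n - 1), varPhase n x₀ S.ray (p, 0) (v, σ, τ)
      = fderiv ℝ Y (p, 0) (v, 0) + σ • geodesicField (g.coordMetric x₀) (Y (p, 0))
        + τ • (0, (Y (p, 0)).2) := by
    intro v
    rw [← hF.fderiv_famPhase_time hp S.zero_mem_Ioo hx, ← map_add]
    simp [varPhase, Y]
  rw [e] at hu
  -- The position component reads `L (σ, δz + σ θ) = 0`, whence `σ = 0` and `δz = 0`.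
  have h1 := congrArg Prod.fst hu
  simp only [Prod.fst_add, Prod.smul_fst, hz, geodesicField, hY0, smul_zero, add_zero,
    Prod.fst_zero, ← map_smul, ← map_add] at h1
  have h2 := eq_zero_of_fderiv_coordΨ hq hx' h1
  simp only [Prod.smul_mk, Prod.mk_add_mk, Prod.mk_eq_zero, smul_eq_mul, mul_one, zero_add] at h2
  obtain ⟨rfl, h2⟩ := h2
  rw [zero_smul, add_zero] at h2
  subst h2
  -- What remains of the velocity component reads `L (τ, dθ(δa) + τ θ) = 0`; the time part gives `τ
  -- = 0`, and the immersion property gives `δa = 0`.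
  have h3 := congrArg Prod.snd hu
  simp only [Prod.snd_add, Prod.smul_snd, ha, hY0, zero_smul, add_zero,
    Prod.snd_zero, ← map_smul, ← map_add] at h3
  have h4 := eq_zero_of_fderiv_coordΨ hq hx' h3
  simp only [Prod.smul_mk, Prod.mk_add_mk, Prod.mk_eq_zero, smul_eq_mul, mul_one, zero_add] at h4
  obtain ⟨rfl, h4⟩ := h4
  rw [zero_smul, add_zero] at h4
  have h5 : δa = 0 := S.immersion_θ p.1 hp.1 p.2 hp.2 (h4.trans (map_zero _).symm)
  subst h5
  rfl

theorem isLightFamily [T2Space M] (hn : 1 ≤ n) :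
    IsLightFamily g S.ray S.params (-S.ε) (S.ℓ + S.ε) where
  toIsGeodesicFamily := isGeodesicFamily
  null p hp s hs :=
    ((isGeodesicOn_ray hp).energy_eq hs S.zero_mem_Ioo).trans (null_ray_zero hp)
  injective p hp s hs x₀ hx u hu := by
    have hx0 := mem_extChartAt_source (I := 𝓡 (n + 1)) (S.ray p 0)
    exact eq_zero_of_varPhase_zero hp hx0
      (isGeodesicFamily.varPhase_eq_zero hp hs hx hu S.zero_mem_Ioo hx0)
  finrank := by
    simp only [Module.finrank_prod, finrank_euclideanSpace_fin]
    -- The dimension is `n + (n - 1) + 1` with truncated subtraction, so `1 ≤ n` is needed.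
    omega

end LightRayFamily

/-! ### Variation fields are Jacobi fields -/

section JacobiFields

open Filter

variable {n : ℕ} {M : Type*} [TopologicalSpace M] [ChartedSpace (Euc (n + 1)) M]
  [IsManifold (𝓡 (n + 1)) ∞ M] {g : LorentzMetric n M}
  {P : Type*} [NormedAddCommGroup P] [NormedSpace ℝ P]
  {Γ : P → ℝ → M} {U : Set P} {a b s : ℝ} {p : P} {x₀ : M}

namespace IsGeodesicFamily

theorem contDiffAt_varPhase (h : IsGeodesicFamily g Γ U a b) (hp : p ∈ U) (hs : s ∈ Ioo a b)
    (hx : Γ p s ∈ (extChartAt (𝓡 (n + 1)) x₀).source) (u : P × ℝ × ℝ) :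
    ContDiffAt ℝ ∞ (fun r : (P × ℝ) × P × ℝ × ℝ ↦ varPhase n x₀ Γ r.1 r.2) ((p, s), u) := by
  have hY := h.contDiffAt_famPhase hp hs hx
  have hY' : ContDiffAt ℝ ∞ (fun r : (P × ℝ) × P × ℝ × ℝ ↦ famPhase n x₀ Γ r.1) ((p, s), u) :=
    ContDiffAt.comp ((p, s), u) (f := fun r : (P × ℝ) × P × ℝ × ℝ ↦ r.1) hY contDiffAt_fst
  have hD : ContDiffAt ℝ ∞ (fun r : (P × ℝ) × P × ℝ × ℝ ↦ fderiv ℝ (famPhase n x₀ Γ) r.1)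
      ((p, s), u) :=
    ContDiffAt.comp ((p, s), u) (f := fun r : (P × ℝ) × P × ℝ × ℝ ↦ r.1)
      (hY.fderiv_right (m := ∞) (by simp)) contDiffAt_fst
  have h1 : ContDiffAt ℝ ∞ (fun r : (P × ℝ) × P × ℝ × ℝ ↦ (r.2.1, r.2.2.1 + r.2.2.2 * r.1.2))
    ((p, s), u) := by fun_prop
  have h2 : ContDiffAt ℝ ∞ (fun r : (P × ℝ) × P × ℝ × ℝ ↦ r.2.2.2) ((p, s), u) := by fun_prop
  exact (hD.clm_apply h1).add (h2.smul (contDiffAt_const.prodMk hY'.snd))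

theorem continuousAt_varPhase (h : IsGeodesicFamily g Γ U a b) (hp : p ∈ U) (hs : s ∈ Ioo a b)
    (hx : Γ p s ∈ (extChartAt (𝓡 (n + 1)) x₀).source) (u : P × ℝ × ℝ) :
    ContinuousAt (fun r : P × ℝ × P × ℝ × ℝ ↦ varPhase n x₀ Γ (r.1, r.2.1) r.2.2) (p, s, u) :=
  ContinuousAt.comp (x := (p, s, u)) (f := fun r : P × ℝ × P × ℝ × ℝ ↦ ((r.1, r.2.1), r.2.2))
    (g := fun r : (P × ℝ) × P × ℝ × ℝ ↦ varPhase n x₀ Γ r.1 r.2)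
    (h.contDiffAt_varPhase hp hs hx u).continuousAt (by fun_prop)

/-- The derivative of the variation field along a geodesic. -/
theorem hasDerivAt_varPhase_fst (h : IsGeodesicFamily g Γ U a b) (hp : p ∈ U)
    (hs : s ∈ Ioo a b) (hx : Γ p s ∈ (extChartAt (𝓡 (n + 1)) x₀).source) (u : P × ℝ × ℝ) :
    HasDerivAt (fun t ↦ (varPhase n x₀ Γ (p, t) u).1) (varPhase n x₀ Γ (p, s) u).2 s := by
  have hX := h.hasDerivAt_varPhase hp hs hx u
  rw [(isCoordMetricAt (g := g) hx).fderiv_geodesicField] at hX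
  exact hX.fst

/-- The linearized geodesic equation, rewritten with covariant derivatives: the terms that
differentiate the Christoffel symbols, with those quadratic in them, combine to the curvature. -/
theorem isJacobiFieldOn (h : IsGeodesicFamily g Γ U a b) (hp : p ∈ U) (u : P × ℝ × ℝ) :
    IsJacobiFieldOn g (Γ p) (fun s ↦ varField n Γ p s u) (Ioo a b) := by
  constructor
  · intro s hs
    refine ContMDiffAt.contMDiffWithinAt ?_
    have hx := mem_extChartAt_source (I := 𝓡 (n + 1)) (Γ p s)
    refine (Trivialization.contMDiffAt_iff (e := trivializationAt (Euc (n + 1))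
      (TangentSpace (𝓡 (n + 1)) (M := M)) (Γ p s)) (IB := 𝓡 (n + 1)) (IM := 𝓘(ℝ, ℝ)) ?_).2
      ⟨(h.geodesic p hp).contMDiffAt hs, ?_⟩
    · simp [TangentBundle.trivializationAt_source]
    · have hd : ContDiffAt ℝ ∞ (fun t ↦ (varPhase n (Γ p s) Γ (p, t) u).1) s :=
        ContDiffAt.fst (ContDiffAt.comp s (f := fun t : ℝ ↦ ((p, t), u))
          (h.contDiffAt_varPhase hp hs hx u) (by fun_prop))
      refine hd.contMDiffAt.congr_of_eventuallyEq ?_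
      filter_upwards [h.eventually_time hp hs hx] with t ht
      have ht' := mem_source_iff.1 ht.2
      have h1 := TangentBundle.continuousLinearMapAt_trivializationAt (I := 𝓡 (n + 1)) ht'
      have h2 := DFunLike.congr_fun h1 (varField n Γ p t u)
      refine Eq.trans ?_ (h2.trans (h.dchart_varField hp ht.1 ht.2 u))
      rw [Trivialization.continuousLinearMapAt_apply, Trivialization.linearMapAt_apply,
        if_pos (by simpa using ht')]
  · intro x₀ s hs hx
    rw [← mem_source_iff] at hx
    have hG := isCoordMetricAt (g := g) hx
    set G := g.coordMetric x₀ with hGdef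
    set Y : ℝ → _ := fun t ↦ famPhase n x₀ Γ (p, t) with hYdef
    set X : ℝ → _ := fun t ↦ varPhase n x₀ Γ (p, t) u with hXdef
    have hcov : ∀ v t, g.covDerivAlong x₀ (coordCurve n x₀ (Γ p)) v t
        = deriv v t + christoffelCLM G (Y t).1 (Y t).2 (v t) := fun v t ↦ rfl
    have hJ : coordField x₀ (Γ p) (fun s ↦ varField n Γ p s u) =ᶠ[𝓝 s] fun t ↦ (X t).1 := by
      filter_upwards [h.eventually_time hp hs hx] with t ht using h.dchart_varField hp ht.1 ht.2 u
    have hDJ : g.covDerivAlong x₀ (coordCurve n x₀ (Γ p))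
        (coordField x₀ (Γ p) (fun s ↦ varField n Γ p s u)) =ᶠ[𝓝 s]
        fun t ↦ (X t).2 + christoffelCLM G (Y t).1 (Y t).2 (X t).1 := by
      filter_upwards [h.eventually_time hp hs hx, hJ.eventuallyEq_nhds] with t ht ht'
      rw [hcov, ht'.eq_of_nhds, ht'.deriv_eq, (h.hasDerivAt_varPhase_fst hp ht.1 ht.2 u).deriv]
    have hY : HasDerivAt Y (geodesicField G (Y s)) s := (h.geodesic p hp).hasDerivAt_phase hs hx
    have hY1 : HasDerivAt (fun t ↦ (Y t).1) (Y s).2 s := hY.fst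
    have hY2 : HasDerivAt (fun t ↦ (Y t).2) (-christoffelCLM G (Y s).1 (Y s).2 (Y s).2) s := hY.snd
    have hX1 : HasDerivAt (fun t ↦ (X t).1) (X s).2 s := h.hasDerivAt_varPhase_fst hp hs hx u
    have hX2 : HasDerivAt (fun t ↦ (X t).2) (-(fderiv ℝ (christoffelCLM G) (Y s).1 (X s).1 (Y s).2
        (Y s).2 + (2 : ℝ) • christoffelCLM G (Y s).1 (Y s).2 (X s).2)) s := by
      have := h.hasDerivAt_varPhase hp hs hx u
      rw [hG.fderiv_geodesicField] at this
      exact this.snd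
    have hC : HasFDerivAt (christoffelCLM G) (fderiv ℝ (christoffelCLM G) (Y s).1) (Y s).1 :=
      (hG.contDiffAt_christoffelCLM.differentiableAt (by simp)).hasFDerivAt
    have hCY := hC.comp_hasDerivAt s hY1
    have hD := hX2.add ((hCY.clm_apply hY2).clm_apply hX1)
    have hfd : ∀ v w z : Euc (n + 1), fderiv ℝ (fun y ↦ g.christoffel x₀ y v w) (Y s).1 z
        = fderiv ℝ (christoffelCLM G) (Y s).1 z v w := by
      intro v w z
      have h1 := (hC.clm_apply (hasFDerivAt_const v _)).clm_apply (hasFDerivAt_const w _)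
      have h2 : HasFDerivAt (fun y ↦ g.christoffel x₀ y v w) _ (Y s).1 := h1
      rw [h2.fderiv]
      simp
    -- The symbols are symmetric at all nearby points, hence so are their derivatives.
    have hfs : ∀ v w z : Euc (n + 1), fderiv ℝ (christoffelCLM G) (Y s).1 z v w
        = fderiv ℝ (christoffelCLM G) (Y s).1 z w v := by
      intro v w z
      rw [← hfd, ← hfd]
      refine DFunLike.congr_fun (Filter.EventuallyEq.fderiv_eq ?_) z
      filter_upwards [(isOpen_extChartAt_target x₀).mem_nhds
        ((extChartAt (𝓡 (n + 1)) x₀).map_source hx)] with y hy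
      exact (g.isCoordMetricAt hy).christoffelCLM_symm v w
    rw [hcov, hDJ.self_of_nhds, hDJ.deriv_eq]
    have hd := hD.deriv
    have hd' : deriv (fun t ↦ (X t).2 + christoffelCLM G (Y t).1 (Y t).2 (X t).1) s = _ := hd
    rw [hd', LorentzMetric.curvature]
    have e1 : coordCurve n x₀ (Γ p) s = (Y s).1 := rfl
    have e2 : deriv (coordCurve n x₀ (Γ p)) s = (Y s).2 := rfl
    rw [e1, e2, hJ.self_of_nhds, hfd, hfd]
    simp only [LorentzMetric.christoffel_eq, ← hGdef, Function.comp_apply, map_neg, map_add,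
      add_apply, neg_apply]
    rw [hfs (X s).1 (Y s).2, hG.christoffelCLM_symm (christoffelCLM G (Y s).1 (Y s).2 (Y s).2),
      hG.christoffelCLM_symm (X s).1 (Y s).2]
    module

end IsGeodesicFamily

/-! ### Stability of the absence of conjugate points -/

theorem injOn_of_inner_deriv_pos {E : Type*} [NormedAddCommGroup E] [InnerProductSpace ℝ E]
    {f f' : ℝ → E} {D : Set ℝ} {v : E} (hD : Convex ℝ D) (hDo : IsOpen D)
    (hd : ∀ t ∈ D, HasDerivAt f (f' t) t) (hpos : ∀ t ∈ D, 0 < inner ℝ v (f' t)) : InjOn f D := by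
  have hd' : ∀ t ∈ D, HasDerivAt (fun t ↦ innerSL ℝ v (f t)) (innerSL ℝ v (f' t)) t := fun t ht ↦
    (innerSL ℝ v).hasFDerivAt.comp_hasDerivAt t (hd t ht)
  have hmono : StrictMonoOn (fun t ↦ innerSL ℝ v (f t)) D := by
    refine strictMonoOn_of_deriv_pos hD
      (fun t ht ↦ (hd' t ht).continuousAt.continuousWithinAt) fun t ht ↦ ?_
    rw [hDo.interior_eq] at ht
    rw [(hd' t ht).deriv]
    exact hpos t ht
  exact fun s hs t ht hst ↦ hmono.injOn hs ht (congrArg (innerSL ℝ v) hst)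

namespace IsLightFamily

theorem eq_zero_of_forall_varField_eq_zero (h : IsLightFamily g Γ U a b) (hp : p ∈ U)
    (hab : (Ioo a b).Nonempty) {u : P × ℝ × ℝ} (hu : ∀ s ∈ Ioo a b, varField n Γ p s u = 0) :
    u = 0 := by
  obtain ⟨s, hs⟩ := hab
  have hx := mem_extChartAt_source (I := 𝓡 (n + 1)) (Γ p s)
  refine h.injective p hp s hs _ hx u ((h.varPhase_eq_zero_iff hp hs hx u).2 ?_)
  filter_upwards [isOpen_Ioo.mem_nhds hs] with t ht using hu t ht

theorem eventually_varField_ne_zero (h : IsLightFamily g Γ U a b) (hp : p ∈ U)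
    (hs : s ∈ Ioo a b) {u : P × ℝ × ℝ} (hu : varField n Γ p s u ≠ 0) :
    ∀ᶠ r in 𝓝 (p, s, u), varField n Γ r.1 r.2.1 r.2.2 ≠ 0 := by
  have hx := mem_extChartAt_source (I := 𝓡 (n + 1)) (Γ p s)
  have hc : ContinuousAt (fun r : P × ℝ × P × ℝ × ℝ ↦
      (varPhase n (Γ p s) Γ (r.1, r.2.1) r.2.2).1) (p, s, u) :=
    (h.continuousAt_varPhase hp hs hx u).fst
  have hne : (varPhase n (Γ p s) Γ (p, s) u).1 ≠ 0 := by
    rw [← h.dchart_varField hp hs hx]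
    exact fun h0 ↦ hu (dchart_injective hx (h0.trans (map_zero (dchart (n := n) _ _)).symm))
  have hq : Tendsto (fun r : P × ℝ × P × ℝ × ℝ ↦ (r.1, r.2.1)) (𝓝 (p, s, u)) (𝓝 (p, s)) :=
    Continuous.tendsto (by fun_prop) (p, s, u)
  filter_upwards [hc.eventually_ne hne, hq.eventually (h.eventually hp hs hx)] with r hr hr' h0
  refine hr ?_
  rw [← h.dchart_varField hr'.1.1 hr'.1.2 hr'.2, h0, map_zero]

/-- A nontrivial variation field vanishes at most once on a short time interval. -/
theorem exists_forall_varField_ne_zero (h : IsLightFamily g Γ U a b) (hp : p ∈ U)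
    (hs : s ∈ Ioo a b) {u : P × ℝ × ℝ} (hu : u ≠ 0) :
    ∃ δ > 0, ∀ᶠ r in 𝓝 (p, u), ∀ s₁ ∈ Metric.ball s δ, ∀ s₂ ∈ Metric.ball s δ,
      varField n Γ r.1 s₁ r.2 = 0 → varField n Γ r.1 s₂ r.2 = 0 → s₁ = s₂ := by
  have hx := mem_extChartAt_source (I := 𝓡 (n + 1)) (Γ p s)
  set x₀ := Γ p s
  set v := (varPhase n x₀ Γ (p, s) u).2
  by_cases h1 : varField n Γ p s u = 0
  swap
  · obtain ⟨V, hV, W, hW, hVW⟩ := mem_nhds_prod_iff.1 (h.eventually_varField_ne_zero hp hs h1)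
    obtain ⟨N, hN, W', hW', hNW⟩ := mem_nhds_prod_iff.1 hW
    obtain ⟨δ, hδ, hball⟩ := Metric.mem_nhds_iff.1 hN
    refine ⟨δ, hδ, ?_⟩
    filter_upwards [prod_mem_nhds hV hW'] with r hr s₁ hs₁ s₂ hs₂ h0
    exact absurd h0 (hVW (mk_mem_prod hr.1 (hNW (mk_mem_prod (hball hs₁) hr.2))))
  · have hv : v ≠ 0 := by
      intro hv
      refine hu (h.injective p hp s hs x₀ hx u (Prod.ext ?_ hv))
      rw [← h.dchart_varField hp hs hx, h1, map_zero]
      rfl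
    have hc : ContinuousAt (fun r : P × ℝ × P × ℝ × ℝ ↦
        inner ℝ v (varPhase n x₀ Γ (r.1, r.2.1) r.2.2).2) (p, s, u) :=
      continuousAt_const.inner (h.continuousAt_varPhase hp hs hx u).snd
    have hpos : 0 < inner ℝ v (varPhase n x₀ Γ (p, s) u).2 := real_inner_self_pos.2 hv
    have hq : Tendsto (fun r : P × ℝ × P × ℝ × ℝ ↦ (r.1, r.2.1)) (𝓝 (p, s, u)) (𝓝 (p, s)) :=
      Continuous.tendsto (by fun_prop) (p, s, u)
    have hev : ∀ᶠ r : P × ℝ × P × ℝ × ℝ in 𝓝 (p, s, u),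
        0 < inner ℝ v (varPhase n x₀ Γ (r.1, r.2.1) r.2.2).2 ∧
        (r.1 ∈ U ∧ r.2.1 ∈ Ioo a b) ∧ Γ r.1 r.2.1 ∈ (extChartAt (𝓡 (n + 1)) x₀).source := by
      filter_upwards [hc.eventually (lt_mem_nhds hpos), hq.eventually (h.eventually hp hs hx)]
        with r h1 h2 using ⟨h1, h2⟩
    obtain ⟨V, hV, W, hW, hVW⟩ := mem_nhds_prod_iff.1 hev
    obtain ⟨N, hN, W', hW', hNW⟩ := mem_nhds_prod_iff.1 hW
    obtain ⟨δ, hδ, hball⟩ := Metric.mem_nhds_iff.1 hN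
    refine ⟨δ, hδ, ?_⟩
    filter_upwards [prod_mem_nhds hV hW'] with r hr
    have key : ∀ t ∈ Metric.ball s δ, 0 < inner ℝ v (varPhase n x₀ Γ (r.1, t) r.2).2 ∧
        (r.1 ∈ U ∧ t ∈ Ioo a b) ∧ Γ r.1 t ∈ (extChartAt (𝓡 (n + 1)) x₀).source := by
      intro t ht
      have hmem : (r.1, t, r.2) ∈ V ×ˢ W := mk_mem_prod hr.1 (hNW (mk_mem_prod (hball ht) hr.2))
      have hev' := hVW hmem
      rwa [mem_ofPred_eq] at hev'
    have hz : ∀ t ∈ Metric.ball s δ, varField n Γ r.1 t r.2 = 0 →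
        (varPhase n x₀ Γ (r.1, t) r.2).1 = 0 := by
      intro t ht h0
      obtain ⟨-, ⟨hpU, htI⟩, htx⟩ := key t ht
      rw [← h.dchart_varField hpU htI htx, h0, map_zero]
    have hinj := injOn_of_inner_deriv_pos (v := v) (convex_ball s δ) Metric.isOpen_ball
      (f := fun t ↦ (varPhase n x₀ Γ (r.1, t) r.2).1)
      (f' := fun t ↦ (varPhase n x₀ Γ (r.1, t) r.2).2)
      (fun t ht ↦ h.hasDerivAt_varPhase_fst (key t ht).2.1.1 (key t ht).2.1.2 (key t ht).2.2 r.2)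
      (fun t ht ↦ (key t ht).1)
    intro s₁ hs₁ s₂ hs₂ h₁ h₂
    exact hinj hs₁ hs₂ ((hz s₁ hs₁ h₁).trans (hz s₂ hs₂ h₂).symm)

/-- The absence of conjugate points is stable. -/
theorem eventually_forall_eq_zero [FiniteDimensional ℝ P] (h : IsLightFamily g Γ U a b)
    (hp : p ∈ U) {c d : ℝ} (hcd : Icc c d ⊆ Ioo a b)
    (hinj : ∀ s₁ ∈ Icc c d, ∀ s₂ ∈ Icc c d, s₁ ≠ s₂ → ∀ u, varField n Γ p s₁ u = 0 →
      varField n Γ p s₂ u = 0 → u = 0) :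
    ∀ᶠ p' in 𝓝 p, ∀ s₁ ∈ Icc c d, ∀ s₂ ∈ Icc c d, s₁ ≠ s₂ → ∀ u, varField n Γ p' s₁ u = 0 →
      varField n Γ p' s₂ u = 0 → u = 0 := by
  -- Variation fields are linear in `u`, so unit vectors suffice, and the remaining data form a
  -- compact set.
  have hK : IsCompact (Icc c d ×ˢ Icc c d ×ˢ Metric.sphere (0 : P × ℝ × ℝ) 1) :=
    isCompact_Icc.prod (isCompact_Icc.prod (isCompact_sphere 0 1))
  have hev : ∀ᶠ p' in 𝓝 p, ∀ k ∈ Icc c d ×ˢ Icc c d ×ˢ Metric.sphere (0 : P × ℝ × ℝ) 1,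
      varField n Γ p' k.1 k.2.2 = 0 → varField n Γ p' k.2.1 k.2.2 = 0 → k.1 = k.2.1 := by
    refine hK.eventually_forall_of_forall_eventually
      (P := fun p' (k : ℝ × ℝ × P × ℝ × ℝ) ↦ varField n Γ p' k.1 k.2.2 = 0 →
        varField n Γ p' k.2.1 k.2.2 = 0 → k.1 = k.2.1) ?_
    rintro ⟨s₁, s₂, u⟩ ⟨hs₁, hs₂, hu⟩
    have hu0 : u ≠ 0 := ne_zero_of_mem_unit_sphere ⟨u, hu⟩
    by_cases hs : s₁ = s₂
    · subst hs
      -- On the diagonal the hypothesis gives no information; simplicity of zeros excludes two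
      -- distinct zeros close together.
      obtain ⟨δ, hδ, hev⟩ := h.exists_forall_varField_ne_zero hp (hcd hs₁) hu0
      have hc : Tendsto (fun r : P × ℝ × ℝ × P × ℝ × ℝ ↦ (r.1, r.2.2.2)) (𝓝 (p, s₁, s₁, u))
        (𝓝 (p, u)) := Continuous.tendsto (by fun_prop) (p, s₁, s₁, u)
      have hc1 : Tendsto (fun r : P × ℝ × ℝ × P × ℝ × ℝ ↦ r.2.1) (𝓝 (p, s₁, s₁, u))
        (𝓝 s₁) := Continuous.tendsto (by fun_prop) (p, s₁, s₁, u)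
      have hc2 : Tendsto (fun r : P × ℝ × ℝ × P × ℝ × ℝ ↦ r.2.2.1) (𝓝 (p, s₁, s₁, u))
        (𝓝 s₁) := Continuous.tendsto (by fun_prop) (p, s₁, s₁, u)
      filter_upwards [hc.eventually hev, hc1.eventually (Metric.ball_mem_nhds s₁ hδ),
        hc2.eventually (Metric.ball_mem_nhds s₁ hδ)] with r h1 h2 h3 using h1 _ h2 _ h3
    · have hc1 : Tendsto (fun r : P × ℝ × ℝ × P × ℝ × ℝ ↦ (r.1, r.2.1, r.2.2.2))
        (𝓝 (p, s₁, s₂, u)) (𝓝 (p, s₁, u)) := Continuous.tendsto (by fun_prop) (p, s₁, s₂, u)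
      have hc2 : Tendsto (fun r : P × ℝ × ℝ × P × ℝ × ℝ ↦ (r.1, r.2.2.1, r.2.2.2))
        (𝓝 (p, s₁, s₂, u)) (𝓝 (p, s₂, u)) := Continuous.tendsto (by fun_prop) (p, s₁, s₂, u)
      by_cases h1 : varField n Γ p s₁ u = 0
      · have h2 : varField n Γ p s₂ u ≠ 0 := fun h2 ↦ hu0 (hinj s₁ hs₁ s₂ hs₂ hs u h1 h2)
        filter_upwards [hc2.eventually (h.eventually_varField_ne_zero hp (hcd hs₂) h2)] with r hr _ h'
        exact absurd h' hr
      · filter_upwards [hc1.eventually (h.eventually_varField_ne_zero hp (hcd hs₁) h1)] with r hr h'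
        exact absurd h' hr
  filter_upwards [hev] with p' hp' s₁ hs₁ s₂ hs₂ hs u h1 h2
  by_contra hu
  have hn : ‖u‖ ≠ 0 := norm_ne_zero_iff.2 hu
  refine hs (hp' (s₁, s₂, ‖u‖⁻¹ • u) ⟨hs₁, hs₂, ?_⟩ ?_ ?_)
  · rw [mem_sphere_zero_iff_norm, norm_smul, norm_inv, norm_norm, inv_mul_cancel₀ hn]
  · refine ((varFieldₗ n Γ p' s₁).map_smul _ u).trans ?_
    exact (congrArg _ h1).trans (smul_zero _)
  · refine ((varFieldₗ n Γ p' s₂).map_smul _ u).trans ?_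
    exact (congrArg _ h2).trans (smul_zero _)

end IsLightFamily

/-- Variation fields are Jacobi fields, so one with two zeros on the central ray vanishes
identically and has `u = 0`; stability extends this to nearby rays. -/
theorem LightRayFamily.eventually_forall_eq_zero [T2Space M] {S : LightRayFamily g} (hn : 1 ≤ n)
    (hconj : S.NoConjugatePoints) :
    ∀ᶠ p in 𝓝 (0 : Euc n × Euc (n - 1)), ∀ s₁ ∈ Icc 0 S.ℓ, ∀ s₂ ∈ Icc 0 S.ℓ, s₁ ≠ s₂ →
      ∀ u, varField n S.ray p s₁ u = 0 → varField n S.ray p s₂ u = 0 → u = 0 := by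
  have h := isLightFamily (S := S) hn
  refine h.eventually_forall_eq_zero zero_mem_params Icc_subset ?_
  intro s₁ hs₁ s₂ hs₂ hne u h1 h2
  refine h.eq_zero_of_forall_varField_eq_zero zero_mem_params ⟨0, zero_mem_Ioo⟩ ?_
  by_contra! hu
  exact hconj s₁ hs₁ s₂ hs₂ ⟨hne, fun s ↦ varField n S.ray 0 s u,
    h.isJacobiFieldOn zero_mem_params u, h1, h2, hu⟩

end JacobiFields

/-! ### Conormal covectors of light rays -/

section Conormals

open Filter

variable {n : ℕ} {M : Type*} [TopologicalSpace M] [ChartedSpace (Euc (n + 1)) M]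
  [IsManifold (𝓡 (n + 1)) ∞ M] {g : LorentzMetric n M}

/-- The components, in the chart at `x₀`, of a covector. -/
def coordCovector (x₀ : M) (q : CotangentBundle n M) : Euc (n + 1) →L[ℝ] ℝ :=
  (trivializationAt (Euc (n + 1) →L[ℝ] ℝ) (fun x : M ↦ CotangentSpace n x) x₀ q).2

/-- The bundle coordinates of covectors are dual to the chart coordinates of vectors. Thus
convergence in `T*M` can be tested against coordinate velocities. -/
theorem coordCovector_dchart {x₀ : M} {q : CotangentBundle n M}
    (hq : q.1 ∈ (extChartAt (𝓡 (n + 1)) x₀).source) (v : TangentSpace (𝓡 (n + 1)) q.1) :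
    coordCovector x₀ q (dchart x₀ q.1 v) = q.2 v := by
  rw [mem_source_iff] at hq
  have h1 := TangentBundle.continuousLinearMapAt_trivializationAt (I := 𝓡 (n + 1)) hq
  have hb : q.1 ∈ (trivializationAt (Euc (n + 1))
    (TangentSpace (𝓡 (n + 1)) (M := M)) x₀).baseSet := by simpa using hq
  rw [coordCovector, hom_trivializationAt_apply]
  have h2 : dchart x₀ q.1 v = (trivializationAt (Euc (n + 1))
    (TangentSpace (𝓡 (n + 1)) (M := M)) x₀).continuousLinearMapAt ℝ q.1 v :=
    (DFunLike.congr_fun h1 v).symm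
  rw [h2, ContinuousLinearMap.inCoordinates]
  simp only [ContinuousLinearMap.comp_apply]
  rw [Trivialization.symmL_continuousLinearMapAt _ hb]
  simp

theorem continuousAt_coordCovector {x₀ : M} {q : CotangentBundle n M}
    (hq : q.1 ∈ (extChartAt (𝓡 (n + 1)) x₀).source) :
    ContinuousAt (coordCovector x₀) q := by
  rw [mem_source_iff] at hq
  have he := (trivializationAt (Euc (n + 1) →L[ℝ] ℝ) (fun x : M ↦ CotangentSpace n x)
    x₀).continuousOn_toFun
  refine ContinuousAt.snd (he.continuousAt (((trivializationAt (Euc (n + 1) →L[ℝ] ℝ)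
    (fun x : M ↦ CotangentSpace n x) x₀).open_source).mem_nhds ?_))
  simpa using hq

theorem continuous_proj_cotangentBundle :
    Continuous (fun q : CotangentBundle n M ↦ q.1) :=
  FiberBundle.continuous_proj (Euc (n + 1) →L[ℝ] ℝ) (fun x : M ↦ CotangentSpace n x)

variable {P : Type*} [NormedAddCommGroup P] [NormedSpace ℝ P] [FiniteDimensional ℝ P]
  {Γ : P → ℝ → M} {U : Set P} {a b s : ℝ} {p : P}

/-- The covectors near a spacelike covector conormal to a light ray are conormal to light rays of
the family. -/
theorem IsLightFamily.eventually_exists_conormal (h : IsLightFamily g Γ U a b) (hp : p ∈ U)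
    (hs : s ∈ Ioo a b) {ξ : CotangentSpace n (Γ p s)} (hξ : ξ (velocity n (Γ p) s) = 0)
    (hsp : 0 < g.val (Γ p s) (g.sharp (Γ p s) ξ) (g.sharp (Γ p s) ξ)) {N : Set (P × ℝ)}
    (hN : N ∈ 𝓝 (p, s)) : ∀ᶠ q in 𝓝 (⟨Γ p s, ξ⟩ : CotangentBundle n M),
      ∃ r ∈ N, ∃ η : CotangentSpace n (Γ r.1 r.2), η (velocity n (Γ r.1) r.2) = 0 ∧
        q = ⟨Γ r.1 r.2, η⟩ := by
  have : CompleteSpace P := FiniteDimensional.complete ℝ P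
  obtain ⟨x₀, hx⟩ : ∃ x₀, Γ p s ∈ (extChartAt (𝓡 (n + 1)) x₀).source :=
    ⟨_, mem_extChartAt_source (I := 𝓡 (n + 1)) (Γ p s)⟩
  have hG := IsGeodesicFamily.isCoordMetricAt (g := g) hx
  set G := g.coordMetric x₀
  set Y := famPhase n x₀ Γ
  set w := dchart x₀ (Γ p s) (g.sharp (Γ p s) ξ)
  set l₀ : Euc (n + 1) →L[ℝ] ℝ := G (Y (p, s)).1 w
  have hl₀ : ∀ v, l₀ (dchart x₀ (Γ p s) v) = ξ v := fun v ↦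
    (g.coordMetric_dchart hx _ _).trans (by rw [g.val_sharp])
  have hl₀w : 0 < l₀ w := by
    rw [hl₀]
    rwa [g.val_sharp] at hsp
  have hl₀c : l₀ (Y (p, s)).2 = 0 := by
    rw [← h.dchart_velocity hp hs hx]
    exact (hl₀ _).trans hξ
  -- Position, pairing with the velocity, and the covector itself. Values with middle entry `0` are
  -- conormal covectors, so a surjective derivative makes all nearby covectors conormal to some ray.
  set Θ : (P × ℝ) × (Euc (n + 1) →L[ℝ] ℝ) → Euc (n + 1) × ℝ × (Euc (n + 1) →L[ℝ] ℝ) :=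
    fun r ↦ ((Y r.1).1, r.2 (Y r.1).2, r.2)
  have hY := h.contDiffAt_famPhase hp hs hx
  have hYs : HasStrictFDerivAt Y (fderiv ℝ Y (p, s)) (p, s) := hY.hasStrictFDerivAt (by simp)
  have hYf : HasStrictFDerivAt (fun r : (P × ℝ) × (Euc (n + 1) →L[ℝ] ℝ) ↦ Y r.1)
      ((fderiv ℝ Y (p, s)).comp (ContinuousLinearMap.fst ℝ _ _)) ((p, s), l₀) :=
    HasStrictFDerivAt.comp ((p, s), l₀) (f := fun r : (P × ℝ) × (Euc (n + 1) →L[ℝ] ℝ) ↦ r.1)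
      hYs hasStrictFDerivAt_fst
  have hΘ := hYf.fst.prodMk
    (((hasStrictFDerivAt_snd (𝕜 := ℝ) (p := ((p, s), l₀))).clm_apply hYf.snd).prodMk
      (hasStrictFDerivAt_snd (𝕜 := ℝ) (p := ((p, s), l₀))))
  have hΘ' : HasStrictFDerivAt Θ _ ((p, s), l₀) := hΘ
  have hmap := hΘ'.map_nhds_eq_of_surj ?_
  swap
  · rw [LinearMap.range_eq_top]
    rintro ⟨e, r, m⟩
    obtain ⟨v, hv⟩ := hG.exists_eq_one (h.famPhase_snd_ne_zero hp hs hx)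
    set α := -(fderiv ℝ G (Y (p, s)).1 e (Y (p, s)).2 (Y (p, s)).2) / 2
    -- The coefficient `α` makes the vector tangent to the null cone bundle. The direction `w = ξ^♯`
    -- is free, being orthogonal to `γ'`, and `l₀ w = g⁻¹(ξ, ξ) > 0` lets its coefficient achieve
    -- the prescribed pairing `r`.
    obtain ⟨u, hu⟩ := h.exists_varPhase_eq hp hs hx (X := (e, α • v
      + ((r - m (Y (p, s)).2 - α * l₀ v) / l₀ w) • w)) (by
        rw [hG.fderiv_coordEnergy]
        have hw : G (Y (p, s)).1 (Y (p, s)).2 w = 0 := by rw [hG.symm]; exact hl₀c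
        simp only [map_add, map_smul, smul_eq_mul]
        rw [hv, hw]
        ring)
    have hu1 := congrArg Prod.fst hu
    have hu2 := congrArg (fun X ↦ l₀ X.2) hu
    simp only [varPhase, Prod.fst_add, Prod.smul_fst, smul_zero, add_zero] at hu1
    simp only [varPhase, Prod.snd_add, Prod.smul_snd, map_add, map_smul, smul_eq_mul] at hu2
    rw [div_mul_cancel₀ _ hl₀w.ne', show l₀ (famPhase n x₀ Γ (p, s)).2 = 0 from hl₀c] at hu2
    -- The term `τ γ'` of the variation may be dropped, since `l₀` annihilates `γ'`.
    refine ⟨((u.1, u.2.1 + u.2.2 * s), m), Prod.ext hu1 (Prod.ext ?_ rfl)⟩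
    have hu3 : l₀ (fderiv ℝ Y (p, s) (u.1, u.2.1 + u.2.2 * s)).2 + u.2.2 * 0
      = α * l₀ v + (r - m (Y (p, s)).2 - α * l₀ v) := hu2
    change l₀ (fderiv ℝ Y (p, s) (u.1, u.2.1 + u.2.2 * s)).2 + m (Y (p, s)).2 = r
    linarith
  have hN' : ∀ᶠ r : (P × ℝ) × (Euc (n + 1) →L[ℝ] ℝ) in 𝓝 ((p, s), l₀), r.1 ∈ N ∧
      (r.1.1 ∈ U ∧ r.1.2 ∈ Ioo a b) ∧ Γ r.1.1 r.1.2 ∈ (extChartAt (𝓡 (n + 1)) x₀).source :=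
    (continuous_fst.tendsto ((p, s), l₀)).eventually
      ((show ∀ᶠ r in 𝓝 (p, s), r ∈ N from hN).and (h.eventually hp hs hx))
  have hmem : Θ '' {r | r.1 ∈ N ∧
      (r.1.1 ∈ U ∧ r.1.2 ∈ Ioo a b) ∧ Γ r.1.1 r.1.2 ∈ (extChartAt (𝓡 (n + 1)) x₀).source}
      ∈ 𝓝 (Θ ((p, s), l₀)) := by
    rw [← hmap]
    exact image_mem_map hN'
  set q₀ : CotangentBundle n M := ⟨Γ p s, ξ⟩
  have hproj := continuous_proj_cotangentBundle (n := n) (M := M)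
  have hκ : ContinuousAt (fun q : CotangentBundle n M ↦
      (extChartAt (𝓡 (n + 1)) x₀ q.1, (0 : ℝ), coordCovector x₀ q)) q₀ :=
    (ContinuousAt.comp (f := fun q : CotangentBundle n M ↦ q.1) (x := q₀)
      (continuousAt_extChartAt' (I := 𝓡 (n + 1)) hx) hproj.continuousAt).prodMk
      (continuousAt_const.prodMk (continuousAt_coordCovector hx))
  have hq₀ : (extChartAt (𝓡 (n + 1)) x₀ q₀.1, (0 : ℝ), coordCovector x₀ q₀)
      = Θ ((p, s), l₀) := by
    refine Prod.ext rfl (Prod.ext hl₀c.symm ?_)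
    ext v
    obtain ⟨v, rfl⟩ := dchart_surjective hx v
    exact (coordCovector_dchart (q := q₀) hx v).trans (hl₀ v).symm
  rw [← hq₀] at hmem
  filter_upwards [hκ hmem, eventually_mem_source (hproj.continuousAt (x := q₀)) hx] with q hq hqs
  obtain ⟨⟨r, l⟩, ⟨hrN, hr, hrs⟩, hrq⟩ := hq
  have h1 : Γ r.1 r.2 = q.1 :=
    (extChartAt (𝓡 (n + 1)) x₀).injOn hrs hqs (congrArg Prod.fst hrq)
  have h2 : l (Y r).2 = 0 := congrArg (fun t ↦ t.2.1) hrq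
  have h3 : l = coordCovector x₀ q := congrArg (fun t ↦ t.2.2) hrq
  obtain ⟨x, η⟩ := q
  obtain rfl : Γ r.1 r.2 = x := h1
  refine ⟨r, hrN, η, ?_, rfl⟩
  rw [← coordCovector_dchart (q := ⟨Γ r.1 r.2, η⟩) hqs, ← h3, h.dchart_velocity hr.1 hr.2 hqs]
  exact h2

end Conormals

/-! ### The canonical relation -/

/-- Linear forms which agree on the basis vectors and on the last factor are equal. -/
theorem linearMap_eq_of_forall_single {n : ℕ} {A B : (Euc n × Euc (n - 1)) × ℝ × ℝ →ₗ[ℝ] ℝ}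
    (hz : ∀ j, A ((EuclideanSpace.single j 1, 0), 0) = B ((EuclideanSpace.single j 1, 0), 0))
    (ha : ∀ k, A ((0, EuclideanSpace.single k 1), 0) = B ((0, EuclideanSpace.single k 1), 0))
    (ht : ∀ t, A (0, t) = B (0, t)) : A = B := by
  refine LinearMap.prod_ext (LinearMap.prod_ext ?_ ?_) (LinearMap.ext ht)
  · refine (EuclideanSpace.basisFun (Fin n) ℝ).toBasis.ext fun j ↦ ?_
    simpa using hz j
  · refine (EuclideanSpace.basisFun (Fin (n - 1)) ℝ).toBasis.ext fun k ↦ ?_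
    simpa using ha k

theorem LorentzMetric.ne_zero_of_mem_spacelikeCone {n : ℕ} {M : Type*} [TopologicalSpace M]
    [ChartedSpace (Euc (n + 1)) M] [IsManifold (𝓡 (n + 1)) ∞ M] {g : LorentzMetric n M} {x : M} {ξ : CotangentSpace n x}
    (h : (⟨x, ξ⟩ : CotangentBundle n M) ∈ g.spacelikeCone) : ξ ≠ 0 := by
  rintro rfl
  have h1 : 0 < g.val x (g.sharp x 0) (g.sharp x 0) := h
  rw [g.val_sharp] at h1
  exact lt_irrefl _ h1

namespace LightRayFamily

open Filter

variable {n : ℕ} {M : Type*} [TopologicalSpace M] [T2Space M] [ChartedSpace (Euc (n + 1)) M]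
  [IsManifold (𝓡 (n + 1)) ∞ M] {g : LorentzMetric n M} {S : LightRayFamily g}
  {z : Euc n} {a : Euc (n - 1)} {s : ℝ}

theorem fieldM_eq (hp : (z, a) ∈ S.params) (hs : s ∈ Ioo (-S.ε) (S.ℓ + S.ε)) (j : Fin n) :
    S.fieldM z a s j
      = varField n S.ray (z, a) s ((EuclideanSpace.single j 1, 0), 0, 0) := by
  have h1 : HasMFDerivAt 𝓘(ℝ, Euc n) 𝓘(ℝ, Euc n × Euc (n - 1)) (fun z' : Euc n ↦ (z', a)) z
      ((ContinuousLinearMap.id ℝ (Euc n)).prod (0 : Euc n →L[ℝ] Euc (n - 1))) :=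
    HasFDerivAt.hasMFDerivAt ((hasFDerivAt_id z).prodMk (hasFDerivAt_const a z))
  have h2 := HasMFDerivAt.comp z (f := fun z' : Euc n ↦ (z', a))
    (isGeodesicFamily.mdifferentiableAt_param hp hs).hasMFDerivAt h1
  have h3 : HasMFDerivAt 𝓘(ℝ, Euc n) (𝓡 (n + 1)) (fun z' ↦ S.γ z' a s) z _ := h2
  rw [fieldM, h3.mfderiv, varField, zero_mul, add_zero, zero_smul, add_zero]
  rfl

theorem fieldJ_eq (hp : (z, a) ∈ S.params) (hs : s ∈ Ioo (-S.ε) (S.ℓ + S.ε)) (k : Fin (n - 1)) :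
    S.fieldJ z a s k
      = varField n S.ray (z, a) s ((0, EuclideanSpace.single k 1), 0, 0) := by
  have h1 : HasMFDerivAt 𝓘(ℝ, Euc (n - 1)) 𝓘(ℝ, Euc n × Euc (n - 1))
      (fun a' : Euc (n - 1) ↦ (z, a')) a
      ((0 : Euc (n - 1) →L[ℝ] Euc n).prod (ContinuousLinearMap.id ℝ (Euc (n - 1)))) :=
    HasFDerivAt.hasMFDerivAt ((hasFDerivAt_const z a).prodMk (hasFDerivAt_id a))
  have h2 := HasMFDerivAt.comp a (f := fun a' : Euc (n - 1) ↦ (z, a'))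
    (isGeodesicFamily.mdifferentiableAt_param hp hs).hasMFDerivAt h1
  have h3 : HasMFDerivAt 𝓘(ℝ, Euc (n - 1)) (𝓡 (n + 1)) (fun a' ↦ S.γ z a' s) a _ := h2
  rw [fieldJ, h3.mfderiv, varField, zero_mul, add_zero, zero_smul, add_zero]
  rfl

/-- The base point of `m` fixes the ray. The components `ζ`, `α` and the conormality give equal
values on all variation fields, so `time_eq` identifies the times and `varField_surjective` the
covectors. -/
theorem eq_of_mem_canonicalRelation (hn : 1 ≤ n) {Ω : Set M} {V : Set (Euc n × Euc (n - 1))}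
    (hV : V ⊆ S.params)
    (hinj : ∀ p ∈ V, ∀ s₁ ∈ Icc 0 S.ℓ, ∀ s₂ ∈ Icc 0 S.ℓ, s₁ ≠ s₂ →
      ∀ u, varField n S.ray p s₁ u = 0 → varField n S.ray p s₂ u = 0 → u = 0)
    {m : ParamCotangent n} {q q' : CotangentBundle n M} (hq : (m, q) ∈ S.canonicalRelation Ω V)
    (hq' : (m, q') ∈ S.canonicalRelation Ω V) (hsp : q ∈ g.spacelikeCone) : q' = q := by
  obtain ⟨z, a, hza, s, hs, -, ξ, -, hξ, he⟩ := hq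
  obtain ⟨z', a', -, s', hs', -, η, -, hη, he'⟩ := hq'
  have h := isLightFamily (S := S) hn
  have hp := hV hza
  have hsI := Icc_subset (Ioo_subset_Icc_self hs)
  have hsI' := Icc_subset (Ioo_subset_Icc_self hs')
  obtain ⟨rfl, rfl⟩ := Prod.ext_iff.1 he
  obtain ⟨hm, rfl⟩ := Prod.ext_iff.1 he'
  simp only [Prod.mk.injEq] at hm
  obtain ⟨⟨rfl, rfl⟩, hζ, hα⟩ := hm
  set A : (Euc n × Euc (n - 1)) × ℝ × ℝ →ₗ[ℝ] ℝ :=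
    (ξ.toLinearMap : _ →ₗ[ℝ] ℝ).comp (varFieldₗ n S.ray (z, a) s)
  set B : (Euc n × Euc (n - 1)) × ℝ × ℝ →ₗ[ℝ] ℝ :=
    (η.toLinearMap : _ →ₗ[ℝ] ℝ).comp (varFieldₗ n S.ray (z, a) s')
  have hvel : ∀ (r : ℝ) (κ : TangentSpace (𝓡 (n + 1)) (S.ray (z, a) r) →L[ℝ] ℝ),
      κ (velocity n (S.ray (z, a)) r) = 0 → ∀ t, κ (varField n S.ray (z, a) r (0, t)) = 0 := by
    intro r κ hκ t
    have h0 : varField n S.ray (z, a) r (0, t)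
        = (t.1 + t.2 * r) • velocity n (S.ray (z, a)) r := by
      refine (congrArg (· + _) ?_).trans (zero_add _)
      exact map_zero (mfderiv 𝓘(ℝ, Euc n × Euc (n - 1)) (𝓡 (n + 1)) (fun p' ↦ S.ray p' r) (z, a))
    rw [h0, map_smul, hκ, smul_zero]
  have hAB : A = B := by
    refine linearMap_eq_of_forall_single (fun j ↦ ?_) (fun k ↦ ?_) fun t ↦
      (hvel s ξ hξ t).trans (hvel s' η hη t).symm
    · have := congrFun hζ j
      rw [fieldM_eq hp hsI, fieldM_eq hp hsI'] at this
      exact this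
    · have := congrFun hα k
      rw [fieldJ_eq hp hsI, fieldJ_eq hp hsI'] at this
      exact this
  have hst : s = s' := h.time_eq hp hsI hsI'
    (hinj _ hza s (Ioo_subset_Icc_self hs) s' (Ioo_subset_Icc_self hs')) hξ hsp
    (fun u ↦ DFunLike.congr_fun hAB u)
  subst hst
  have hξη : ξ = η := by
    ext v
    obtain ⟨u, rfl⟩ := h.varField_surjective hp hsI v
    exact DFunLike.congr_fun hAB u
  rw [hξη]

end LightRayFamily

end LightRay

end

/-! ### The theorem on the composition `C⁻¹ ∘ C` -/

theorem lemma3p12 {n : ℕ} (hn : 2 ≤ n) {M : Type*} [TopologicalSpace M] [T2Space M]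
    [ChartedSpace (LightRay.Euc (n + 1)) M] [IsManifold (𝓡 (n + 1)) ∞ M]
    (g : LightRay.LorentzMetric n M) (S : LightRay.LightRayFamily g)
    (Ω : Set M) (hΩ : IsOpen Ω) (hΩc : IsCompact (closure Ω))
    (h0 : S.γ₀ 0 ∉ closure Ω) (hℓ : S.γ₀ S.ℓ ∉ closure Ω)
    (hconj : S.NoConjugatePoints) :
    ∃ W ∈ 𝓝 (0 : LightRay.Euc n × LightRay.Euc (n - 1)),
      ∀ V : Set (LightRay.Euc n × LightRay.Euc (n - 1)), IsOpen V → 0 ∈ V →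
        V ⊆ W → V ⊆ S.params →
      ∃ U : Set (LightRay.CotangentBundle n M), IsOpen U ∧
        {p | p ∈ g.spacelikeCone ∩ S.conormal ∧ p.1 ∈ Ω} ⊆ U ∧
        ∀ p ∈ U ∩ g.spacelikeCone, {q | (p, q) ∈ S.CinvC Ω V} = {p} := by
  have hn' : 1 ≤ n := by omega
  have h := LightRay.LightRayFamily.isLightFamily (S := S) hn'
  refine ⟨_, LightRay.LightRayFamily.eventually_forall_eq_zero hn' hconj, fun V hVo hV0 hVW hVp ↦ ?_⟩
  -- The rays and times admitted in the canonical relation. Covectors in `T` are conormal to such a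
  -- ray, so on `T` the nonzero ones have a nonempty image under `C`.
  set N : Set ((LightRay.Euc n × LightRay.Euc (n - 1)) × ℝ) :=
    {r | (r.1 ∈ V ∧ r.2 ∈ Ioo 0 S.ℓ) ∧ S.ray r.1 r.2 ∈ Ω}
  set T : Set (LightRay.CotangentBundle n M) := {q | ∃ r ∈ N, ∃ η : LightRay.CotangentSpace n (S.ray r.1 r.2),
    η (LightRay.velocity n (S.ray r.1) r.2) = 0 ∧ q = ⟨S.ray r.1 r.2, η⟩}
  refine ⟨interior T, isOpen_interior, ?_, ?_⟩
  · rintro q ⟨⟨hsp, s, hs, ξ, rfl, hξ⟩, hqΩ⟩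
    -- The relation admits only interior times; the endpoints are excluded because they lie outside
    -- the closure of `Ω`.
    have hs' : s ∈ Ioo 0 S.ℓ := by
      refine ⟨lt_of_le_of_ne hs.1 ?_, lt_of_le_of_ne hs.2 ?_⟩
      · rintro rfl
        exact h0 (subset_closure hqΩ)
      · rintro rfl
        exact hℓ (subset_closure hqΩ)
    have hsI := LightRay.LightRayFamily.Icc_subset hs
    refine mem_interior_iff_mem_nhds.2
      (h.eventually_exists_conormal (p := 0) LightRay.LightRayFamily.zero_mem_params hsI hξ hsp ?_)
    have hc : ContinuousAt (fun r : (LightRay.Euc n × LightRay.Euc (n - 1)) × ℝ ↦ S.ray r.1 r.2) (0, s) :=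
      (h.contMDiffAt_param LightRay.LightRayFamily.zero_mem_params hsI).continuousAt
    exact Filter.inter_mem ((hVo.prod isOpen_Ioo).mem_nhds (mk_mem_prod hV0 hs'))
      (hc (hΩ.mem_nhds hqΩ))
  · rintro q ⟨hqT, hsp⟩
    obtain ⟨⟨⟨z, a⟩, s⟩, ⟨⟨hV, hs⟩, hΩr⟩, ξ, hξ, rfl⟩ := interior_subset hqT
    ext q'
    constructor
    · rintro ⟨m, hm, hm'⟩
      exact LightRay.LightRayFamily.eq_of_mem_canonicalRelation hn' hVp (fun p hp ↦ hVW hp) hm hm' hsp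
    · rintro rfl
      have hm : ∃ m, (m, (⟨S.ray (z, a) s, ξ⟩ : LightRay.CotangentBundle n M))
          ∈ S.canonicalRelation Ω V :=
        ⟨_, z, a, hV, s, hs, hΩr, ξ, LightRay.LorentzMetric.ne_zero_of_mem_spacelikeCone hsp, hξ, rfl⟩
      obtain ⟨m, hm⟩ := hm
      exact ⟨m, hm, hm⟩
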